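/- Let $\lambda$ be Lebesgue measure on $\mathbb{C}$, let $|\cdot|_2$ be the Hilbert--Schmidt norm, and let $M_n$ be the algebra of complex $n\times n$ matrices, with $e_1,\dots,e_n$ the standard basis of $\mathbb{C}^n$. For a Borel set $\Omega\subset\mathbb{C}$ let $\Lambda(\Omega)$ be the set of $f\in L^\infty(\Omega,\lambda)$ whose difference quotient $Df(s,t)=\frac{f(s)-f(t)}{s-t}$ is in $L^\infty(\Omega\times\Omega,\lambda\otimes\lambda)$, and let $M_f$ be the operator of multiplication by $f$ on $L^2(\Omega)=L^2(\Omega,\lambda)$. For $T\in\mathcal{B}(L^2(\Omega))$ put $$L(T)=\sup\{\,|[M_f,T]|_2 : f\in\Lambda(\Omega),\ \|Df\|_\infty\le 1\,\},\qquad |||T|||=\|T\|+L(T),$$ and let $E\Lambda(\Omega)=\{T\in\mathcal{B}(L^2(\Omega)) : L(T)<\infty\}$, which is a unital $*$-subalgebra of $\mathcal{B}(L^2(\Omega))$. Let $E\Lambda(\Omega)_0$ be the closure in $E\Lambda(\Omega)$, with respect to $|||\cdot|||$, of the set of all operators $T\oplus 0$ on $L^2(\Omega)=L^2(\Omega_1)\oplus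 L^2(\Omega\setminus\Omega_1)$, where $\Omega_1\subset\Omega$ is a bounded Borel set and $T\in E\Lambda(\Omega_1)$; it is a $*$-subalgebra. Elements $T\otimes m$ of $E\Lambda(\Omega)\otimes M_n$ and $E\Lambda(\Omega)_0\otimes M_n$ (algebraic tensor products) act on $L^2(\Omega)\otimes\mathbb{C}^n$ by $h\otimes v\mapsto Th\otimes mv$. **Proposition.** Let $n\ge 1$ and let $\Omega\subset\mathbb{C}$ be a Borel set. There are $U_1,\dots,U_n\in E\Lambda(\Omega)$ such that $$U:L^2(\Omega)\to L^2(\Omega)\otimes\mathbb{C}^n,\qquad Uh=\sum_{k=1}^n U_kh\otimes e_k,$$ is a unitary operator, with the following properties. 1. $U\,E\Lambda(\Omega)\,U^*=E\Lambda(\Omega)\otimes M_n$ (as sets of operators on $L^2(\Omega)\otimes\mathbb{C}^n$), and $T\mapsto UTU^*$ is an isomorphism of $*$-algebras $E\Lambda(\Omega)\to E\Lambda(\Omega)\otimes M_n$. 2. If $\Omega=\mathbb{C}$, then moreover $U\,E\Lambda(\mathbb{C})_0\,U^*=E\Lambda(\mathbb{C})_0\otimes M_n$, and $T\mapsto UTU^*$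 is an isomorphism of $*$-algebras $E\Lambda(\mathbb{C})_0\to E\Lambda(\mathbb{C})_0\otimes M_n$. -/

import Mathlib

open MeasureTheory
open scoped ENNReal TensorProduct

noncomputable section

/-! ## The Hilbert–Schmidt norm -/

section HilbertSchmidt

variable {H K : Type*} [NormedAddCommGroup H] [InnerProductSpace ℂ H] [CompleteSpace H]
  [NormedAddCommGroup K] [InnerProductSpace ℂ K] [CompleteSpace K]

/-- The Hilbert–Schmidt norm `|T|₂ = (∑ ‖T bᵢ‖²)^(1/2) ∈ [0, ∞]`, computed in a chosen Hilbert
basis. By `hsNorm_eq` below, the basis does not matter. -/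
def hsNorm (T : H →L[ℂ] K) : ℝ≥0∞ :=
  (∑' i, ‖T ((exists_hilbertBasis ℂ H).choose_spec.choose i)‖ₑ ^ 2) ^ (1 / 2 : ℝ)

theorem parseval_enorm {ι : Type*} (b : HilbertBasis ι ℂ H) (x : H) :
    ∑' i, ‖inner ℂ (b i) x‖ₑ ^ 2 = ‖x‖ₑ ^ 2 := by
  have h := (b.hasSum_inner_mul_inner x x)
  have h2 : HasSum (fun i => ‖inner ℂ (b i) x‖ ^ 2) (‖x‖ ^ 2) := by
    have := (Complex.hasSum_re h)
    convert this using 1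
    · ext i
      rw [← inner_conj_symm x (b i), ← Complex.normSq_eq_conj_mul_self, Complex.ofReal_re,
        Complex.normSq_eq_norm_sq]
    · exact (inner_self_eq_norm_sq (𝕜 := ℂ) x).symm
  have h3 : ∀ y : ℝ, 0 ≤ y → ENNReal.ofReal (y ^ 2) = ENNReal.ofReal y ^ 2 :=
    fun y hy => ENNReal.ofReal_pow hy 2
  rw [← ofReal_norm x, ← h3 _ (norm_nonneg _), ← h2.tsum_eq,
    ENNReal.ofReal_tsum_of_nonneg (fun i => by positivity) h2.summable]
  refine tsum_congr fun i => ?_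
  rw [h3 _ (norm_nonneg _), ofReal_norm]

theorem hs_sum_adjoint {ι κ : Type*} (b : HilbertBasis ι ℂ H) (c : HilbertBasis κ ℂ K)
    (T : H →L[ℂ] K) :
    ∑' i, ‖T (b i)‖ₑ ^ 2 = ∑' k, ‖ContinuousLinearMap.adjoint T (c k)‖ₑ ^ 2 := by
  simp_rw [← parseval_enorm c (T _), ← parseval_enorm b (ContinuousLinearMap.adjoint T _)]
  rw [ENNReal.tsum_comm]
  refine tsum_congr fun k => tsum_congr fun i => ?_
  rw [ContinuousLinearMap.adjoint_inner_right, ← inner_conj_symm]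
  rw [← ofReal_norm, RCLike.norm_conj, ofReal_norm]

theorem hsNorm_eq {ι : Type*} (b : HilbertBasis ι ℂ H) (T : H →L[ℂ] K) :
    hsNorm T = (∑' i, ‖T (b i)‖ₑ ^ 2) ^ (1 / 2 : ℝ) := by
  obtain ⟨w, c, -⟩ := exists_hilbertBasis ℂ K
  rw [hsNorm, hs_sum_adjoint _ c, ← hs_sum_adjoint b c]

theorem hsNorm_adjoint (T : H →L[ℂ] K) : hsNorm (ContinuousLinearMap.adjoint T) = hsNorm T := by
  obtain ⟨w, b, -⟩ := exists_hilbertBasis ℂ H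
  obtain ⟨w', c, -⟩ := exists_hilbertBasis ℂ K
  rw [hsNorm_eq b, hsNorm_eq c, hs_sum_adjoint b c]

theorem hsNorm_zero : hsNorm (0 : H →L[ℂ] K) = 0 := by
  simp [hsNorm]

theorem hsNorm_add_le (S T : H →L[ℂ] K) : hsNorm (S + T) ≤ hsNorm S + hsNorm T := by
  obtain ⟨w, b, -⟩ := exists_hilbertBasis ℂ H
  simp only [hsNorm_eq b]
  rw [one_div, ENNReal.rpow_inv_le_iff (by norm_num : (0 : ℝ) < 2)]
  rw [ENNReal.tsum_eq_iSup_sum]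
  refine iSup_le fun s => ?_
  rw [← ENNReal.rpow_inv_le_iff (by norm_num : (0 : ℝ) < 2)]
  have h1 := ENNReal.Lp_add_le s (fun i => ‖S (b i)‖ₑ) (fun i => ‖T (b i)‖ₑ)
    (by norm_num : (1 : ℝ) ≤ 2)
  simp only [one_div] at h1
  have key : ∀ f : w → ℝ≥0∞, ∑ i ∈ s, f i ^ (2 : ℝ) = ∑ i ∈ s, f i ^ 2 :=
    fun f => Finset.sum_congr rfl fun i _ => ENNReal.rpow_two _
  simp only [key] at h1
  calc (∑ i ∈ s, ‖(S + T) (b i)‖ₑ ^ 2) ^ (2 : ℝ)⁻¹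
      ≤ (∑ i ∈ s, (‖S (b i)‖ₑ + ‖T (b i)‖ₑ) ^ 2) ^ (2 : ℝ)⁻¹ := by
        gcongr with i hi
        exact enorm_add_le _ _
    _ ≤ _ := h1
    _ ≤ _ := by
        gcongr <;> exact ENNReal.sum_le_tsum _

theorem hsNorm_comp_le {G : Type*} [NormedAddCommGroup G] [InnerProductSpace ℂ G] [CompleteSpace G]
    (A : K →L[ℂ] G) (T : H →L[ℂ] K) : hsNorm (A ∘L T) ≤ ‖A‖ₑ * hsNorm T := by
  obtain ⟨w, b, -⟩ := exists_hilbertBasis ℂ H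
  simp only [hsNorm_eq b]
  have : ‖A‖ₑ = (‖A‖ₑ ^ 2) ^ (1 / 2 : ℝ) := by
    rw [← ENNReal.rpow_two, ← ENNReal.rpow_mul]; norm_num
  rw [this, ← ENNReal.mul_rpow_of_nonneg _ _ (by norm_num), ← ENNReal.tsum_mul_left]
  gcongr with i
  rw [← mul_pow]
  gcongr
  exact A.le_opENorm _

theorem hsNorm_comp_le' {G : Type*} [NormedAddCommGroup G] [InnerProductSpace ℂ G]
    [CompleteSpace G] (T : K →L[ℂ] G) (A : H →L[ℂ] K) : hsNorm (T ∘L A) ≤ hsNorm T * ‖A‖ₑ := by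
  rw [← hsNorm_adjoint, ContinuousLinearMap.adjoint_comp, mul_comm, ← hsNorm_adjoint T]
  refine (hsNorm_comp_le _ _).trans_eq ?_
  congr 1
  rw [← ofReal_norm, ← ofReal_norm, LinearIsometryEquiv.norm_map]

end HilbertSchmidt

namespace ELam

/-! ## The algebras -/

/-- Lebesgue measure `λ` on `Ω ⊆ ℂ`. -/
abbrev leb (Ω : Set ℂ) : Measure ℂ := volume.restrict Ω

/-- The Hilbert space `L²(Ω, λ)`. -/
abbrev L2 (Ω : Set ℂ) : Type := Lp ℂ 2 (leb Ω)

/-- The multiplication operator `M_f` on `L²(Ω, λ)`, for `f ∈ L^∞(Ω, λ)`. -/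
def mulOp {Ω : Set ℂ} (f : Lp ℂ ∞ (leb Ω)) : L2 Ω →L[ℂ] L2 Ω :=
  (ContinuousLinearMap.mul ℂ ℂ).holderL (leb Ω) ∞ 2 2 f

/-- The difference quotient `Df(s,t) = (f(s) - f(t)) / (s - t)`. -/
def diffQuot {Ω : Set ℂ} (f : Lp ℂ ∞ (leb Ω)) (p : ℂ × ℂ) : ℂ :=
  (f p.1 - f p.2) / (p.1 - p.2)

/-- The space `Λ(Ω)` of essentially Lipschitz functions: those `f ∈ L^∞(Ω)` with
`Df ∈ L^∞(Ω × Ω)`. -/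
def lipAlg (Ω : Set ℂ) : Set (Lp ℂ ∞ (leb Ω)) :=
  {f | MemLp (diffQuot f) ∞ ((leb Ω).prod (leb Ω))}

/-- `L(T) = sup {|[M_f, T]|₂ : f ∈ Λ(Ω), ‖Df‖_∞ ≤ 1} ∈ [0, ∞]`. -/
def lipNorm {Ω : Set ℂ} (T : L2 Ω →L[ℂ] L2 Ω) : ℝ≥0∞ :=
  ⨆ f ∈ {f ∈ lipAlg Ω | eLpNorm (diffQuot f) ∞ ((leb Ω).prod (leb Ω)) ≤ 1},
    hsNorm (mulOp f * T - T * mulOp f)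

/-- The norm `|||T||| = ‖T‖ + L(T)`. -/
def tripleNorm {Ω : Set ℂ} (T : L2 Ω →L[ℂ] L2 Ω) : ℝ≥0∞ := ‖T‖ₑ + lipNorm T

section Basic

variable {Ω : Set ℂ}

theorem coeFn_mulOp (f : Lp ℂ ∞ (leb Ω)) (g : L2 Ω) :
    mulOp f g =ᵐ[leb Ω] fun x => f x * g x :=
  (ContinuousLinearMap.mul ℂ ℂ).coeFn_holder f g

theorem mulOp_adjoint (f : Lp ℂ ∞ (leb Ω)) : star (mulOp f) = mulOp (star f) := by
  rw [ContinuousLinearMap.star_eq_adjoint]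
  symm
  rw [ContinuousLinearMap.eq_adjoint_iff]
  intro g h
  rw [L2.inner_def, L2.inner_def]
  refine integral_congr_ae ?_
  filter_upwards [coeFn_mulOp f h, coeFn_mulOp (star f) g, Lp.coeFn_star f] with x h1 h2 h3
  simp only [h1, h2, h3, Pi.star_apply, RCLike.inner_apply, map_mul, RCLike.star_def,
    RCLike.conj_conj]
  ring

theorem diffQuot_star (f : Lp ℂ ∞ (leb Ω)) :
    ∀ᵐ p ∂((leb Ω).prod (leb Ω)), ‖diffQuot (star f) p‖ = ‖diffQuot f p‖ := by
  have h1 := Measure.quasiMeasurePreserving_fst (μ := leb Ω) (ν := leb Ω) |>.ae (Lp.coeFn_star f)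
  have h2 := Measure.quasiMeasurePreserving_snd (μ := leb Ω) (ν := leb Ω) |>.ae (Lp.coeFn_star f)
  filter_upwards [h1, h2] with p h1 h2
  simp only [diffQuot, h1, h2, Pi.star_apply, norm_div, ← star_sub, norm_star]

theorem aestronglyMeasurable_diffQuot (f : Lp ℂ ∞ (leb Ω)) :
    AEStronglyMeasurable (diffQuot f) ((leb Ω).prod (leb Ω)) := by
  have h := (Lp.aestronglyMeasurable f)
  have h1 := h.comp_fst (ν := leb Ω)
  have h2 := h.comp_snd (μ := leb Ω)
  exact ((h1.sub h2).aemeasurable.div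
    (measurable_fst.sub measurable_snd).aemeasurable).aestronglyMeasurable

theorem eLpNorm_diffQuot_star (f : Lp ℂ ∞ (leb Ω)) :
    eLpNorm (diffQuot (star f)) ∞ ((leb Ω).prod (leb Ω)) =
      eLpNorm (diffQuot f) ∞ ((leb Ω).prod (leb Ω)) :=
  eLpNorm_congr_norm_ae (diffQuot_star f)

theorem le_lipNorm (T : L2 Ω →L[ℂ] L2 Ω) (f : Lp ℂ ∞ (leb Ω))
    (hf : eLpNorm (diffQuot f) ∞ ((leb Ω).prod (leb Ω)) ≤ 1) :
    hsNorm (mulOp f * T - T * mulOp f) ≤ lipNorm T :=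
  le_iSup₂_of_le f ⟨⟨aestronglyMeasurable_diffQuot f, hf.trans_lt ENNReal.one_lt_top⟩, hf⟩ le_rfl

theorem lipNorm_le (T : L2 Ω →L[ℂ] L2 Ω) (C : ℝ≥0∞)
    (h : ∀ f : Lp ℂ ∞ (leb Ω), eLpNorm (diffQuot f) ∞ ((leb Ω).prod (leb Ω)) ≤ 1 →
      hsNorm (mulOp f * T - T * mulOp f) ≤ C) : lipNorm T ≤ C :=
  iSup₂_le fun f hf => h f hf.2

theorem lipNorm_add_le (S T : L2 Ω →L[ℂ] L2 Ω) : lipNorm (S + T) ≤ lipNorm S + lipNorm T := by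
  refine lipNorm_le _ _ fun f hf => ?_
  have : mulOp f * (S + T) - (S + T) * mulOp f
      = (mulOp f * S - S * mulOp f) + (mulOp f * T - T * mulOp f) := by noncomm_ring
  rw [this]
  exact (hsNorm_add_le _ _).trans (add_le_add (le_lipNorm _ f hf) (le_lipNorm _ f hf))

theorem lipNorm_mul_le (S T : L2 Ω →L[ℂ] L2 Ω) :
    lipNorm (S * T) ≤ lipNorm S * ‖T‖ₑ + ‖S‖ₑ * lipNorm T := by
  refine lipNorm_le _ _ fun f hf => ?_
  have : mulOp f * (S * T) - (S * T) * mulOp f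
      = (mulOp f * S - S * mulOp f) * T + S * (mulOp f * T - T * mulOp f) := by noncomm_ring
  rw [this]
  refine (hsNorm_add_le _ _).trans (add_le_add ?_ ?_)
  · exact (hsNorm_comp_le' _ _).trans (by gcongr; exact le_lipNorm _ f hf)
  · exact (hsNorm_comp_le _ _).trans (by gcongr; exact le_lipNorm _ f hf)

theorem lipNorm_star_le (T : L2 Ω →L[ℂ] L2 Ω) : lipNorm (star T) ≤ lipNorm T := by
  refine lipNorm_le _ _ fun f hf => ?_
  have : mulOp f * star T - star T * mulOp f
      = star (-1 * (mulOp (star f) * T - T * mulOp (star f))) := by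
    simp only [star_mul, star_sub, mulOp_adjoint, star_star, star_neg, star_one]
    noncomm_ring
  rw [this, ContinuousLinearMap.star_eq_adjoint, hsNorm_adjoint]
  refine (hsNorm_comp_le _ _).trans ?_
  refine (mul_le_mul_left (α := ℝ≥0∞) (b := ‖(-1 : L2 Ω →L[ℂ] L2 Ω)‖ₑ) (c := 1) ?_ _).trans ?_
  · rw [enorm_neg, ← ofReal_norm]
    exact ENNReal.ofReal_le_one.2 ContinuousLinearMap.norm_id_le
  · rw [one_mul]
    exact le_lipNorm T (star f) (by rwa [eLpNorm_diffQuot_star])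

theorem lipNorm_star (T : L2 Ω →L[ℂ] L2 Ω) : lipNorm (star T) = lipNorm T :=
  le_antisymm (lipNorm_star_le T) (by simpa using lipNorm_star_le (star T))

theorem lipNorm_algebraMap (c : ℂ) : lipNorm (algebraMap ℂ (L2 Ω →L[ℂ] L2 Ω) c) = 0 := by
  refine le_antisymm (lipNorm_le _ _ fun f _ => ?_) bot_le
  rw [Algebra.commutes, sub_self, hsNorm_zero]

theorem tripleNorm_add_le (S T : L2 Ω →L[ℂ] L2 Ω) :
    tripleNorm (S + T) ≤ tripleNorm S + tripleNorm T :=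
  (add_le_add (enorm_add_le S T) (lipNorm_add_le S T)).trans_eq (by simp only [tripleNorm]; ring)

theorem enorm_op_mul_le (S T : L2 Ω →L[ℂ] L2 Ω) : ‖S * T‖ₑ ≤ ‖S‖ₑ * ‖T‖ₑ := by
  simp only [← ofReal_norm]
  rw [← ENNReal.ofReal_mul (norm_nonneg _)]
  exact ENNReal.ofReal_le_ofReal (norm_mul_le S T)

theorem tripleNorm_mul_le (S T : L2 Ω →L[ℂ] L2 Ω) :
    tripleNorm (S * T) ≤ tripleNorm S * tripleNorm T := by
  refine (add_le_add (enorm_op_mul_le S T) (lipNorm_mul_le S T)).trans ?_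
  simp only [tripleNorm, add_mul, mul_add]
  rw [← add_assoc]
  calc ‖S‖ₑ * ‖T‖ₑ + lipNorm S * ‖T‖ₑ + ‖S‖ₑ * lipNorm T
      ≤ ‖S‖ₑ * ‖T‖ₑ + lipNorm S * ‖T‖ₑ + ‖S‖ₑ * lipNorm T + lipNorm S * lipNorm T :=
        le_self_add
    _ = _ := by ring

theorem tripleNorm_star (T : L2 Ω →L[ℂ] L2 Ω) : tripleNorm (star T) = tripleNorm T := by
  rw [tripleNorm, tripleNorm, lipNorm_star, ContinuousLinearMap.star_eq_adjoint, ← ofReal_norm,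
    ← ofReal_norm, LinearIsometryEquiv.norm_map]

theorem tripleNorm_zero : tripleNorm (0 : L2 Ω →L[ℂ] L2 Ω) = 0 := by
  have := lipNorm_algebraMap (Ω := Ω) 0
  rw [map_zero] at this
  rw [tripleNorm, this, add_zero, ← ofReal_norm, norm_zero, ENNReal.ofReal_zero]

theorem tripleNorm_algebraMap_lt_top (c : ℂ) :
    tripleNorm (algebraMap ℂ (L2 Ω →L[ℂ] L2 Ω) c) < ∞ := by
  rw [tripleNorm, lipNorm_algebraMap, add_zero]
  exact enorm_lt_top

theorem tripleNorm_lt_top_iff (T : L2 Ω →L[ℂ] L2 Ω) : tripleNorm T < ∞ ↔ lipNorm T < ∞ := by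
  simp [tripleNorm, ENNReal.add_lt_top]

end Basic

/-- The involutive algebra `EΛ(Ω) = {T ∈ B(L²(Ω, λ)) : L(T) < ∞}`. -/
def EL (Ω : Set ℂ) : StarSubalgebra ℂ (L2 Ω →L[ℂ] L2 Ω) where
  carrier := {T | lipNorm T < ∞}
  mul_mem' {S T} hS hT := (lipNorm_mul_le S T).trans_lt
    (ENNReal.add_lt_top.2 ⟨ENNReal.mul_lt_top hS enorm_lt_top, ENNReal.mul_lt_top enorm_lt_top hT⟩)
  add_mem' {S T} hS hT := (lipNorm_add_le S T).trans_lt (ENNReal.add_lt_top.2 ⟨hS, hT⟩)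
  algebraMap_mem' c := by simp [lipNorm_algebraMap]
  star_mem' {T} hT := (lipNorm_star_le T).trans_lt hT

theorem mem_EL {Ω : Set ℂ} {T : L2 Ω →L[ℂ] L2 Ω} : T ∈ EL Ω ↔ lipNorm T < ∞ := Iff.rfl

/-! ## The inclusions `i(Ω₂, Ω₁)` -/

section Inclusion

variable {Ω₁ Ω₂ Ω₃ : Set ℂ}

theorem leb_mono (h : Ω₁ ⊆ Ω₂) : leb Ω₁ ≤ leb Ω₂ := Measure.restrict_mono h le_rfl

/-- Restriction of functions, `L^p(Ω₂) → L^p(Ω₁)`, for `Ω₁ ⊆ Ω₂`. -/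
def resFun {p : ℝ≥0∞} (h : Ω₁ ⊆ Ω₂) (g : Lp ℂ p (leb Ω₂)) : Lp ℂ p (leb Ω₁) :=
  ((Lp.memLp g).mono_measure (leb_mono h)).toLp g

theorem coeFn_resFun {p : ℝ≥0∞} (h : Ω₁ ⊆ Ω₂) (g : Lp ℂ p (leb Ω₂)) :
    resFun h g =ᵐ[leb Ω₁] g := MemLp.coeFn_toLp _

theorem ae_leb_mono (h : Ω₁ ⊆ Ω₂) {P : ℂ → Prop} (hP : ∀ᵐ x ∂(leb Ω₂), P x) :
    ∀ᵐ x ∂(leb Ω₁), P x := ae_mono (leb_mono h) hP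

/-- Restriction of functions as a bounded operator `L²(Ω₂) → L²(Ω₁)`. -/
def resOp (h : Ω₁ ⊆ Ω₂) : L2 Ω₂ →L[ℂ] L2 Ω₁ :=
  LinearMap.mkContinuous
    { toFun := resFun h
      map_add' := fun f g => by
        apply Lp.ext
        filter_upwards [coeFn_resFun h (f + g), Lp.coeFn_add (resFun h f) (resFun h g),
          coeFn_resFun h f, coeFn_resFun h g, ae_leb_mono h (Lp.coeFn_add f g)]
          with x h1 h2 h3 h4 h5
        simp only [h1, h2, h3, h4, h5, Pi.add_apply]
      map_smul' := fun c f => by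
        apply Lp.ext
        filter_upwards [coeFn_resFun h (c • f), Lp.coeFn_smul c (resFun h f),
          coeFn_resFun h f, ae_leb_mono h (Lp.coeFn_smul c f)] with x h1 h2 h3 h4
        simp only [RingHom.id_apply, h1, h2, h3, h4, Pi.smul_apply] }
    1 (fun f => by
      rw [one_mul]
      change ‖resFun h f‖ ≤ _
      rw [Lp.norm_def, Lp.norm_def]
      refine ENNReal.toReal_mono (Lp.eLpNorm_ne_top f) ?_
      rw [eLpNorm_congr_ae (coeFn_resFun h f)]
      exact eLpNorm_mono_measure _ (leb_mono h))

theorem leb_restrict (h : Ω₁ ⊆ Ω₂) (hm : MeasurableSet Ω₁) :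
    (leb Ω₂).restrict Ω₁ = leb Ω₁ := by
  rw [leb, Measure.restrict_restrict hm, Set.inter_eq_self_of_subset_left h]

/-- Extension of a function by zero, from `Ω₁` to `Ω₂ ⊇ Ω₁`. -/
def extFun (h : Ω₁ ⊆ Ω₂) (hm : MeasurableSet Ω₁) (g : L2 Ω₁) : L2 Ω₂ :=
  MemLp.toLp (Ω₁.indicator g) ((memLp_indicator_iff_restrict hm).2
    ((leb_restrict h hm).symm ▸ Lp.memLp g))

theorem coeFn_extFun (h : Ω₁ ⊆ Ω₂) (hm : MeasurableSet Ω₁) (g : L2 Ω₁) :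
    extFun h hm g =ᵐ[leb Ω₂] Ω₁.indicator g := MemLp.coeFn_toLp _

theorem ae_leb_imp (h : Ω₁ ⊆ Ω₂) (hm : MeasurableSet Ω₁) {P : ℂ → Prop}
    (hP : ∀ᵐ x ∂(leb Ω₁), P x) : ∀ᵐ x ∂(leb Ω₂), x ∈ Ω₁ → P x := by
  rw [← leb_restrict h hm] at hP
  exact (ae_restrict_iff' hm).1 hP

/-- Extension by zero as a bounded operator `L²(Ω₁) → L²(Ω₂)`; it is the inclusion of the first
summand of `L²(Ω₂) = L²(Ω₁) ⊕ L²(Ω₂ ∖ Ω₁)`. -/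
def extOp (h : Ω₁ ⊆ Ω₂) (hm : MeasurableSet Ω₁) : L2 Ω₁ →L[ℂ] L2 Ω₂ :=
  LinearMap.mkContinuous
    { toFun := extFun h hm
      map_add' := fun f g => by
        apply Lp.ext
        filter_upwards [coeFn_extFun h hm (f + g), Lp.coeFn_add (extFun h hm f) (extFun h hm g),
          coeFn_extFun h hm f, coeFn_extFun h hm g, ae_leb_imp h hm (Lp.coeFn_add f g)]
          with x h1 h2 h3 h4 h5
        rw [h1, h2, Pi.add_apply, h3, h4]
        by_cases hx : x ∈ Ω₁
        · simp only [Set.indicator_of_mem hx, h5 hx, Pi.add_apply]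
        · simp only [Set.indicator_of_notMem hx, add_zero]
      map_smul' := fun c f => by
        apply Lp.ext
        filter_upwards [coeFn_extFun h hm (c • f), Lp.coeFn_smul c (extFun h hm f),
          coeFn_extFun h hm f, ae_leb_imp h hm (Lp.coeFn_smul c f)] with x h1 h2 h3 h4
        by_cases hx : x ∈ Ω₁ <;> simp [h1, h2, h3, h4, hx] }
    1 (fun f => by
      rw [one_mul]
      change ‖extFun h hm f‖ ≤ _
      rw [Lp.norm_def, Lp.norm_def]
      refine ENNReal.toReal_mono (Lp.eLpNorm_ne_top f) ?_
      rw [eLpNorm_congr_ae (coeFn_extFun h hm f), eLpNorm_indicator_eq_eLpNorm_restrict hm,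
        leb_restrict h hm])

/-- The inclusion homomorphism `i(Ω₂, Ω₁)(T) = T ⊕ 0`, with respect to
`L²(Ω₂) = L²(Ω₁) ⊕ L²(Ω₂ ∖ Ω₁)`. -/
def incl (h : Ω₁ ⊆ Ω₂) (hm : MeasurableSet Ω₁) (T : L2 Ω₁ →L[ℂ] L2 Ω₁) : L2 Ω₂ →L[ℂ] L2 Ω₂ :=
  extOp h hm ∘L T ∘L resOp h

theorem coeFn_resOp (h : Ω₁ ⊆ Ω₂) (g : L2 Ω₂) : resOp h g =ᵐ[leb Ω₁] g := coeFn_resFun h g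

theorem coeFn_extOp (h : Ω₁ ⊆ Ω₂) (hm : MeasurableSet Ω₁) (g : L2 Ω₁) :
    extOp h hm g =ᵐ[leb Ω₂] Ω₁.indicator g := coeFn_extFun h hm g

theorem resOp_extOp (h : Ω₁ ⊆ Ω₂) (hm : MeasurableSet Ω₁) (g : L2 Ω₁) :
    resOp h (extOp h hm g) = g := by
  apply Lp.ext
  filter_upwards [coeFn_resOp h (extOp h hm g), ae_leb_mono h (coeFn_extOp h hm g),
    ae_restrict_mem hm] with x h1 h2 h3
  rw [h1, h2, Set.indicator_of_mem h3]

theorem extOp_adjoint (h : Ω₁ ⊆ Ω₂) (hm : MeasurableSet Ω₁) :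
    ContinuousLinearMap.adjoint (extOp h hm) = resOp h := by
  symm
  rw [ContinuousLinearMap.eq_adjoint_iff]
  intro g f
  rw [L2.inner_def, L2.inner_def]
  have hi : ∀ F : ℂ → ℂ, ∫ x, F x ∂(leb Ω₁) = ∫ x, Ω₁.indicator F x ∂(leb Ω₂) := fun F => by
    rw [integral_indicator hm, leb_restrict h hm]
  rw [hi]
  refine integral_congr_ae ?_
  filter_upwards [coeFn_extOp h hm f, ae_leb_imp h hm (coeFn_resOp h g)] with x h1 h2
  by_cases hx : x ∈ Ω₁ <;> simp [h1, h2, hx]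

theorem incl_add (h : Ω₁ ⊆ Ω₂) (hm : MeasurableSet Ω₁) (S T : L2 Ω₁ →L[ℂ] L2 Ω₁) :
    incl h hm (S + T) = incl h hm S + incl h hm T := by
  ext1 x; simp [incl]

theorem incl_mul (h : Ω₁ ⊆ Ω₂) (hm : MeasurableSet Ω₁) (S T : L2 Ω₁ →L[ℂ] L2 Ω₁) :
    incl h hm (S * T) = incl h hm S * incl h hm T := by
  ext1 x; simp [incl, resOp_extOp]

theorem incl_star (h : Ω₁ ⊆ Ω₂) (hm : MeasurableSet Ω₁) (T : L2 Ω₁ →L[ℂ] L2 Ω₁) :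
    incl h hm (star T) = star (incl h hm T) := by
  rw [ContinuousLinearMap.star_eq_adjoint, ContinuousLinearMap.star_eq_adjoint, incl, incl,
    ContinuousLinearMap.adjoint_comp, ContinuousLinearMap.adjoint_comp, extOp_adjoint,
    ← extOp_adjoint h hm, ContinuousLinearMap.adjoint_adjoint, ContinuousLinearMap.comp_assoc]

theorem incl_incl (h : Ω₁ ⊆ Ω₂) (h' : Ω₂ ⊆ Ω₃) (hm : MeasurableSet Ω₁) (hm' : MeasurableSet Ω₂)
    (T : L2 Ω₁ →L[ℂ] L2 Ω₁) : incl h' hm' (incl h hm T) = incl (h.trans h') hm T := by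
  have hr : ∀ x, resOp h (resOp h' x) = resOp (h.trans h') x := fun x => by
    apply Lp.ext
    filter_upwards [coeFn_resOp h (resOp h' x), ae_leb_mono h (coeFn_resOp h' x),
      coeFn_resOp (h.trans h') x] with z h1 h2 h3
    rw [h1, h2, h3]
  have he : ∀ x, extOp h' hm' (extOp h hm x) = extOp (h.trans h') hm x := fun x => by
    apply Lp.ext
    filter_upwards [coeFn_extOp h' hm' (extOp h hm x), ae_leb_imp h' hm' (coeFn_extOp h hm x),
      coeFn_extOp (h.trans h') hm x] with z h1 h2 h3
    rw [h1, h3]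
    by_cases hz : z ∈ Ω₂
    · rw [Set.indicator_of_mem hz, h2 hz]
    · rw [Set.indicator_of_notMem hz, Set.indicator_of_notMem (fun h4 => hz (h h4))]
  ext1 x
  simp [incl, hr, he]

theorem resOp_mulOp (h : Ω₁ ⊆ Ω₂) (f : Lp ℂ ∞ (leb Ω₂)) (g : L2 Ω₂) :
    resOp h (mulOp f g) = mulOp (resFun h f) (resOp h g) := by
  apply Lp.ext
  filter_upwards [coeFn_resOp h (mulOp f g), ae_leb_mono h (coeFn_mulOp f g),
    coeFn_mulOp (resFun h f) (resOp h g), coeFn_resFun h f, coeFn_resOp h g] with x h1 h2 h3 h4 h5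
  rw [h1, h2, h3, h4, h5]

theorem mulOp_extOp (h : Ω₁ ⊆ Ω₂) (hm : MeasurableSet Ω₁) (f : Lp ℂ ∞ (leb Ω₂)) (g : L2 Ω₁) :
    mulOp f (extOp h hm g) = extOp h hm (mulOp (resFun h f) g) := by
  apply Lp.ext
  filter_upwards [coeFn_mulOp f (extOp h hm g), coeFn_extOp h hm g,
    coeFn_extOp h hm (mulOp (resFun h f) g), ae_leb_imp h hm (coeFn_mulOp (resFun h f) g),
    ae_leb_imp h hm (coeFn_resFun h f)] with x h1 h2 h3 h4 h5
  rw [h1, h2, h3]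
  by_cases hx : x ∈ Ω₁
  · simp [hx, h4, h5]
  · simp [hx]

theorem eLpNorm_diffQuot_resFun_le (h : Ω₁ ⊆ Ω₂) (f : Lp ℂ ∞ (leb Ω₂)) :
    eLpNorm (diffQuot (resFun h f)) ∞ ((leb Ω₁).prod (leb Ω₁)) ≤
      eLpNorm (diffQuot f) ∞ ((leb Ω₂).prod (leb Ω₂)) := by
  have h1 := Measure.quasiMeasurePreserving_fst (μ := leb Ω₁) (ν := leb Ω₁) |>.ae
    (coeFn_resFun h f)
  have h2 := Measure.quasiMeasurePreserving_snd (μ := leb Ω₁) (ν := leb Ω₁) |>.ae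
    (coeFn_resFun h f)
  have : diffQuot (resFun h f) =ᵐ[(leb Ω₁).prod (leb Ω₁)] diffQuot f := by
    filter_upwards [h1, h2] with p h1 h2
    simp only [diffQuot, h1, h2]
  rw [eLpNorm_congr_ae this]
  exact eLpNorm_mono_measure _ (Measure.prod_mono (leb_mono h) (leb_mono h))

theorem lipNorm_incl_le (h : Ω₁ ⊆ Ω₂) (hm : MeasurableSet Ω₁) (T : L2 Ω₁ →L[ℂ] L2 Ω₁) :
    lipNorm (incl h hm T) ≤ ‖extOp h hm‖ₑ * (lipNorm T * ‖resOp h‖ₑ) := by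
  refine lipNorm_le _ _ fun f hf => ?_
  have : mulOp f * incl h hm T - incl h hm T * mulOp f =
      extOp h hm ∘L (mulOp (resFun h f) * T - T * mulOp (resFun h f)) ∘L resOp h := by
    ext1 x
    simp [incl, mulOp_extOp, resOp_mulOp]
  rw [this]
  refine (hsNorm_comp_le _ _).trans ?_
  gcongr
  refine (hsNorm_comp_le' _ _).trans ?_
  gcongr
  exact le_lipNorm T _ ((eLpNorm_diffQuot_resFun_le h f).trans hf)

theorem incl_mem_EL (h : Ω₁ ⊆ Ω₂) (hm : MeasurableSet Ω₁) {T : L2 Ω₁ →L[ℂ] L2 Ω₁}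
    (hT : T ∈ EL Ω₁) : incl h hm T ∈ EL Ω₂ :=
  (lipNorm_incl_le h hm T).trans_lt
    (ENNReal.mul_lt_top enorm_lt_top (ENNReal.mul_lt_top hT enorm_lt_top))

end Inclusion

/-- The union of the `i(Ω, Ω₁) EΛ(Ω₁)` over all bounded Borel sets `Ω₁ ⊆ Ω`. -/
def bddPart (Ω : Set ℂ) : Set (L2 Ω →L[ℂ] L2 Ω) :=
  {T | ∃ (Ω₁ : Set ℂ) (h : Ω₁ ⊆ Ω) (hm : MeasurableSet Ω₁), Bornology.IsBounded Ω₁ ∧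
    ∃ S ∈ EL Ω₁, T = incl h hm S}

section BddPart

variable {Ω : Set ℂ} {S T : L2 Ω →L[ℂ] L2 Ω}

theorem bddPart_subset : bddPart Ω ⊆ EL Ω := by
  rintro _ ⟨Ω₁, h, hm, -, S, hS, rfl⟩
  exact incl_mem_EL h hm hS

theorem bddPart_common (hS : S ∈ bddPart Ω) (hT : T ∈ bddPart Ω) :
    ∃ (Ω₁ : Set ℂ) (h : Ω₁ ⊆ Ω) (hm : MeasurableSet Ω₁), Bornology.IsBounded Ω₁ ∧
      ∃ S' ∈ EL Ω₁, ∃ T' ∈ EL Ω₁, S = incl h hm S' ∧ T = incl h hm T' := by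
  obtain ⟨Ω₁, h, hm, hb, S', hS', rfl⟩ := hS
  obtain ⟨Ω₂, h', hm', hb', T', hT', rfl⟩ := hT
  refine ⟨Ω₁ ∪ Ω₂, Set.union_subset h h', hm.union hm', hb.union hb',
    incl Set.subset_union_left hm S', incl_mem_EL _ _ hS',
    incl Set.subset_union_right hm' T', incl_mem_EL _ _ hT', ?_, ?_⟩ <;> rw [incl_incl]

theorem bddPart_add (hS : S ∈ bddPart Ω) (hT : T ∈ bddPart Ω) : S + T ∈ bddPart Ω := by
  obtain ⟨Ω₁, h, hm, hb, S', hS', T', hT', rfl, rfl⟩ := bddPart_common hS hT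
  exact ⟨Ω₁, h, hm, hb, S' + T', add_mem hS' hT', (incl_add _ _ _ _).symm⟩

theorem bddPart_mul (hS : S ∈ bddPart Ω) (hT : T ∈ bddPart Ω) : S * T ∈ bddPart Ω := by
  obtain ⟨Ω₁, h, hm, hb, S', hS', T', hT', rfl, rfl⟩ := bddPart_common hS hT
  exact ⟨Ω₁, h, hm, hb, S' * T', mul_mem hS' hT', (incl_mul _ _ _ _).symm⟩

theorem bddPart_star (hT : T ∈ bddPart Ω) : star T ∈ bddPart Ω := by
  obtain ⟨Ω₁, h, hm, hb, T', hT', rfl⟩ := hT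
  exact ⟨Ω₁, h, hm, hb, star T', star_mem hT', (incl_star _ _ _).symm⟩

theorem bddPart_smul (c : ℂ) (hT : T ∈ bddPart Ω) : c • T ∈ bddPart Ω := by
  obtain ⟨Ω₁, h, hm, hb, T', hT', rfl⟩ := hT
  exact ⟨Ω₁, h, hm, hb, c • T', (EL Ω₁).smul_mem hT' c, by ext1 x; simp [incl]⟩

theorem bddPart_zero : (0 : L2 Ω →L[ℂ] L2 Ω) ∈ bddPart Ω :=
  ⟨∅, Set.empty_subset _, MeasurableSet.empty, Bornology.isBounded_empty, 0, zero_mem _, by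
    ext1 x; simp [incl]⟩

end BddPart

/-- The algebra `EΛ(Ω)₀`: the closure, in `EΛ(Ω)` with its norm `|||·|||`, of the union of the
`i(Ω, Ω₁) EΛ(Ω₁)` over all bounded Borel sets `Ω₁ ⊆ Ω`. -/
def EL0 (Ω : Set ℂ) : NonUnitalStarSubalgebra ℂ (L2 Ω →L[ℂ] L2 Ω) where
  carrier := {T | T ∈ EL Ω ∧ ∀ ε : ℝ≥0∞, 0 < ε → ∃ S ∈ bddPart Ω, tripleNorm (T - S) < ε}
  zero_mem' := ⟨zero_mem _, fun ε hε => ⟨0, bddPart_zero, by simpa [tripleNorm_zero] using hε⟩⟩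
  add_mem' := by
    rintro T T' ⟨h, ha⟩ ⟨h', ha'⟩
    refine ⟨add_mem h h', fun ε hε => ?_⟩
    obtain ⟨S, hS, hSε⟩ := ha (ε / 2) (ENNReal.half_pos hε.ne')
    obtain ⟨S', hS', hSε'⟩ := ha' (ε / 2) (ENNReal.half_pos hε.ne')
    refine ⟨S + S', bddPart_add hS hS', ?_⟩
    rw [add_sub_add_comm]
    calc _ ≤ _ := tripleNorm_add_le _ _
      _ < ε / 2 + ε / 2 := ENNReal.add_lt_add hSε hSε'
      _ = ε := ENNReal.add_halves ε
  smul_mem' := by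
    rintro c T ⟨h, ha⟩
    refine ⟨(EL Ω).smul_mem h c, fun ε hε => ?_⟩
    obtain ⟨δ, hδ, hδε⟩ := ENNReal.exists_pos_mul_lt
      (tripleNorm_algebraMap_lt_top (Ω := Ω) c).ne hε.ne'
    obtain ⟨S, hS, hSε⟩ := ha δ hδ
    refine ⟨c • S, bddPart_smul c hS, ?_⟩
    rw [← smul_sub, Algebra.smul_def]
    refine (tripleNorm_mul_le _ _).trans_lt (lt_of_le_of_lt ?_ hδε)
    rw [mul_comm]
    gcongr
  mul_mem' := by
    rintro T T' ⟨h, ha⟩ ⟨h', ha'⟩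
    refine ⟨mul_mem h h', fun ε hε => ?_⟩
    have hε2 := ENNReal.half_pos hε.ne'
    obtain ⟨δ', hδ', hδε'⟩ := ENNReal.exists_pos_mul_lt
      ((tripleNorm_lt_top_iff T).2 h).ne hε2.ne'
    obtain ⟨S', hS', hSε'⟩ := ha' δ' hδ'
    obtain ⟨δ, hδ, hδε⟩ := ENNReal.exists_pos_mul_lt
      ((tripleNorm_lt_top_iff S').2 (bddPart_subset hS')).ne hε2.ne'
    obtain ⟨S, hS, hSε⟩ := ha δ hδ
    refine ⟨S * S', bddPart_mul hS hS', ?_⟩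
    have : T * T' - S * S' = T * (T' - S') + (T - S) * S' := by noncomm_ring
    rw [this]
    calc _ ≤ _ := tripleNorm_add_le _ _
      _ ≤ tripleNorm T * tripleNorm (T' - S') + tripleNorm (T - S) * tripleNorm S' :=
        add_le_add (tripleNorm_mul_le _ _) (tripleNorm_mul_le _ _)
      _ ≤ δ' * tripleNorm T + δ * tripleNorm S' := by
        rw [mul_comm (tripleNorm T)]
        gcongr
      _ < ε / 2 + ε / 2 := ENNReal.add_lt_add hδε' hδε
      _ = ε := ENNReal.add_halves ε
  star_mem' := by
    rintro T ⟨h, ha⟩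
    refine ⟨star_mem h, fun ε hε => ?_⟩
    obtain ⟨S, hS, hSε⟩ := ha ε hε
    exact ⟨star S, bddPart_star hS, by rwa [← star_sub, tripleNorm_star]⟩

/-! ## Operators on `L²(Ω) ⊗ ℂⁿ` -/

/-- The Hilbert space `ℂⁿ`. -/
abbrev Cn (n : ℕ) : Type := EuclideanSpace ℂ (Fin n)

/-- The algebra `M_n` of complex `n × n` matrices. -/
abbrev Mn (n : ℕ) : Type := Matrix (Fin n) (Fin n) ℂ

/-- The operator on `L²(Ω) ⊗ ℂⁿ` given by an element of `A ⊗ M_n`, where `A` is represented on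
`L²(Ω)` by `j`: the tensor `a ⊗ m` acts by `h ⊗ v ↦ j(a) h ⊗ m v`. -/
def tensorOp {Ω : Set ℂ} {A : Type*} [AddCommGroup A] [Module ℂ A]
    (j : A →ₗ[ℂ] (L2 Ω →L[ℂ] L2 Ω)) (n : ℕ) :
    A ⊗[ℂ] Mn n →ₗ[ℂ] Module.End ℂ (L2 Ω ⊗[ℂ] Cn n) :=
  TensorProduct.homTensorHomMap (RingHom.id ℂ) (L2 Ω) (Cn n) (L2 Ω) (Cn n) ∘ₗ
    TensorProduct.map (ContinuousLinearMap.coeLM ℂ ∘ₗ j) (Matrix.toEuclideanLin).toLinearMap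

/-- The representation of `EΛ(Ω) ⊗ M_n` on `L²(Ω) ⊗ ℂⁿ`. -/
def ELtensorOp (Ω : Set ℂ) (n : ℕ) :
    EL Ω ⊗[ℂ] Mn n →ₗ[ℂ] Module.End ℂ (L2 Ω ⊗[ℂ] Cn n) :=
  tensorOp (EL Ω).subtype.toAlgHom.toLinearMap n

/-- The representation of `EΛ(Ω)₀ ⊗ M_n` on `L²(Ω) ⊗ ℂⁿ`. -/
def EL0tensorOp (Ω : Set ℂ) (n : ℕ) :
    EL0 Ω ⊗[ℂ] Mn n →ₗ[ℂ] Module.End ℂ (L2 Ω ⊗[ℂ] Cn n) :=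
  tensorOp ((EL0 Ω).toNonUnitalSubalgebra.toSubmodule.subtype) n

/-- The operator `U T U*` on `L²(Ω) ⊗ ℂⁿ`. -/
def conjBy {Ω : Set ℂ} {n : ℕ} (U : L2 Ω ≃ₗᵢ[ℂ] L2 Ω ⊗[ℂ] Cn n) (T : L2 Ω →L[ℂ] L2 Ω) :
    Module.End ℂ (L2 Ω ⊗[ℂ] Cn n) :=
  U.toLinearEquiv.conj T

end ELam

end

/-! It suffices to find isometries R, W in EΛ(Ω) with RR* + WW* = 1. Words in R* and W* then give
coisometries V_1, …, V_n in EΛ(Ω) with V_j V_k* = δ_jk and ∑ V_k* V_k = 1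
(`exists_complementary_isometries`). The map U with components V_k is unitary, UTU* has matrix
entries V_k T V_l*, and the inverse correspondence is (T_kl) ↦ ∑ V_k* T_kl V_l; both stay inside the
algebra.

For R, take a Parseval frame v_i and an orthonormal family e_i and put Rh = ∑ ⟨v_i, h⟩ e_i. If v_i
and e_i are concentrated near the same point x_i and f is 1-Lipschitz, both are approximate
eigenvectors of M_f with eigenvalue f(x_i). Hence |[M_f, R]|₂² is bounded, uniformly in f, by the
sums of the second moments of |v_i|² and |e_i|² about x_i (`hsNorm_commutator_frameOp_sq_le`).

The crux is a Parseval frame whose second moments have a small sum (`exists_concentrated_frame`).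
Dimension two is critical: scale 2^{-m} has 4^m squares in a unit square, each with moment of order
4^{-m}, so every scale costs a constant and the sum over all scales diverges. The scales are
therefore mixed with weights b_k(m), ∑_k b_k(m)² = 1, that vary slowly with m; only the differences
b_k(m) - b_k(m+1) enter the moments, and their squares have an arbitrarily small sum
(`exists_slow_partition`).

For W there is a swindle (`exists_isometries`): with infinitely many such isometries R_l of mutually
orthogonal ranges, W maps ran R_l onto ran R_{l+1} by R_{l+1} R_l* and is the identity on the rest.
Its range is the complement of ran R_0.

For EΛ(ℂ)₀, all frame vectors live in single unit squares, so R and W commute with restriction to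
unions of unit squares. Multiplying by them enlarges a bounded support only to the bounded union of
the squares it meets (`mul_EL0_mul`). -/

noncomputable section

/-! ## Bessel families and the operators they define -/

namespace Bessel

open ContinuousLinearMap
open scoped NNReal ComplexConjugate

variable {H : Type*} [NormedAddCommGroup H] [InnerProductSpace ℂ H] {ι κ : Type*}

/-- A family `v` is Bessel with bound `B` if `∑ |⟨vᵢ, h⟩|² ≤ B² ‖h‖²` for all `h`. -/
def IsBessel (B : ℝ≥0) (v : ι → H) : Prop :=
  ∀ h, ∑' i, ‖inner ℂ (v i) h‖ₑ ^ 2 ≤ (B : ℝ≥0∞) ^ 2 * ‖h‖ₑ ^ 2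

theorem enorm_sq_lp (f : lp (fun _ : ι => ℂ) 2) : ‖f‖ₑ ^ 2 = ∑' i, ‖f i‖ₑ ^ 2 := by
  have h := lp.hasSum_norm (p := 2) (by norm_num) f
  simp only [ENNReal.toReal_ofNat, Real.rpow_two] at h
  have h3 : ∀ y : ℝ, 0 ≤ y → ENNReal.ofReal (y ^ 2) = ENNReal.ofReal y ^ 2 :=
    fun y hy => ENNReal.ofReal_pow hy 2
  rw [← ofReal_norm, ← h3 _ (norm_nonneg _), ← h.tsum_eq,
    ENNReal.ofReal_tsum_of_nonneg (fun i => by positivity) h.summable]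
  refine tsum_congr fun i => ?_
  rw [h3 _ (norm_nonneg _), ofReal_norm]

theorem memℓp_two_of_tsum_lt_top {f : ι → ℂ} (hf : ∑' i, ‖f i‖ₑ ^ 2 < ∞) : Memℓp f 2 := by
  refine memℓp_gen ?_
  simp only [ENNReal.toReal_ofNat, Real.rpow_two]
  have h1 : ∀ i, ‖f i‖ₑ ^ 2 = ((‖f i‖₊ ^ 2 : ℝ≥0) : ℝ≥0∞) := fun i => by
    rw [ENNReal.coe_pow]; rfl
  simp only [h1] at hf
  have := ENNReal.tsum_coe_ne_top_iff_summable.1 hf.ne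
  simpa only [NNReal.coe_pow, coe_nnnorm] using NNReal.summable_coe.2 this

/-- The analysis operator `h ↦ (⟨vᵢ, h⟩)ᵢ` of a Bessel family. -/
def analysisOp {B : ℝ≥0} {v : ι → H} (hv : IsBessel B v) : H →L[ℂ] lp (fun _ : ι => ℂ) 2 :=
  LinearMap.mkContinuous
    { toFun := fun h => ⟨fun i => inner ℂ (v i) h, memℓp_two_of_tsum_lt_top
        ((hv h).trans_lt (ENNReal.mul_lt_top (by simp) (by simp)))⟩
      map_add' := fun x y => by ext i; exact inner_add_right _ _ _
      map_smul' := fun c x => by ext i; exact inner_smul_right _ _ _ }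
    B (fun h => by
      have h1 := enorm_sq_lp (⟨fun i => inner ℂ (v i) h, memℓp_two_of_tsum_lt_top
        ((hv h).trans_lt (ENNReal.mul_lt_top (by simp) (by simp)))⟩ : lp (fun _ : ι => ℂ) 2)
      have h2 := h1.trans_le (hv h)
      simp only [← mul_pow] at h2
      have h3 := (ENNReal.pow_le_pow_left_iff two_ne_zero).1 h2
      have h4 := ENNReal.toReal_mono (by finiteness) h3
      simpa using h4)

@[simp] theorem analysisOp_apply {B : ℝ≥0} {v : ι → H} (hv : IsBessel B v) (h : H) (i : ι) :
    analysisOp hv h i = inner ℂ (v i) h := rfl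

theorem enorm_analysisOp_le {B : ℝ≥0} {v : ι → H} (hv : IsBessel B v) :
    ‖analysisOp hv‖ₑ ≤ B := by
  have : ‖analysisOp hv‖ ≤ B := LinearMap.mkContinuous_norm_le _ B.2 _
  rw [← ofReal_norm]
  exact (ENNReal.ofReal_le_ofReal this).trans_eq (by simp)

theorem enorm_sq_analysisOp_apply {B : ℝ≥0} {v : ι → H} (hv : IsBessel B v) (h : H) :
    ‖analysisOp hv h‖ₑ ^ 2 = ∑' i, ‖inner ℂ (v i) h‖ₑ ^ 2 := enorm_sq_lp _

theorem add_sq_le_ennreal (a b : ℝ≥0∞) : (a + b) ^ 2 ≤ 2 * a ^ 2 + 2 * b ^ 2 := by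
  have := ENNReal.rpow_add_le_mul_rpow_add_rpow a b (p := 2) (by norm_num)
  norm_num at this
  rwa [mul_add] at this

theorem enorm_add_sq_le {E : Type*} [NormedAddCommGroup E] (a b : E) :
    ‖a + b‖ₑ ^ 2 ≤ 2 * ‖a‖ₑ ^ 2 + 2 * ‖b‖ₑ ^ 2 :=
  (pow_le_pow_left' (enorm_add_le a b) 2).trans (add_sq_le_ennreal _ _)

theorem enorm_sub_sq_le {E : Type*} [NormedAddCommGroup E] (a b : E) :
    ‖a - b‖ₑ ^ 2 ≤ 2 * ‖a‖ₑ ^ 2 + 2 * ‖b‖ₑ ^ 2 := by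
  simpa [sub_eq_add_neg] using enorm_add_sq_le a (-b)

theorem enorm_inner_le (x y : H) : ‖inner ℂ x y‖ₑ ≤ ‖x‖ₑ * ‖y‖ₑ := by
  simp only [← ofReal_norm]
  rw [← ENNReal.ofReal_mul (norm_nonneg _)]
  exact ENNReal.ofReal_le_ofReal (norm_inner_le_norm x y)

/-- Cauchy–Schwarz in each term. This makes the error vectors A e_i - c_i e_i admissible in
`frameOp`. -/
theorem isBessel_of_tsum_lt_top {w : ι → H} (hw : ∑' i, ‖w i‖ₑ ^ 2 < ∞) :
    ∃ B, IsBessel B w := by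
  refine ⟨((∑' i, ‖w i‖ₑ ^ 2) ^ (1 / 2 : ℝ)).toNNReal, fun h => ?_⟩
  rw [ENNReal.coe_toNNReal (ENNReal.rpow_ne_top_of_nonneg (by norm_num) hw.ne),
    ← ENNReal.rpow_two, ← ENNReal.rpow_mul]
  norm_num
  rw [← ENNReal.tsum_mul_right]
  refine ENNReal.tsum_le_tsum fun i => ?_
  rw [← mul_pow]
  gcongr
  exact enorm_inner_le _ _

theorem isBessel_of_orthonormal {e : ι → H} (he : Orthonormal ℂ e) : IsBessel 1 e := fun h => by
  have h1 := he.tsum_inner_products_le (x := h)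
  have h2 := he.inner_products_summable (x := h)
  have h3 : ∀ y : ℝ, 0 ≤ y → ENNReal.ofReal (y ^ 2) = ENNReal.ofReal y ^ 2 :=
    fun y hy => ENNReal.ofReal_pow hy 2
  simp only [ENNReal.coe_one, one_pow, one_mul, ← ofReal_norm]
  rw [← h3 _ (norm_nonneg h)]
  refine le_trans (le_of_eq ?_) (ENNReal.ofReal_le_ofReal h1)
  rw [ENNReal.ofReal_tsum_of_nonneg (fun i => by positivity) h2]
  exact tsum_congr fun i => (h3 _ (norm_nonneg _)).symm

variable [CompleteSpace H]

/-- The operator `h ↦ ∑ᵢ ⟨vᵢ, h⟩ eᵢ` of two Bessel families. -/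
def frameOp {B B' : ℝ≥0} {e v : ι → H} (he : IsBessel B e) (hv : IsBessel B' v) : H →L[ℂ] H :=
  adjoint (analysisOp he) ∘L analysisOp hv

theorem hasSum_inner_frameOp {B B' : ℝ≥0} {e v : ι → H} (he : IsBessel B e) (hv : IsBessel B' v)
    (h g : H) :
    HasSum (fun i => inner ℂ (e i) g * conj (inner ℂ (v i) h)) (inner ℂ (frameOp he hv h) g) := by
  rw [frameOp, coe_comp, Function.comp_apply, adjoint_inner_left]
  exact lp.hasSum_inner (analysisOp hv h) (analysisOp he g)

theorem inner_frameOp {B B' : ℝ≥0} {e v : ι → H} (he : IsBessel B e) (hv : IsBessel B' v)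
    (h g : H) :
    inner ℂ (frameOp he hv h) g = ∑' i, inner ℂ (e i) g * conj (inner ℂ (v i) h) :=
  (hasSum_inner_frameOp he hv h g).tsum_eq.symm

theorem frameOp_adjoint {B B' : ℝ≥0} {e v : ι → H} (he : IsBessel B e) (hv : IsBessel B' v) :
    adjoint (frameOp he hv) = frameOp hv he := by
  simp [frameOp, adjoint_comp]

theorem hsNorm_sq_eq {K : Type*} [NormedAddCommGroup K] [InnerProductSpace ℂ K] [CompleteSpace K]
    (b : HilbertBasis ι ℂ H) (T : H →L[ℂ] K) : hsNorm T ^ 2 = ∑' i, ‖T (b i)‖ₑ ^ 2 := by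
  rw [hsNorm_eq b, ← ENNReal.rpow_two, ← ENNReal.rpow_mul]
  norm_num

theorem hsNorm_analysisOp_sq {B : ℝ≥0} {v : ι → H} (hv : IsBessel B v) :
    hsNorm (analysisOp hv) ^ 2 = ∑' i, ‖v i‖ₑ ^ 2 := by
  obtain ⟨w, b, -⟩ := exists_hilbertBasis ℂ H
  rw [hsNorm_sq_eq b]
  simp only [enorm_sq_analysisOp_apply, ← parseval_enorm b (v _)]
  rw [ENNReal.tsum_comm]
  refine tsum_congr fun i => tsum_congr fun j => ?_
  rw [← inner_conj_symm, ← ofReal_norm, RCLike.norm_conj, ofReal_norm]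

/-- Passing to the adjoint and exchanging the two sums shows that a Parseval frame computes
Hilbert–Schmidt norms as well as an orthonormal basis does. -/
theorem tsum_enorm_sq_apply_of_parseval {v : ι → H}
    (hv : ∀ h, ∑' i, ‖inner ℂ (v i) h‖ₑ ^ 2 = ‖h‖ₑ ^ 2) (A : H →L[ℂ] H) :
    ∑' i, ‖A (v i)‖ₑ ^ 2 = hsNorm A ^ 2 := by
  obtain ⟨w, b, -⟩ := exists_hilbertBasis ℂ H
  rw [← hsNorm_adjoint, hsNorm_sq_eq b]
  rw [tsum_congr fun i => (parseval_enorm b (A (v i))).symm,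
    tsum_congr fun j => (hv (adjoint A (b j))).symm, ENNReal.tsum_comm]
  refine tsum_congr fun i => tsum_congr fun j => ?_
  rw [adjoint_inner_right, ← inner_conj_symm, ← ofReal_norm, RCLike.norm_conj, ofReal_norm]

/-- The Hilbert–Schmidt norm of a commutator `[A, ∑ᵢ ⟨vᵢ, ·⟩ eᵢ]`, when `vᵢ` and `eᵢ` are
approximate eigenvectors of `A` for the same approximate eigenvalue. -/
theorem hsNorm_commutator_frameOp_sq_le {B B' : ℝ≥0} {e v : ι → H} (he : IsBessel B e)
    (hv : IsBessel B' v) (A : H →L[ℂ] H) (c : ι → ℂ)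
    (h1 : ∑' i, ‖A (e i) - c i • e i‖ₑ ^ 2 < ∞)
    (h2 : ∑' i, ‖star A (v i) - conj (c i) • v i‖ₑ ^ 2 < ∞) :
    hsNorm (A * frameOp he hv - frameOp he hv * A) ^ 2 ≤
      2 * (B' ^ 2 * ∑' i, ‖A (e i) - c i • e i‖ₑ ^ 2) +
      2 * (B ^ 2 * ∑' i, ‖star A (v i) - conj (c i) • v i‖ₑ ^ 2) := by
  obtain ⟨C, hw⟩ := isBessel_of_tsum_lt_top h1
  obtain ⟨C', hu⟩ := isBessel_of_tsum_lt_top h2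
  -- The scalars c_i enter both terms of the commutator and cancel; what is left is built from the
  -- error vectors, whose analysis operators are Hilbert–Schmidt.
  have key : A * frameOp he hv - frameOp he hv * A = frameOp hw hv - frameOp he hu := by
    ext1 h
    refine ext_inner_right ℂ fun g => ?_
    change inner ℂ (A (frameOp he hv h) - frameOp he hv (A h)) g =
      inner ℂ (frameOp hw hv h - frameOp he hu h) g
    rw [inner_sub_left, inner_sub_left, ← adjoint_inner_right A]
    refine HasSum.unique ((hasSum_inner_frameOp he hv h _).sub (hasSum_inner_frameOp he hv (A h) g))
      ?_
    convert (hasSum_inner_frameOp hw hv h g).sub (hasSum_inner_frameOp he hu h g) using 2 with i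
    rw [star_eq_adjoint, adjoint_inner_right, inner_sub_left, inner_sub_left, adjoint_inner_left,
      inner_smul_left, inner_smul_left, map_sub, map_mul, Complex.conj_conj]
    ring
  rw [key, sub_eq_add_neg]
  refine (pow_le_pow_left' (hsNorm_add_le _ _) 2).trans ((add_sq_le_ennreal _ _).trans ?_)
  have hneg : hsNorm (-(frameOp he hu)) = hsNorm (frameOp he hu) := by simp [hsNorm]
  rw [hneg]
  refine add_le_add (mul_le_mul_right ?_ 2) (mul_le_mul_right ?_ 2)
  · rw [← hsNorm_analysisOp_sq hw, ← mul_pow]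
    gcongr
    refine (hsNorm_comp_le' _ _).trans ?_
    rw [hsNorm_adjoint, mul_comm]
    gcongr
    exact enorm_analysisOp_le hv
  · rw [← hsNorm_analysisOp_sq hu, ← mul_pow]
    gcongr
    refine (hsNorm_comp_le _ _).trans ?_
    gcongr
    rw [← ofReal_norm, LinearIsometryEquiv.norm_map, ofReal_norm]
    exact enorm_analysisOp_le he

end Bessel

/-! ## Two isometries with complementary ranges -/

namespace Bessel

open ContinuousLinearMap Filter Topology
open scoped NNReal ComplexConjugate

variable {H : Type*} [NormedAddCommGroup H] [InnerProductSpace ℂ H] [CompleteSpace H]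
  {ι : Type*}

theorem op_mul_apply (S T : H →L[ℂ] H) (h : H) : (S * T) h = S (T h) := rfl

theorem op_one_apply (h : H) : (1 : H →L[ℂ] H) h = h := rfl

theorem isBessel_of_parseval {v : ι → H}
    (hv : ∀ h, ∑' i, ‖inner ℂ (v i) h‖ₑ ^ 2 = ‖h‖ₑ ^ 2) : IsBessel 1 v :=
  fun h => by simp [hv]

theorem frameOp_self_of_parseval {v : ι → H}
    (hv : ∀ h, ∑' i, ‖inner ℂ (v i) h‖ₑ ^ 2 = ‖h‖ₑ ^ 2) :
    frameOp (isBessel_of_parseval hv) (isBessel_of_parseval hv) = 1 := by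
  refine (norm_map_iff_adjoint_comp_self _).1 fun h => ?_
  have h1 := enorm_sq_analysisOp_apply (isBessel_of_parseval hv) h
  rw [hv] at h1
  have h2 := congrArg ENNReal.toReal h1
  simp only [ENNReal.toReal_pow, toReal_enorm] at h2
  exact (pow_left_inj₀ (norm_nonneg _) (norm_nonneg _) two_ne_zero).1 h2

theorem inner_frameOp_of_orthonormal {B B' : ℝ≥0} {e v : ι → H} (he : Orthonormal ℂ e)
    (he' : IsBessel B e) (hv : IsBessel B' v) (i : ι) (h : H) :
    inner ℂ (e i) (frameOp he' hv h) = inner ℂ (v i) h := by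
  rw [← inner_conj_symm, inner_frameOp, tsum_eq_single i]
  · simp [he.1]
  · intro j hj
    rw [he.2 hj, zero_mul]

theorem inner_frameOp_frameOp_of_inner_eq_zero {κ : Type*} {e : ι → H} {e' : κ → H}
    (hee : ∀ i j, inner ℂ (e i) (e' j) = 0) {B B' C C' : ℝ≥0} {v : ι → H} {v' : κ → H}
    (he : IsBessel C e) (he' : IsBessel C' e') (hv : IsBessel B v) (hv' : IsBessel B' v') (h g : H) :
    inner ℂ (frameOp he hv h) (frameOp he' hv' g) = 0 := by
  rw [inner_frameOp]
  refine (tsum_congr fun i => ?_).trans tsum_zero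
  rw [← inner_conj_symm, inner_frameOp]
  have : ∑' i', inner ℂ (e' i') (e i) * conj (inner ℂ (v' i') g) = 0 := by
    refine (tsum_congr fun i' => ?_).trans tsum_zero
    rw [← inner_conj_symm, hee, map_zero, zero_mul]
  rw [this]
  simp

theorem star_frameOp_mul_frameOp {B : ℝ≥0} {e v : ι → H} (he : Orthonormal ℂ e)
    (he' : IsBessel B e) (hv : ∀ h, ∑' i, ‖inner ℂ (v i) h‖ₑ ^ 2 = ‖h‖ₑ ^ 2) :
    star (frameOp he' (isBessel_of_parseval hv)) * frameOp he' (isBessel_of_parseval hv) = 1 := by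
  ext1 h
  refine ext_inner_right ℂ fun g => ?_
  rw [star_eq_adjoint, mul_def, comp_apply, adjoint_inner_left, inner_frameOp]
  simp only [inner_frameOp_of_orthonormal he]
  rw [← inner_frameOp (isBessel_of_parseval hv) (isBessel_of_parseval hv),
    frameOp_self_of_parseval hv]

section Shift

variable {R : ℕ → H →L[ℂ] H} {W : H →L[ℂ] H}

theorem hasSum_sub_of_tendsto_zero {s : ℂ} {t : ℕ → ℂ} (ht : Tendsto t atTop (𝓝 0))
    (hs : HasSum (fun l => t (l + 1) - t l) s) : s = - t 0 := by
  refine tendsto_nhds_unique hs.tendsto_sum_nat ?_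
  simp only [Finset.sum_range_sub]
  simpa using ht.sub_const (t 0)

-- `hW` is the weak form of W = 1 + ∑ (R_{l+1} - R_l) R_l*: the shift ran R_l → ran R_{l+1},
-- extended by the identity on the complement of all the ranges.
variable (hiso : ∀ l, star (R l) * R l = 1) (hort : ∀ l m, l ≠ m → star (R l) * R m = 0)
  (hzero : ∀ h, Tendsto (fun l => star (R l) h) atTop (𝓝 0))
  (hW : ∀ h g, HasSum (fun l => inner ℂ ((R (l + 1) - R l) (star (R l) h)) g)
    (inner ℂ (W h - h) g))

include hiso hort hW

theorem shift_apply (l : ℕ) (h : H) : W (R l h) = R (l + 1) h := by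
  refine ext_inner_right ℂ fun g => ?_
  have h1 : HasSum (fun m => inner ℂ ((R (m + 1) - R m) (star (R m) (R l h))) g)
      (inner ℂ ((R (l + 1) - R l) h) g) := by
    have := hasSum_single (f := fun m => inner ℂ ((R (m + 1) - R m) (star (R m) (R l h))) g) l
      (fun m hm => by
        rw [← op_mul_apply (star (R m)), hort m l hm]; simp)
    rwa [← op_mul_apply (star (R l)), hiso, op_one_apply] at this
  have h2 := (hW (R l h) g).unique h1
  rw [sub_apply, inner_sub_left, inner_sub_left] at h2
  exact sub_left_injective h2

theorem star_mul_shift_zero (h : H) : star (R 0) (W h) = 0 := by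
  refine ext_inner_right ℂ fun g => ?_
  rw [star_eq_adjoint, adjoint_inner_left, inner_zero_left]
  have h2 := hW h (R 0 g)
  have key : ∀ l, inner ℂ ((R (l + 1) - R l) (star (R l) h)) (R 0 g) =
      if l = 0 then - inner ℂ (star (R 0) h) g else 0 := fun l => by
    rw [← adjoint_inner_left (R 0), ← star_eq_adjoint, ← op_mul_apply, mul_sub, hort _ _ (by omega)]
    split_ifs with hl
    · rw [hl, hiso]; simp
    · rw [hort _ _ (Ne.symm hl)]; simp
  simp only [key] at h2
  have h3 := h2.unique (hasSum_ite_eq 0 _)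
  rw [inner_sub_left, star_eq_adjoint, adjoint_inner_left] at h3
  linear_combination h3

theorem star_mul_shift_succ (m : ℕ) (h : H) : star (R (m + 1)) (W h) = star (R m) h := by
  refine ext_inner_right ℂ fun g => ?_
  rw [star_eq_adjoint, adjoint_inner_left]
  have h2 := hW h (R (m + 1) g)
  have key : ∀ l, inner ℂ ((R (l + 1) - R l) (star (R l) h)) (R (m + 1) g) =
      (if l = m then inner ℂ (star (R m) h) g else 0) +
      (if l = m + 1 then - inner ℂ (star (R (m + 1)) h) g else 0) := fun l => by
    rw [← adjoint_inner_left (R (m + 1)), ← star_eq_adjoint, ← op_mul_apply, mul_sub]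
    by_cases hl : l = m
    · subst hl
      rw [hiso, hort _ _ (by omega)]; simp
    · by_cases hl' : l = m + 1
      · subst hl'
        rw [hiso, hort _ _ (by omega)]; simp
      · rw [hort _ _ (by omega), hort _ _ (by omega)]; simp [hl, hl']
  simp only [key] at h2
  have h3 := h2.unique ((hasSum_ite_eq m _).add (hasSum_ite_eq (m + 1) _))
  rw [inner_sub_left, star_eq_adjoint, star_eq_adjoint, adjoint_inner_left (R (m + 1))] at h3
  rw [star_eq_adjoint]
  linear_combination h3

include hzero

/-- Expanding ⟨Wh, Wg⟩ - ⟨h, g⟩ by `hW` gives a series that telescopes in t_l = ⟨R_l* h, R_l* Wg⟩.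
Here t_l → 0 by `hzero`, and t_0 = 0 because R_0* W = 0. -/
theorem star_shift_mul_shift : star W * W = 1 := by
  ext1 h
  refine ext_inner_right ℂ fun g => ?_
  rw [op_mul_apply, star_eq_adjoint, adjoint_inner_left, op_one_apply]
  have h1 := hW h (W g)
  have h2 := (Complex.hasSum_conj'.2 (hW g h))
  have h3 := h1.add h2
  simp only [inner_conj_symm] at h3
  have h4 := hasSum_sub_of_tendsto_zero
    (t := fun l => inner ℂ (star (R l) h) (star (R l) (W g)))
    (by simpa using (hzero h).inner (𝕜 := ℂ) (hzero (W g))) (s := _) (by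
      convert h3 using 2 with l
      simp only [star_mul_shift_succ hiso hort hW, sub_apply, inner_sub_left, inner_sub_right]
      rw [← adjoint_inner_right (R (l + 1)), ← adjoint_inner_right (R l),
        ← adjoint_inner_left (R (l + 1)), ← adjoint_inner_left (R l), ← star_eq_adjoint,
        ← star_eq_adjoint, star_mul_shift_succ hiso hort hW]
      ring)
  simp only [star_mul_shift_zero hiso hort hW, inner_zero_right, neg_zero] at h4
  rw [inner_sub_left, inner_sub_right] at h4
  linear_combination h4

/-- The same telescoping with t_l = ⟨R_l* h, R_l* g⟩; now the initial term t_0 survives and is the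
projection onto ran R_0. -/
theorem range_add_shift_mul_star : R 0 * star (R 0) + W * star W = 1 := by
  ext1 h
  refine ext_inner_right ℂ fun g => ?_
  rw [add_apply, op_mul_apply, op_mul_apply, op_one_apply, inner_add_left]
  have hs : ∀ l, star (R l) (star W h) = star (R (l + 1)) h := fun l => by
    refine ext_inner_right ℂ fun g => ?_
    simp only [star_eq_adjoint, adjoint_inner_left, shift_apply hiso hort hW]
  have h1 := hW (star W h) g
  have h2 := (Complex.hasSum_conj'.2 (hW g h))
  have h3 := h1.add h2
  simp only [inner_conj_symm] at h3
  have h4 := hasSum_sub_of_tendsto_zero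
    (t := fun l => inner ℂ (star (R l) h) (star (R l) g))
    (by simpa using (hzero h).inner (𝕜 := ℂ) (hzero g)) (s := _) (by
      convert h3 using 2 with l
      simp only [hs, sub_apply, inner_sub_left, inner_sub_right]
      rw [← adjoint_inner_right (R (l + 1)), ← adjoint_inner_right (R l),
        ← adjoint_inner_left (R (l + 1)), ← adjoint_inner_left (R l), ← star_eq_adjoint,
        ← star_eq_adjoint]
      ring)
  rw [inner_sub_left, inner_sub_right] at h4
  have h5 : inner ℂ (star W h) g = inner ℂ h (W g) := by rw [star_eq_adjoint, adjoint_inner_left]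
  have h6 : inner ℂ (R 0 (star (R 0) h)) g = inner ℂ (star (R 0) h) (star (R 0) g) := by
    rw [star_eq_adjoint, adjoint_inner_right]
  rw [h5] at h4
  rw [h6]
  linear_combination h4

end Shift

end Bessel

/-! ### Complementary isometries from frames, with commutator estimates. -/

namespace Bessel

open ContinuousLinearMap Filter Topology
open scoped NNReal ComplexConjugate

variable {H : Type*} [NormedAddCommGroup H] [InnerProductSpace ℂ H] [CompleteSpace H]
  {ι : Type*}

theorem enorm_apply_le (T : H →L[ℂ] H) (h : H) : ‖T h‖ₑ ≤ ‖T‖ₑ * ‖h‖ₑ := T.le_opENorm h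

theorem enorm_frameOp_apply_le {B B' : ℝ≥0} {e v : ι → H} (he : IsBessel B e)
    (hv : IsBessel B' v) (h : H) : ‖frameOp he hv h‖ₑ ≤ B * ‖analysisOp hv h‖ₑ := by
  refine (ContinuousLinearMap.le_opENorm (adjoint (analysisOp he)) (analysisOp hv h)).trans ?_
  gcongr
  rw [← ofReal_norm, LinearIsometryEquiv.norm_map, ofReal_norm]
  exact enorm_analysisOp_le he

theorem enorm_le_one_of_star_mul_self {T : H →L[ℂ] H} (hT : star T * T = 1) : ‖T‖ₑ ≤ 1 := by
  have h1 : ‖T‖ ≤ 1 := T.opNorm_le_bound zero_le_one fun h => by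
    have := (norm_map_iff_adjoint_comp_self T).2 hT h
    rw [this, one_mul]
  rw [← ofReal_norm]
  exact (ENNReal.ofReal_le_ofReal h1).trans_eq (by simp)

theorem isBessel_comp {e : ι → H} {κ : Type*} {B : ℝ≥0} (he : IsBessel B e) {j : κ → ι}
    (hj : Function.Injective j) : IsBessel B (e ∘ j) := fun h =>
  (ENNReal.tsum_comp_le_tsum_of_injective hj (fun i => ‖inner ℂ (e i) h‖ₑ ^ 2)).trans (he h)

theorem hsNorm_sub_sq_le (S T : H →L[ℂ] H) :
    hsNorm (S - T) ^ 2 ≤ 2 * hsNorm S ^ 2 + 2 * hsNorm T ^ 2 := by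
  have hneg : hsNorm (-T) = hsNorm T := by simp [hsNorm]
  rw [sub_eq_add_neg, ← hneg]
  exact (pow_le_pow_left' (hsNorm_add_le _ _) 2).trans (add_sq_le_ennreal _ _)

/-- Given Parseval frames `v l`, `l ∈ ℕ`, and an orthonormal family `e`, there are two isometries
with complementary ranges, whose commutators with any operator `A` are controlled by how far
`v l i` and `e (l, i)` are from being eigenvectors of `A` for a common eigenvalue `c (l, i)`. -/
theorem exists_isometries (v : ℕ → ι → H) (e : ℕ × ι → H)
    (hv : ∀ l h, ∑' i, ‖inner ℂ (v l i) h‖ₑ ^ 2 = ‖h‖ₑ ^ 2) (he : Orthonormal ℂ e) :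
    ∃ R W : H →L[ℂ] H, star R * R = 1 ∧ star W * W = 1 ∧ R * star R + W * star W = 1 ∧
      ∀ (A : H →L[ℂ] H) (c : ℕ × ι → ℂ) (τ : ℝ≥0∞), τ < ∞ →
        ∑' p : ℕ × ι, ‖A (e p) - c p • e p‖ₑ ^ 2 ≤ τ →
        ∑' p : ℕ × ι, ‖star A (e p) - conj (c p) • e p‖ₑ ^ 2 ≤ τ →
        ∑' p : ℕ × ι, ‖A (v p.1 p.2) - c p • v p.1 p.2‖ₑ ^ 2 ≤ τ →
        ∑' p : ℕ × ι, ‖star A (v p.1 p.2) - conj (c p) • v p.1 p.2‖ₑ ^ 2 ≤ τ →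
        hsNorm (A * R - R * A) ^ 2 ≤ 88 * τ ∧ hsNorm (A * W - W * A) ^ 2 ≤ 88 * τ := by
  have hinj : ∀ l : ℕ, Function.Injective (Prod.mk l : ι → ℕ × ι) := fun l => Prod.mk_right_injective l
  have heB : IsBessel 1 e := isBessel_of_orthonormal he
  have hel : ∀ l, Orthonormal ℂ (e ∘ Prod.mk l) := fun l => he.comp _ (hinj l)
  have helB : ∀ l, IsBessel 1 (e ∘ Prod.mk l) := fun l => isBessel_comp heB (hinj l)
  have hvB : ∀ l, IsBessel 1 (v l) := fun l => isBessel_of_parseval (hv l)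
  set R : ℕ → H →L[ℂ] H := fun l => frameOp (helB l) (hvB l) with hR
  have hstar : ∀ l, star (R l) = frameOp (hvB l) (helB l) := fun l => by
    rw [star_eq_adjoint, frameOp_adjoint]
  have hiso : ∀ l, star (R l) * R l = 1 := fun l => star_frameOp_mul_frameOp (hel l) _ (hv l)
  have hort : ∀ l m, l ≠ m → star (R l) * R m = 0 := fun l m hlm => by
    ext1 h
    refine ext_inner_right ℂ fun g => ?_
    rw [op_mul_apply, star_eq_adjoint, adjoint_inner_left, zero_apply, inner_zero_left]
    refine inner_frameOp_frameOp_of_inner_eq_zero (fun i j => he.2 ?_) _ _ _ _ _ _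
    simp [Ne.symm hlm]
  have hsum : ∀ h, ∑' l, ‖star (R l) h‖ₑ ^ 2 ≤ ‖h‖ₑ ^ 2 := fun h => by
    have h1 := heB h
    rw [ENNReal.tsum_prod'] at h1
    simp only [ENNReal.coe_one, one_pow, one_mul] at h1
    refine (ENNReal.tsum_le_tsum fun l => ?_).trans h1
    rw [hstar]
    refine (pow_le_pow_left' (enorm_frameOp_apply_le _ _ _) 2).trans_eq ?_
    rw [ENNReal.coe_one, one_mul, enorm_sq_analysisOp_apply]
    rfl
  -- Terms of a convergent series: the ranges of the R l are orthogonal, so the ‖R_l* h‖² have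
  -- finite sum.
  have hzero : ∀ h, Tendsto (fun l => star (R l) h) atTop (𝓝 0) := fun h => by
    have h1 := ENNReal.tendsto_atTop_zero_of_tsum_ne_top ((hsum h).trans_lt (by finiteness)).ne
    have h2 := (ENNReal.tendsto_toReal ENNReal.zero_ne_top).comp h1
    rw [tendsto_zero_iff_norm_tendsto_zero]
    have h3 := h2.sqrt
    simpa [Function.comp_def] using h3
  -- Since R_l* = ∑ ⟨e_{l,i}, ·⟩ v_{l,i}, the sum ∑ (R_{l+1} - R_l) R_l* is the operator of the pair
  -- of families d and e, so the commutator estimate for such operators applies to W as well.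
  set d : ℕ × ι → H := fun p => (R (p.1 + 1) - R p.1) (v p.1 p.2) with hd
  have hdB : IsBessel 2 d := fun h => by
    rw [ENNReal.tsum_prod']
    have h1 : ∀ l, ∑' i, ‖inner ℂ (d (l, i)) h‖ₑ ^ 2 =
        ‖star (R (l + 1)) h - star (R l) h‖ₑ ^ 2 := fun l => by
      rw [← hv l]
      refine tsum_congr fun i => ?_
      rw [← sub_apply, ← star_sub, star_eq_adjoint, adjoint_inner_right]
    calc _ = ∑' l, ‖star (R (l + 1)) h - star (R l) h‖ₑ ^ 2 := tsum_congr h1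
      _ ≤ ∑' l, (2 * ‖star (R (l + 1)) h‖ₑ ^ 2 + 2 * ‖star (R l) h‖ₑ ^ 2) :=
        ENNReal.tsum_le_tsum fun l => enorm_sub_sq_le _ _
      _ ≤ 2 * ‖h‖ₑ ^ 2 + 2 * ‖h‖ₑ ^ 2 := by
        rw [ENNReal.tsum_add, ENNReal.tsum_mul_left, ENNReal.tsum_mul_left]
        gcongr
        · exact (ENNReal.tsum_comp_le_tsum_of_injective (add_left_injective 1)
            (fun l => ‖star (R l) h‖ₑ ^ 2)).trans (hsum h)
        · exact hsum h
      _ = _ := by rw [← add_mul]; norm_num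
  set W : H →L[ℂ] H := 1 + frameOp hdB heB with hWdef
  have hW : ∀ h g, HasSum (fun l => inner ℂ ((R (l + 1) - R l) (star (R l) h)) g)
      (inner ℂ (W h - h) g) := fun h g => by
    have h1 := hasSum_inner_frameOp hdB heB h g
    have h2 : W h - h = frameOp hdB heB h := by rw [hWdef, add_apply, op_one_apply]; abel
    rw [h2]
    refine h1.prod_fiberwise fun l => ?_
    have h3 := hasSum_inner_frameOp (hvB l) (helB l) h (star (R (l + 1) - R l) g)
    rw [star_eq_adjoint, adjoint_inner_right, ← hstar] at h3
    convert h3 using 2 with i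
    rw [adjoint_inner_right]
    rfl
  refine ⟨R 0, W, hiso 0, star_shift_mul_shift hiso hort hzero hW,
    range_add_shift_mul_star hiso hort hzero hW, fun A c τ hτ h1 h2 h3 h4 => ?_⟩
  have hsub : ∀ (f : ℕ × ι → ℝ≥0∞) l, ∑' i, f (l, i) ≤ ∑' p, f p := fun f l =>
    ENNReal.tsum_comp_le_tsum_of_injective (hinj l) f
  have hRl : ∀ l, hsNorm (A * R l - R l * A) ^ 2 ≤
      2 * (∑' i, ‖A (e (l, i)) - c (l, i) • e (l, i)‖ₑ ^ 2) +
      2 * (∑' i, ‖star A (v l i) - conj (c (l, i)) • v l i‖ₑ ^ 2) := fun l => by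
    have := hsNorm_commutator_frameOp_sq_le (helB l) (hvB l) A (fun i => c (l, i))
      ((hsub (fun p => ‖A (e p) - c p • e p‖ₑ ^ 2) l).trans_lt (h1.trans_lt hτ))
      ((hsub (fun p => ‖star A (v p.1 p.2) - conj (c p) • v p.1 p.2‖ₑ ^ 2) l).trans_lt
        (h4.trans_lt hτ))
    simpa using this
  have hRsum : ∑' l, hsNorm (A * R l - R l * A) ^ 2 ≤ 4 * τ := by
    refine (ENNReal.tsum_le_tsum hRl).trans ?_
    rw [ENNReal.tsum_add, ENNReal.tsum_mul_left, ENNReal.tsum_mul_left]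
    rw [ENNReal.tsum_prod'] at h1 h4
    calc _ ≤ 2 * τ + 2 * τ := by gcongr
      _ = 4 * τ := by rw [← add_mul]; norm_num
  constructor
  · refine ((ENNReal.le_tsum 0).trans hRsum).trans ?_
    gcongr
    norm_num
  -- The error splits as [A, X] v + X (Av - cv) with X = R_{l+1} - R_l and ‖X‖ ≤ 2. As v l is
  -- Parseval, the first part sums to |[A, X]|₂², already controlled by the estimate for the R l.
  have hX : ∀ l, ∑' i, ‖A (d (l, i)) - c (l, i) • d (l, i)‖ₑ ^ 2 ≤
      2 * (2 * hsNorm (A * R (l + 1) - R (l + 1) * A) ^ 2 + 2 * hsNorm (A * R l - R l * A) ^ 2) +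
      8 * ∑' i, ‖A (v l i) - c (l, i) • v l i‖ₑ ^ 2 := fun l => by
    set X := R (l + 1) - R l with hXd
    have hXn : ‖X‖ₑ ≤ 2 := by
      have hb := fun l => enorm_le_one_of_star_mul_self (hiso l)
      calc ‖X‖ₑ ≤ ‖R (l + 1)‖ₑ + ‖R l‖ₑ := enorm_sub_le
        _ ≤ 1 + 1 := add_le_add (hb _) (hb _)
        _ = 2 := by norm_num
    have e1 : ∀ i, A (d (l, i)) - c (l, i) • d (l, i) =
        (A * X - X * A) (v l i) + X (A (v l i) - c (l, i) • v l i) := fun i => by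
      change A (X (v l i)) - c (l, i) • X (v l i) = (A (X (v l i)) - X (A (v l i))) + _
      rw [map_sub, map_smul]
      abel
    have e2 : A * X - X * A = (A * R (l + 1) - R (l + 1) * A) - (A * R l - R l * A) := by
      rw [hXd]; noncomm_ring
    calc _ ≤ ∑' i, (2 * ‖(A * X - X * A) (v l i)‖ₑ ^ 2 +
          8 * ‖A (v l i) - c (l, i) • v l i‖ₑ ^ 2) := by
          refine ENNReal.tsum_le_tsum fun i => ?_
          rw [e1]
          refine (enorm_add_sq_le _ _).trans ?_
          refine add_le_add le_rfl ?_
          calc _ ≤ 2 * (2 * ‖A (v l i) - c (l, i) • v l i‖ₑ) ^ 2 := by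
                gcongr
                exact (enorm_apply_le _ _).trans (by gcongr)
            _ = _ := by rw [mul_pow, ← mul_assoc]; norm_num
      _ ≤ _ := by
        rw [ENNReal.tsum_add, ENNReal.tsum_mul_left, ENNReal.tsum_mul_left,
          tsum_enorm_sq_apply_of_parseval (hv l), e2]
        gcongr
        exact hsNorm_sub_sq_le _ _
  have hD : ∑' p, ‖A (d p) - c p • d p‖ₑ ^ 2 ≤ 40 * τ := by
    rw [ENNReal.tsum_prod']
    refine (ENNReal.tsum_le_tsum hX).trans ?_
    rw [ENNReal.tsum_add, ENNReal.tsum_mul_left, ENNReal.tsum_mul_left, ENNReal.tsum_add,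
      ENNReal.tsum_mul_left, ENNReal.tsum_mul_left]
    rw [ENNReal.tsum_prod'] at h3
    have h5 : ∑' l, hsNorm (A * R (l + 1) - R (l + 1) * A) ^ 2 ≤ 4 * τ :=
      (ENNReal.tsum_comp_le_tsum_of_injective (add_left_injective 1)
        (fun l => hsNorm (A * R l - R l * A) ^ 2)).trans hRsum
    calc _ ≤ 2 * (2 * (4 * τ) + 2 * (4 * τ)) + 8 * τ := by gcongr
      _ = 40 * τ := by ring
  have hcomm : A * W - W * A = A * frameOp hdB heB - frameOp hdB heB * A := by
    rw [hWdef]; noncomm_ring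
  rw [hcomm]
  have h6 := hsNorm_commutator_frameOp_sq_le hdB heB A c
    (hD.trans_lt (ENNReal.mul_lt_top (by simp) hτ)) (h2.trans_lt hτ)
  refine h6.trans ?_
  -- e has Bessel bound 1 and error sum τ, d has Bessel bound 2 and error sum 40τ: 88 = 2 · 40 + 2 ·
  -- 4.
  calc _ ≤ 2 * ((1 : ℝ≥0) ^ 2 * (40 * τ)) + 2 * ((2 : ℝ≥0) ^ 2 * τ) := by gcongr
    _ = 88 * τ := by
      simp only [ENNReal.coe_one, ENNReal.coe_ofNat]
      ring

end Bessel

/-! ## Slowly varying partitions of unity on `ℕ` -/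

namespace SlowPartition

open Filter Topology Real

/-- A bump function on `[-1, 1]` whose integer translates are a square partition of unity. -/
def bump (s : ℝ) : ℝ := cos (π / 2 * min |s| 1)

theorem bump_of_one_le {s : ℝ} (hs : 1 ≤ |s|) : bump s = 0 := by
  rw [bump, min_eq_right hs, mul_one, cos_pi_div_two]

theorem abs_bump_sub_le (s t : ℝ) : |bump s - bump t| ≤ 2 * |s - t| := by
  have hpi := pi_le_four
  have h1 : |cos (π / 2 * min |s| 1) - cos (π / 2 * min |t| 1)| ≤
      |π / 2 * min |s| 1 - π / 2 * min |t| 1| := by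
    have := Real.lipschitzWith_cos.dist_le_mul (π / 2 * min |s| 1) (π / 2 * min |t| 1)
    simpa [Real.dist_eq] using this
  have h2 : |min |s| 1 - min |t| 1| ≤ |s - t| :=
    (abs_min_sub_min_le_max _ _ _ _).trans (by
      simpa using abs_abs_sub_abs_le_abs_sub s t)
  refine h1.trans ?_
  rw [← mul_sub, abs_mul, abs_of_pos (by positivity)]
  exact mul_le_mul (by linarith) h2 (abs_nonneg _) (by norm_num)

theorem enorm_sq_real (x : ℝ) : ‖x‖ₑ ^ 2 = ENNReal.ofReal (x ^ 2) := by
  rw [← ofReal_norm, ← ENNReal.ofReal_pow (norm_nonneg _), Real.norm_eq_abs, sq_abs]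

theorem tsum_bump_sq {t : ℝ} (ht : 0 ≤ t) : ∑' k : ℕ, ‖bump (t - k)‖ₑ ^ 2 = 1 := by
  set j := ⌊t⌋₊ with hj
  have h1 : (j : ℝ) ≤ t := Nat.floor_le ht
  have h2 : t < j + 1 := Nat.lt_floor_add_one t
  -- Only the two translates centred at the integers around t are nonzero there; they are a cosine
  -- and a sine of the same angle.
  rw [tsum_eq_sum (s := {j, j + 1})]
  · rw [Finset.sum_pair (by omega)]
    have e1 : bump (t - j) = cos (π / 2 * (t - j)) := by
      rw [bump, abs_of_nonneg (by linarith), min_eq_left (by linarith)]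
    have e2 : bump (t - (j + 1 : ℕ)) = sin (π / 2 * (t - j)) := by
      push_cast
      rw [bump, abs_of_nonpos (by linarith), min_eq_left (by linarith), ← cos_pi_div_two_sub]
      congr 1
      ring
    rw [e1, e2, enorm_sq_real, enorm_sq_real, ← ENNReal.ofReal_add (by positivity) (by positivity),
      cos_sq_add_sin_sq, ENNReal.ofReal_one]
  · intro k hk
    simp only [Finset.mem_insert, Finset.mem_singleton, not_or] at hk
    rw [bump_of_one_le]
    · simp
    · rcases lt_or_ge k j with h | h
      · have : (k : ℝ) + 1 ≤ j := by exact_mod_cast h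
        exact le_abs.2 (Or.inl (by linarith))
      · have : (j : ℝ) + 2 ≤ k := by
          have : j + 2 ≤ k := by omega
          exact_mod_cast this
        exact le_abs.2 (Or.inr (by linarith))

/-- Twelve is 3 · 2²: at most three integers k matter, and the bump is 2-Lipschitz because π/2 ≤ 2.
-/
theorem tsum_bump_sub_bump_sq_le {t t' : ℝ} (ht : 0 ≤ t) (h : t ≤ t') (h' : t' ≤ t + 1) :
    ∑' k : ℕ, ‖bump (t - k) - bump (t' - k)‖ₑ ^ 2 ≤ ENNReal.ofReal (12 * (t' - t) ^ 2) := by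
  set j := ⌊t⌋₊ with hj
  have h1 : (j : ℝ) ≤ t := Nat.floor_le ht
  have h2 : t < j + 1 := Nat.lt_floor_add_one t
  rw [tsum_eq_sum (s := {j, j + 1, j + 2})]
  · have hk : ∀ k : ℕ, ‖bump (t - k) - bump (t' - k)‖ₑ ^ 2 ≤
        ENNReal.ofReal (4 * (t' - t) ^ 2) := fun k => by
      rw [enorm_sq_real]
      refine ENNReal.ofReal_le_ofReal ?_
      have := abs_bump_sub_le (t - k) (t' - k)
      rw [← sq_abs]
      calc _ ≤ (2 * |t - k - (t' - k)|) ^ 2 := by gcongr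
        _ = _ := by rw [mul_pow, sq_abs]; ring
    refine (Finset.sum_le_card_nsmul _ _ _ fun k _ => hk k).trans ?_
    have hc : ({j, j + 1, j + 2} : Finset ℕ).card = 3 := by
      rw [Finset.card_eq_three]; exact ⟨j, j + 1, j + 2, by omega, by omega, by omega, rfl⟩
    rw [hc, ← ENNReal.ofReal_nsmul]
    refine ENNReal.ofReal_le_ofReal (le_of_eq ?_)
    simp only [nsmul_eq_mul]
    push_cast
    ring
  · intro k hk
    simp only [Finset.mem_insert, Finset.mem_singleton, not_or] at hk
    rcases lt_or_ge k j with h3 | h3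
    · have : (k : ℝ) + 1 ≤ j := by exact_mod_cast h3
      rw [bump_of_one_le (le_abs.2 (Or.inl (by linarith))),
        bump_of_one_le (le_abs.2 (Or.inl (by linarith)))]
      simp
    · have : (j : ℝ) + 3 ≤ k := by
        have : j + 3 ≤ k := by omega
        exact_mod_cast this
      rw [bump_of_one_le (le_abs.2 (Or.inr (by linarith))),
        bump_of_one_le (le_abs.2 (Or.inr (by linarith)))]
      simp

/-- The weights are bumps in the variable log(m + s). The logarithm is unbounded, so each weight has
finite support; its increments are at most 1/(m + s), hence square summable, with small total for
large s. -/
theorem exists_slow_partition {ε : ℝ≥0∞} (hε : 0 < ε) : ∃ b : ℕ → ℕ → ℝ,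
    (∀ m, ∑' k, ‖b k m‖ₑ ^ 2 = 1) ∧ (∀ k, ∃ M, ∀ m, M ≤ m → b k m = 0) ∧
    ∑' k, ∑' m, ‖b k m - b k (m + 1)‖ₑ ^ 2 ≤ ε := by
  set f : ℕ → ℝ≥0∞ := fun i => ENNReal.ofReal (12 * (1 / (i : ℝ) ^ 2)) with hf
  have hfs : ∑' i, f i ≠ ∞ := by
    rw [hf, ← ENNReal.ofReal_tsum_of_nonneg (fun i => by positivity)
      ((Real.summable_one_div_nat_pow.2 (by norm_num)).mul_left 12)]
    exact ENNReal.ofReal_ne_top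
  have h1 := ENNReal.tendsto_sum_nat_add f hfs
  -- The condition s ≥ 1 keeps log(m + s) nonnegative, as needed for bumps indexed by ℕ, and its
  -- increments at most 1.
  obtain ⟨s, hs, hs1⟩ := ((h1.eventually (gt_mem_nhds hε)).and (eventually_ge_atTop 1)).exists
  have hs1' : (1 : ℝ) ≤ s := by exact_mod_cast hs1
  have hpos : ∀ m : ℕ, 0 ≤ log (m + s) := fun m => log_nonneg (by
    have : (0 : ℝ) ≤ m := m.cast_nonneg
    linarith)
  refine ⟨fun k m => bump (log (m + s) - k), fun m => tsum_bump_sq (hpos m), fun k => ?_, ?_⟩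
  · have h2 : Tendsto (fun m : ℕ => log ((m : ℝ) + s)) atTop atTop :=
      tendsto_log_atTop.comp (tendsto_atTop_add_const_right _ _ tendsto_natCast_atTop_atTop)
    obtain ⟨M, hM⟩ := eventually_atTop.1 (h2.eventually_ge_atTop ((k : ℝ) + 1))
    refine ⟨M, fun m hm => bump_of_one_le (le_abs.2 (Or.inl ?_))⟩
    have := hM m hm
    linarith
  · rw [ENNReal.tsum_comm]
    refine le_trans (ENNReal.tsum_le_tsum fun m => ?_) hs.le
    have hm : (0 : ℝ) < m + s := by positivity
    have hle : log ((m : ℝ) + s) ≤ log ((m + 1 : ℕ) + s) :=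
      log_le_log hm (by push_cast; linarith)
    have hdiff : log ((m + 1 : ℕ) + s) - log ((m : ℝ) + s) ≤ 1 / (m + s) := by
      rw [← log_div (by positivity) hm.ne']
      refine (log_le_sub_one_of_pos (by positivity)).trans (le_of_eq ?_)
      field_simp
      push_cast
      ring
    have h1m : 1 / ((m : ℝ) + s) ≤ 1 := by
      rw [div_le_one hm]
      have : (0 : ℝ) ≤ m := m.cast_nonneg
      linarith
    refine (tsum_bump_sub_bump_sq_le (hpos m) hle (by linarith)).trans ?_
    refine ENNReal.ofReal_le_ofReal ?_
    push_cast at hle hdiff ⊢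
    rw [← one_div_pow]
    gcongr

end SlowPartition

/-! ## Parseval frames from filtrations -/

namespace Bessel

open Filter Topology
open scoped ComplexConjugate

variable {H : Type*} [NormedAddCommGroup H] [InnerProductSpace ℂ H]

theorem enorm_add_sq_of_inner_eq_zero {x y : H} (h : inner ℂ x y = 0) :
    ‖x + y‖ₑ ^ 2 = ‖x‖ₑ ^ 2 + ‖y‖ₑ ^ 2 := by
  have h1 := norm_add_sq_eq_norm_sq_add_norm_sq_of_inner_eq_zero x y h
  simp only [← sq] at h1
  simp only [← ofReal_norm, ← ENNReal.ofReal_pow (norm_nonneg _)]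
  rw [← ENNReal.ofReal_add (by positivity) (by positivity), h1]

/-- The Pythagorean theorem for martingale differences. -/
theorem enorm_sum_smul_sub_sq {F : ℕ → H}
    (hF : ∀ m n, m ≤ n → inner ℂ (F m) (F (n + 1) - F n) = 0) (β : ℕ → ℂ) (N : ℕ) :
    ‖∑ m ∈ Finset.range N, β m • (F (m + 1) - F m)‖ₑ ^ 2 =
      ∑ m ∈ Finset.range N, ‖β m‖ₑ ^ 2 * ‖F (m + 1) - F m‖ₑ ^ 2 := by
  induction N with
  | zero => simp
  | succ N ih =>
    rw [Finset.sum_range_succ, Finset.sum_range_succ, enorm_add_sq_of_inner_eq_zero, ih,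
      enorm_smul, mul_pow]
    rw [sum_inner]
    refine Finset.sum_eq_zero fun m hm => ?_
    have hm' := Finset.mem_range.1 hm
    rw [inner_smul_left, inner_smul_right, inner_sub_left, hF _ _ hm', hF _ _ hm'.le]
    simp

/-- Abel summation. It passes between ∑ (b_m - b_{m+1}) P_m, whose image vectors have small second
moments, and ∑ b_m (P_m - P_{m-1}), to which Pythagoras applies. -/
theorem sum_sub_smul (F : ℕ → H) (h0 : F 0 = 0) (b : ℕ → ℂ) (N : ℕ) :
    ∑ m ∈ Finset.range N, (b m - b (m + 1)) • F (m + 1) + b N • F N =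
      ∑ m ∈ Finset.range N, b m • (F (m + 1) - F m) := by
  induction N with
  | zero => simp [h0]
  | succ N ih =>
    rw [Finset.sum_range_succ, Finset.sum_range_succ, ← ih, sub_smul, smul_sub]
    abel

/-- Let P_m be the projection onto K m and B_k = ∑ (b_k(m) - b_k(m+1)) P_m. The frame vectors are
B_k u. As B_k h lies in K (M k), where u (M k) is Parseval, the k-th block contributes ‖B_k h‖² =
∑_m b_k(m)² ‖(P_m - P_{m-1}) h‖². Summing over k first leaves ∑_m ‖(P_m - P_{m-1}) h‖² = ‖h‖². -/
theorem parseval_of_filtration [CompleteSpace H] {γ : Type*} (K : ℕ → Submodule ℂ H)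
    [∀ m, (K m).HasOrthogonalProjection]
    (hmono : Monotone K) (htot : ⊤ ≤ (⨆ m, K m).topologicalClosure) (u : ℕ → γ → H)
    (hu : ∀ m, ∀ g ∈ K m, ∑' c, ‖inner ℂ (u m c) g‖ₑ ^ 2 = ‖g‖ₑ ^ 2) (b : ℕ → ℕ → ℝ)
    (hb : ∀ m, ∑' k, ‖b k m‖ₑ ^ 2 = 1) (M : ℕ → ℕ) (hM : ∀ k m, M k ≤ m → b k m = 0) (h : H) :
    ∑' p : ℕ × γ, ‖inner ℂ (∑ m ∈ Finset.range (M p.1 + 1),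
      ((b p.1 m - b p.1 (m + 1) : ℝ) : ℂ) • (K m).starProjection (u (M p.1) p.2)) h‖ₑ ^ 2 =
      ‖h‖ₑ ^ 2 := by
  -- The index is shifted by one so that F 0 = 0 plays the role of P_{-1} h.
  set F : ℕ → H := fun n => Nat.casesOn n 0 (fun m => (K m).starProjection h) with hFdef
  have hFs : ∀ m, F (m + 1) = (K m).starProjection h := fun m => rfl
  have hFmem : ∀ m n, m ≤ n → F (m + 1) ∈ K n := fun m n hmn =>
    hmono hmn (Submodule.starProjection_apply_mem _ _)
  have hproj : ∀ m, ∀ w ∈ K m, inner ℂ w ((K m).starProjection h) = inner ℂ w h :=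
    fun m w hw => by
      rw [← Submodule.inner_starProjection_left_eq_right, Submodule.starProjection_eq_self_iff.2 hw]
  have hF : ∀ m n, m ≤ n → inner ℂ (F m) (F (n + 1) - F n) = 0 := fun m n hmn => by
    cases m with
    | zero => exact inner_zero_left _
    | succ m =>
      obtain ⟨n, rfl⟩ : ∃ n', n = n' + 1 := ⟨n - 1, by omega⟩
      rw [inner_sub_right, hFs (n + 1), hFs n, hproj _ _ (hFmem m _ (by omega)),
        hproj _ _ (hFmem m _ (by omega)), sub_self]
  set Δ : ℕ → ℝ≥0∞ := fun m => ‖F (m + 1) - F m‖ₑ ^ 2 with hΔ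
  have hk : ∀ k, ∑' c, ‖inner ℂ (∑ m ∈ Finset.range (M k + 1),
      ((b k m - b k (m + 1) : ℝ) : ℂ) • (K m).starProjection (u (M k) c)) h‖ₑ ^ 2 =
      ∑' m, ‖b k m‖ₑ ^ 2 * Δ m := fun k => by
    set Bh := ∑ m ∈ Finset.range (M k + 1), ((b k m - b k (m + 1) : ℝ) : ℂ) • F (m + 1) with hBh
    have h1 : ∀ c, inner ℂ (∑ m ∈ Finset.range (M k + 1),
        ((b k m - b k (m + 1) : ℝ) : ℂ) • (K m).starProjection (u (M k) c)) h =
        inner ℂ (u (M k) c) Bh := fun c => by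
      rw [hBh, sum_inner, inner_sum]
      refine Finset.sum_congr rfl fun m _ => ?_
      rw [inner_smul_left, inner_smul_right, Complex.conj_ofReal, hFs,
        Submodule.inner_starProjection_left_eq_right]
    have hmem : Bh ∈ K (M k) := Submodule.sum_mem _ fun m hm => Submodule.smul_mem _ _
      (hFmem m _ (by have := Finset.mem_range.1 hm; omega))
    simp only [h1]
    rw [hu _ _ hmem]
    have h2 := sum_sub_smul F rfl (fun m => ((b k m : ℝ) : ℂ)) (M k + 1)
    simp only [hM k (M k + 1) (by omega), Complex.ofReal_zero, zero_smul, add_zero,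
      ← Complex.ofReal_sub] at h2
    rw [hBh, h2, enorm_sum_smul_sub_sq hF, tsum_eq_sum (s := Finset.range (M k + 1))]
    · refine Finset.sum_congr rfl fun m _ => ?_
      rw [← ofReal_norm, Complex.norm_real, ofReal_norm]
    · intro m hm
      rw [hM k m (by rw [Finset.mem_range] at hm; omega)]
      simp
  rw [ENNReal.tsum_prod']
  simp only [hk]
  rw [ENNReal.tsum_comm]
  simp only [ENNReal.tsum_mul_right, hb, one_mul]
  have h3 : ∀ N, ∑ m ∈ Finset.range N, Δ m = ‖F N‖ₑ ^ 2 := fun N => by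
    have := enorm_sum_smul_sub_sq hF (fun _ => 1) N
    simp only [one_smul, enorm_one, one_pow, one_mul, Finset.sum_range_sub] at this
    rw [hΔ, ← this]
    congr 2
    exact sub_zero (F N)
  have h4 := ENNReal.tendsto_nat_tsum Δ
  simp only [h3] at h4
  refine tendsto_nhds_unique ((tendsto_add_atTop_iff_nat 1).2 h4) ?_
  have h5 := Submodule.starProjection_tendsto_self K hmono h htot
  exact (ENNReal.continuous_pow 2).continuousAt.tendsto.comp (continuous_enorm.continuousAt.tendsto.comp h5)

end Bessel

/-! ## Dyadic cells in the plane -/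

namespace DyadicCell

open Filter Topology

/-- The index of the dyadic square of side `2⁻ᵐ` that contains `z`. -/
def cellIdx (m : ℕ) (z : ℂ) : ℤ × ℤ := (⌊2 ^ m * z.re⌋, ⌊2 ^ m * z.im⌋)

/-- The dyadic squares of side `2⁻ᵐ`. -/
def cell (m : ℕ) (c : ℤ × ℤ) : Set ℂ := cellIdx m ⁻¹' {c}

theorem mem_cell {m : ℕ} {c : ℤ × ℤ} {z : ℂ} : z ∈ cell m c ↔ cellIdx m z = c := Iff.rfl

theorem mem_cell_cellIdx (m : ℕ) (z : ℂ) : z ∈ cell m (cellIdx m z) := rfl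

theorem measurable_cellIdx (m : ℕ) : Measurable (cellIdx m) :=
  (Int.measurable_floor.comp (Complex.measurable_re.const_mul _)).prodMk
    (Int.measurable_floor.comp (Complex.measurable_im.const_mul _))

theorem measurableSet_preimage_cellIdx (m : ℕ) (s : Set (ℤ × ℤ)) :
    MeasurableSet (cellIdx m ⁻¹' s) := measurable_cellIdx m .of_discrete

theorem measurableSet_cell (m : ℕ) (c : ℤ × ℤ) : MeasurableSet (cell m c) :=
  measurableSet_preimage_cellIdx m _

theorem disjoint_cell (m : ℕ) {c c' : ℤ × ℤ} (h : c ≠ c') : Disjoint (cell m c) (cell m c') :=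
  Disjoint.preimage _ (by simpa using h)

theorem iUnion_cell (m : ℕ) : ⋃ c, cell m c = Set.univ := by
  ext z; simp [mem_cell]

theorem floor_two_pow_mul (m : ℕ) (x : ℝ) : ⌊2 ^ m * x⌋ = ⌊2 ^ (m + 1) * x⌋ / 2 := by
  have := Int.floor_div_natCast (2 ^ (m + 1) * x) 2
  rw [← Nat.cast_ofNat (R := ℤ), ← this]
  congr 1
  push_cast
  rw [pow_succ]
  ring

theorem cellIdx_eq_half (m : ℕ) (z : ℂ) :
    cellIdx m z = ((cellIdx (m + 1) z).1 / 2, (cellIdx (m + 1) z).2 / 2) := by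
  simp only [cellIdx, floor_two_pow_mul m]

theorem cellIdx_eq_of_le {m M : ℕ} (h : m ≤ M) {z w : ℂ} (hzw : cellIdx M z = cellIdx M w) :
    cellIdx m z = cellIdx m w := by
  induction M, h using Nat.le_induction with
  | base => exact hzw
  | succ n _ ih => exact ih (by rw [cellIdx_eq_half, cellIdx_eq_half n w, hzw])

theorem cell_subset_of_le {m M : ℕ} (h : m ≤ M) (z : ℂ) :
    cell M (cellIdx M z) ⊆ cell m (cellIdx m z) := fun _ hw => cellIdx_eq_of_le h hw

theorem abs_sub_le_of_floor_eq {m : ℕ} {x y : ℝ} (h : ⌊2 ^ m * x⌋ = ⌊2 ^ m * y⌋) :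
    |x - y| ≤ (1 / 2) ^ m := by
  have h1 := Int.abs_sub_lt_one_of_floor_eq_floor h
  rw [← mul_sub, abs_mul, abs_of_pos (by positivity : (0 : ℝ) < 2 ^ m)] at h1
  rw [one_div, inv_pow, ← one_div, le_div_iff₀ (by positivity)]
  linarith

theorem norm_sub_le_of_cellIdx_eq {m : ℕ} {z w : ℂ} (h : cellIdx m z = cellIdx m w) :
    ‖z - w‖ ≤ √2 * (1 / 2) ^ m := by
  have h1 := abs_sub_le_of_floor_eq (congrArg Prod.fst h)
  have h2 := abs_sub_le_of_floor_eq (congrArg Prod.snd h)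
  refine (Complex.norm_le_sqrt_two_mul_max _).trans ?_
  gcongr
  exact max_le (by simpa using h1) (by simpa using h2)

theorem cellIdx_mem_of_cellIdx_zero {q : ℤ × ℤ} {z : ℂ} (m : ℕ) (h : cellIdx 0 z = q) :
    cellIdx m z ∈ Finset.Ico (2 ^ m * q.1) (2 ^ m * q.1 + 2 ^ m) ×ˢ
      Finset.Ico (2 ^ m * q.2) (2 ^ m * q.2 + 2 ^ m) := by
  have key : ∀ x : ℝ, ⌊2 ^ m * x⌋ ∈ Finset.Ico (2 ^ m * ⌊x⌋) (2 ^ m * ⌊x⌋ + 2 ^ m) := fun x => by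
    rw [Finset.mem_Ico, Int.le_floor, Int.floor_lt]
    push_cast
    have h1 := Int.floor_le x
    have h2 := Int.lt_floor_add_one x
    have h3 : (0 : ℝ) < 2 ^ m := by positivity
    constructor <;> nlinarith
  subst h
  rw [Finset.mem_product]
  refine ⟨?_, ?_⟩
  · simpa [cellIdx] using key z.re
  · simpa [cellIdx] using key z.im

/-- The set of all dyadic squares generates the Borel sets. -/
theorem borel_eq_generateFrom_cells : (inferInstance : MeasurableSpace ℂ) =
    MeasurableSpace.generateFrom {s | ∃ m c, s = cell m c ∨ s = ∅} := by
  refine le_antisymm ?_ (MeasurableSpace.generateFrom_le ?_)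
  · rw [BorelSpace.measurable_eq (α := ℂ), borel]
    refine MeasurableSpace.generateFrom_le fun U hU => ?_
    have hU' : IsOpen U := hU
    have : U = ⋃ p : {p : ℕ × ℤ × ℤ // cell p.1 p.2 ⊆ U}, cell p.1.1 p.1.2 := by
      refine Set.Subset.antisymm (fun z hz => ?_) (Set.iUnion_subset fun p => p.2)
      obtain ⟨ε, hε, hεU⟩ := Metric.isOpen_iff.1 hU' z hz
      have h1 : Tendsto (fun m : ℕ => √2 * (1 / 2 : ℝ) ^ m) atTop (𝓝 (√2 * 0)) :=
        (tendsto_pow_atTop_nhds_zero_of_lt_one (by norm_num) (by norm_num)).const_mul _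
      rw [mul_zero] at h1
      obtain ⟨m, hm⟩ := (h1.eventually (gt_mem_nhds hε)).exists
      refine Set.mem_iUnion.2 ⟨⟨(m, cellIdx m z), fun w hw => hεU ?_⟩, mem_cell_cellIdx m z⟩
      rw [Metric.mem_ball, dist_eq_norm]
      exact (norm_sub_le_of_cellIdx_eq hw).trans_lt hm
    rw [this]
    exact MeasurableSet.iUnion fun p => MeasurableSpace.measurableSet_generateFrom
      ⟨_, _, Or.inl rfl⟩
  · rintro s ⟨m, c, rfl | rfl⟩
    · exact measurableSet_cell m c
    · exact MeasurableSet.empty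

/-- Two dyadic squares are nested or disjoint. -/
theorem isPiSystem_cells : IsPiSystem {s | ∃ m c, s = cell m c ∨ s = ∅} := by
  have key : ∀ m M c C, m ≤ M → (cell m c ∩ cell M C).Nonempty →
      cell m c ∩ cell M C = cell M C := by
    rintro m M c C h ⟨z, rfl, rfl⟩
    exact Set.inter_eq_right.2 (cell_subset_of_le h z)
  rintro s ⟨m, c, rfl | rfl⟩ t ⟨M, C, rfl | rfl⟩ hst
  · rcases le_total m M with h | h
    · exact ⟨M, C, Or.inl (key _ _ _ _ h hst)⟩
    · rw [Set.inter_comm] at hst ⊢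
      exact ⟨m, c, Or.inl (key _ _ _ _ h hst)⟩
  · simp at hst
  · simp at hst
  · simp at hst

/-- An integrable function whose integrals over all dyadic squares vanish is zero. -/
theorem ae_eq_zero_of_setIntegral_cell_eq_zero {μ : Measure ℂ} {f : ℂ → ℂ} (hf : Integrable f μ)
    (h : ∀ m c, ∫ z in cell m c, f z ∂μ = 0) : f =ᵐ[μ] 0 := by
  refine hf.ae_eq_zero_of_forall_setIntegral_eq_zero fun s hs hfin => ?_
  clear hfin
  have huniv : ∫ z, f z ∂μ = 0 := by
    rw [← setIntegral_univ, ← iUnion_cell 0, integral_iUnion (measurableSet_cell 0)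
      (fun c c' hcc => disjoint_cell 0 hcc) hf.integrableOn]
    simp [h]
  induction s, hs using MeasurableSpace.induction_on_inter borel_eq_generateFrom_cells
    isPiSystem_cells with
  | empty => simp
  | basic t ht =>
    obtain ⟨m, c, rfl | rfl⟩ := ht
    · exact h m c
    · simp
  | compl t ht ih =>
    have := integral_add_compl ht hf
    rw [ih] at this
    simpa [huniv] using this
  | iUnion g hd hm ih =>
    rw [integral_iUnion hm hd hf.integrableOn]
    simp [ih]

end DyadicCell

/-! ### The filtration of L²(μ) by dyadic step functions. -/

namespace DyadicCell

open Filter Topology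
open scoped ComplexConjugate

/-- The fixed vectors of h ↦ ∑ ⟨e_i, h⟩ e_i form a closed subspace that contains every e_i. -/
theorem tsum_inner_sq_of_mem_closure_span {H ι : Type*} [NormedAddCommGroup H]
    [InnerProductSpace ℂ H] [CompleteSpace H] {e : ι → H} (he : Orthonormal ℂ e) {g : H}
    (hg : g ∈ (Submodule.span ℂ (Set.range e)).topologicalClosure) :
    ∑' i, ‖inner ℂ (e i) g‖ₑ ^ 2 = ‖g‖ₑ ^ 2 := by
  have heB := Bessel.isBessel_of_orthonormal he
  have hP : Bessel.frameOp heB heB g = g := by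
    have h1 : IsClosed {x : H | Bessel.frameOp heB heB x = x} :=
      isClosed_eq (Bessel.frameOp heB heB).continuous continuous_id
    refine closure_minimal (fun x hx => ?_) h1 hg
    change Bessel.frameOp heB heB x = x
    induction hx using Submodule.span_induction with
    | zero => exact map_zero _
    | add x y _ _ hx hy => rw [map_add, hx, hy]
    | smul a x _ hx => rw [map_smul, hx]
    | mem x hx =>
      obtain ⟨i, rfl⟩ := hx
      refine ext_inner_right ℂ fun f => ?_
      rw [Bessel.inner_frameOp, tsum_eq_single i fun j hj => by rw [he.2 hj]; simp]
      simp [he.1]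
  have h2 := Bessel.hasSum_inner_frameOp heB heB g g
  rw [hP] at h2
  have h3 : HasSum (fun i => ‖inner ℂ (e i) g‖ ^ 2) (‖g‖ ^ 2) := by
    convert Complex.hasSum_re h2 using 1
    · ext i
      rw [Complex.mul_conj, Complex.ofReal_re, Complex.normSq_eq_norm_sq]
    · exact (inner_self_eq_norm_sq (𝕜 := ℂ) g).symm
  have h4 : ∀ y : ℝ, 0 ≤ y → ENNReal.ofReal (y ^ 2) = ENNReal.ofReal y ^ 2 :=
    fun y hy => ENNReal.ofReal_pow hy 2
  rw [← ofReal_norm g, ← h4 _ (norm_nonneg _), ← h3.tsum_eq,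
    ENNReal.ofReal_tsum_of_nonneg (fun i => by positivity) h3.summable]
  refine tsum_congr fun i => ?_
  rw [h4 _ (norm_nonneg _), ofReal_norm]

variable (μ : Measure ℂ) [IsFiniteMeasure μ]

/-- The indicator of a dyadic square in `L²(μ)`. -/
def ind (m : ℕ) (c : ℤ × ℤ) : Lp ℂ 2 μ :=
  indicatorConstLp 2 (measurableSet_cell m c) (measure_ne_top μ _) (1 : ℂ)

/-- The closed span of the indicators of the dyadic squares of side `2⁻ᵐ`. -/
def cellSpace (m : ℕ) : Submodule ℂ (Lp ℂ 2 μ) :=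
  (Submodule.span ℂ (Set.range (ind μ m))).topologicalClosure

instance (m : ℕ) : (cellSpace μ m).HasOrthogonalProjection := by
  unfold cellSpace; infer_instance

theorem ind_mem_cellSpace (m : ℕ) (c : ℤ × ℤ) : ind μ m c ∈ cellSpace μ m :=
  Submodule.le_topologicalClosure _ (Submodule.subset_span ⟨c, rfl⟩)

theorem inner_ind_ind (m M : ℕ) (c C : ℤ × ℤ) :
    inner ℂ (ind μ m c) (ind μ M C) = μ.real (cell m c ∩ cell M C) :=
  L2.inner_indicatorConstLp_one_indicatorConstLp_one _ _

theorem inner_ind (m : ℕ) (c : ℤ × ℤ) (f : Lp ℂ 2 μ) :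
    inner ℂ (ind μ m c) f = ∫ z in cell m c, f z ∂μ :=
  L2.inner_indicatorConstLp_one _ _ _

theorem indicatorConstLp_preimage_mem_cellSpace (m : ℕ) (s : Finset (ℤ × ℤ)) :
    indicatorConstLp 2 (measurableSet_preimage_cellIdx m s) (measure_ne_top μ _) (1 : ℂ) ∈
      cellSpace μ m := by
  induction s using Finset.induction_on with
  | empty =>
    convert zero_mem (cellSpace μ m)
    simp
  | insert c s hc ih =>
    have hd : Disjoint (cell m c) (cellIdx m ⁻¹' s) := Disjoint.preimage _ (by simpa using hc)
    have h1 := indicatorConstLp_disjoint_union (p := 2) (μ := μ) (measurableSet_cell m c)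
      (measurableSet_preimage_cellIdx m s) (measure_ne_top μ _) (measure_ne_top μ _) hd (1 : ℂ)
    convert add_mem (ind_mem_cellSpace μ m c) ih using 1
    rw [ind, ← h1]
    congr 1
    rw [Finset.coe_insert, Set.insert_eq, Set.preimage_union]
    rfl

theorem monotone_cellSpace : Monotone (cellSpace μ) := by
  refine monotone_nat_of_le_succ fun m => ?_
  refine Submodule.topologicalClosure_minimal _ ?_ (Submodule.isClosed_topologicalClosure _)
  rw [Submodule.span_le]
  rintro _ ⟨c, rfl⟩
  have h1 := indicatorConstLp_preimage_mem_cellSpace μ (m + 1)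
    (({2 * c.1, 2 * c.1 + 1} : Finset ℤ) ×ˢ ({2 * c.2, 2 * c.2 + 1} : Finset ℤ))
  have h2 : ind μ m c = indicatorConstLp 2 (measurableSet_preimage_cellIdx (m + 1)
      (({2 * c.1, 2 * c.1 + 1} : Finset ℤ) ×ˢ ({2 * c.2, 2 * c.2 + 1} : Finset ℤ) :
        Finset (ℤ × ℤ))) (measure_ne_top μ _) (1 : ℂ) := by
    unfold ind
    congr 1
    ext z
    rw [mem_cell, cellIdx_eq_half]
    simp only [Set.mem_preimage, Finset.mem_coe, Finset.mem_product, Finset.mem_insert,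
      Finset.mem_singleton, Prod.ext_iff]
    omega
  rw [SetLike.mem_coe, h2]
  exact h1

/-- A vector orthogonal to all the spaces has vanishing integral over every dyadic square. -/
theorem iSup_cellSpace_dense : ⊤ ≤ (⨆ m, cellSpace μ m).topologicalClosure := by
  refine top_le_iff.2 ((Submodule.topologicalClosure_eq_top_iff).2 ?_)
  rw [Submodule.eq_bot_iff]
  intro f hf
  have hf1 : Integrable f μ := (Lp.memLp f).integrable (by norm_num)
  have h0 := ae_eq_zero_of_setIntegral_cell_eq_zero hf1 fun m c => by
    rw [← inner_ind μ m c f]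
    exact (Submodule.mem_orthogonal _ _).1 hf _
      (Submodule.mem_iSup_of_mem m (ind_mem_cellSpace μ m c))
  exact (Lp.eq_zero_iff_ae_eq_zero).2 h0

/-- The normalized indicator of a dyadic square (zero if the square is null). -/
def nind (m : ℕ) (c : ℤ × ℤ) : Lp ℂ 2 μ := (((√(μ.real (cell m c)))⁻¹ : ℝ) : ℂ) • ind μ m c

theorem nind_eq_zero {m : ℕ} {c : ℤ × ℤ} (h : μ (cell m c) = 0) : nind μ m c = 0 := by
  simp [nind, Measure.real, h]

theorem measureReal_pos_of_ne_zero {s : Set ℂ} (h : μ s ≠ 0) : 0 < μ.real s :=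
  ENNReal.toReal_pos h (measure_ne_top μ _)

theorem orthonormal_nind (m : ℕ) :
    Orthonormal ℂ (fun c : {c : ℤ × ℤ // μ (cell m c) ≠ 0} => nind μ m c) := by
  classical
  rw [orthonormal_iff_ite]
  rintro ⟨c, hc⟩ ⟨c', hc'⟩
  rw [nind, nind, inner_smul_left, inner_smul_right, inner_ind_ind, Complex.conj_ofReal]
  split_ifs with h
  · rw [Subtype.mk.injEq] at h
    subst h
    have h1 := measureReal_pos_of_ne_zero μ hc
    rw [Set.inter_self, ← Complex.ofReal_mul, ← Complex.ofReal_mul, ← Complex.ofReal_one]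
    congr 1
    have h2 := Real.mul_self_sqrt h1.le
    have h3 := (Real.sqrt_pos.2 h1).ne'
    field_simp
    rw [sq, h2]
  · rw [(disjoint_cell m fun h' => h (Subtype.ext h')).inter_eq]
    simp

theorem tsum_inner_nind_sq (m : ℕ) (g : Lp ℂ 2 μ) (hg : g ∈ cellSpace μ m) :
    ∑' c, ‖inner ℂ (nind μ m c) g‖ₑ ^ 2 = ‖g‖ₑ ^ 2 := by
  rw [← tsum_inner_sq_of_mem_closure_span (orthonormal_nind μ m) (g := g)]
  · refine (tsum_subtype_eq_of_support_subset (s := {c | μ (cell m c) ≠ 0})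
      (f := fun c => ‖inner ℂ (nind μ m c) g‖ₑ ^ 2) fun c hc hc' => hc ?_).symm
    simp [nind_eq_zero μ hc']
  · refine Submodule.topologicalClosure_mono ?_ hg
    rw [Submodule.span_le]
    rintro _ ⟨c, rfl⟩
    by_cases hc : μ (cell m c) = 0
    · have : ind μ m c = 0 := by
        rw [← inner_self_eq_zero (𝕜 := ℂ), inner_ind_ind, Set.inter_self]
        simp [Measure.real, hc]
      rw [this]
      exact zero_mem _
    · have h1 := measureReal_pos_of_ne_zero μ hc
      have : ind μ m c = ((√(μ.real (cell m c)) : ℝ) : ℂ) • nind μ m c := by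
        rw [nind, smul_smul, ← Complex.ofReal_mul, mul_inv_cancel₀ (Real.sqrt_pos.2 h1).ne']
        simp
      rw [this]
      exact Submodule.smul_mem _ _ (Submodule.subset_span ⟨⟨c, hc⟩, rfl⟩)

/-- The projection is conditional expectation onto the squares of level m: it spreads the mass of
the small square evenly over the level-m square containing it. -/
theorem starProjection_nind {m M : ℕ} (h : m ≤ M) (z : ℂ)
    (hz : μ (cell M (cellIdx M z)) ≠ 0) :
    (cellSpace μ m).starProjection (nind μ M (cellIdx M z)) =
      ((√(μ.real (cell M (cellIdx M z))) / μ.real (cell m (cellIdx m z)) : ℝ) : ℂ) •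
        ind μ m (cellIdx m z) := by
  have hsub := cell_subset_of_le h z
  have hz' : μ (cell m (cellIdx m z)) ≠ 0 := fun h0 => hz (measure_mono_null hsub h0)
  have p1 := measureReal_pos_of_ne_zero μ hz
  have p2 := measureReal_pos_of_ne_zero μ hz'
  refine Submodule.eq_starProjection_of_mem_orthogonal
    (Submodule.smul_mem _ _ (ind_mem_cellSpace μ m _)) ?_
  rw [cellSpace, Submodule.orthogonal_closure, Submodule.mem_orthogonal]
  intro g hg
  induction hg using Submodule.span_induction with
  | zero => exact inner_zero_left _
  | add x y _ _ hx hy => rw [inner_add_left, hx, hy, add_zero]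
  | smul a x _ hx => rw [inner_smul_left, hx, mul_zero]
  | mem x hx =>
    obtain ⟨c, rfl⟩ := hx
    rw [inner_sub_right, nind, inner_smul_right, inner_smul_right, inner_ind_ind, inner_ind_ind,
      ← Complex.ofReal_mul, ← Complex.ofReal_mul, ← Complex.ofReal_sub, Complex.ofReal_eq_zero]
    by_cases hc : c = cellIdx m z
    · subst hc
      rw [Set.inter_self, Set.inter_eq_right.2 hsub]
      have h2 := Real.mul_self_sqrt p1.le
      have h3 := (Real.sqrt_pos.2 p1).ne'
      field_simp
      rw [sq, h2, sub_self, mul_zero]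
    · have hd := disjoint_cell m hc
      rw [hd.inter_eq, (hd.mono_right hsub).inter_eq]
      simp

end DyadicCell

/-! ## Parseval frames of well-concentrated functions -/

namespace DyadicCell

open Filter Topology
open scoped ComplexConjugate

/-- Pointwise estimate for D = |z - x|, with χ m = 1 when z and x share their square of level m.
Cauchy–Schwarz with weights 2^{-m} and 2^m is used; the sum of the 2^m is geometric, hence governed
by the last shared level, and D absorbs it. -/
theorem weighted_sum_sq_le (N : ℕ) {D : ℝ} (hD : 0 ≤ D) (χ α : ℕ → ℝ)
    (hχ : ∀ m, χ m = 0 ∨ (χ m = 1 ∧ D ≤ √2 * (1 / 2) ^ m)) :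
    D ^ 2 * (∑ m ∈ Finset.range N, α m * χ m) ^ 2 ≤
      4 * ∑ m ∈ Finset.range N, α m ^ 2 * χ m * (1 / 4) ^ m := by
  have hχ0 : ∀ m, 0 ≤ χ m := fun m => by rcases hχ m with h | h <;> simp [h]
  have hχ1 : ∀ m, χ m ≤ 1 := fun m => by rcases hχ m with h | h <;> simp [h]
  -- By induction on the number of levels: a shared level N gives D ≤ √2 · 2^{-N}, while the whole
  -- sum up to N is at most 2^{N+1}.
  have h1 : ∀ N, D * ∑ m ∈ Finset.range N, χ m * 2 ^ m ≤ 2 * √2 := fun N => by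
    induction N with
    | zero => simp
    | succ N ih =>
      rcases hχ N with h | ⟨h, h'⟩
      · rw [Finset.sum_range_succ, h, zero_mul, add_zero]
        exact ih
      · have h2 : ∑ m ∈ Finset.range (N + 1), χ m * 2 ^ m ≤ 2 ^ (N + 1) := by
          calc _ ≤ ∑ m ∈ Finset.range (N + 1), (2 : ℝ) ^ m := by
                refine Finset.sum_le_sum fun m _ => ?_
                exact mul_le_of_le_one_left (by positivity) (hχ1 m)
            _ ≤ _ := by
                rw [geom_sum_eq (by norm_num)]
                linarith
        calc _ ≤ (√2 * (1 / 2) ^ N) * 2 ^ (N + 1) :=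
              mul_le_mul h' h2 (Finset.sum_nonneg fun m _ => mul_nonneg (hχ0 m) (by positivity))
                (by positivity)
          _ = _ := by
            rw [pow_succ, one_div, inv_pow]
            field_simp
  have h2 : (∑ m ∈ Finset.range N, α m * χ m) ^ 2 ≤
      (∑ m ∈ Finset.range N, α m ^ 2 * χ m * (1 / 2) ^ m) *
        ∑ m ∈ Finset.range N, χ m * 2 ^ m := by
    refine Finset.sum_sq_le_sum_mul_sum_of_sq_le_mul _ (fun m _ => ?_) (fun m _ => ?_)
      (fun m _ => ?_)
    · have := hχ0 m; positivity
    · have := hχ0 m; positivity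
    · refine le_of_eq ?_
      rw [one_div, inv_pow]
      rcases hχ m with h | h <;> simp [h]
  have h3 : D * ∑ m ∈ Finset.range N, α m ^ 2 * χ m * (1 / 2) ^ m ≤
      √2 * ∑ m ∈ Finset.range N, α m ^ 2 * χ m * (1 / 4) ^ m := by
    rw [Finset.mul_sum, Finset.mul_sum]
    refine Finset.sum_le_sum fun m _ => ?_
    rcases hχ m with h | ⟨h, h'⟩
    · simp [h]
    · rw [h, mul_one]
      calc _ ≤ (√2 * (1 / 2) ^ m) * (α m ^ 2 * (1 / 2) ^ m) := by gcongr
        _ = √2 * (α m ^ 2 * ((1 / 2) ^ m * (1 / 2) ^ m)) := by ring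
        _ = _ := by rw [← mul_pow]; norm_num
  have hs : √2 * √2 = 2 := Real.mul_self_sqrt (by norm_num)
  calc _ ≤ D ^ 2 * ((∑ m ∈ Finset.range N, α m ^ 2 * χ m * (1 / 2) ^ m) *
        ∑ m ∈ Finset.range N, χ m * 2 ^ m) := by gcongr
    _ = (D * ∑ m ∈ Finset.range N, α m ^ 2 * χ m * (1 / 2) ^ m) *
        (D * ∑ m ∈ Finset.range N, χ m * 2 ^ m) := by ring
    _ ≤ (√2 * ∑ m ∈ Finset.range N, α m ^ 2 * χ m * (1 / 4) ^ m) * (2 * √2) := by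
        refine mul_le_mul h3 (h1 N) ?_ ?_
        · exact mul_nonneg hD (Finset.sum_nonneg fun m _ => mul_nonneg (hχ0 m) (by positivity))
        · exact mul_nonneg (by positivity) (Finset.sum_nonneg fun m _ =>
            mul_nonneg (mul_nonneg (by positivity) (hχ0 m)) (by positivity))
    _ = _ := by
        linear_combination (2 * (∑ m ∈ Finset.range N, α m ^ 2 * χ m * (1 / 4) ^ m)) * hs

/-- The second moment of `|v|²` about the point `x`. -/
def spread {μ : Measure ℂ} (x : ℂ) (v : Lp ℂ 2 μ) : ℝ≥0∞ :=
  ∫⁻ z, ‖z - x‖ₑ ^ 2 * ‖v z‖ₑ ^ 2 ∂μ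

theorem spread_zero {μ : Measure ℂ} (x : ℂ) : spread x (0 : Lp ℂ 2 μ) = 0 := by
  have : spread x (0 : Lp ℂ 2 μ) = ∫⁻ _, 0 ∂μ := by
    refine lintegral_congr_ae ?_
    filter_upwards [Lp.coeFn_zero ℂ 2 μ] with z hz
    rw [hz]
    simp
  rw [this, lintegral_zero]

variable (μ : Measure ℂ) [IsFiniteMeasure μ]

theorem coeFn_sum_smul_ind (β : ℕ → ℝ) (c : ℕ → ℤ × ℤ) (N : ℕ) :
    ⇑(∑ m ∈ Finset.range N, (β m : ℂ) • ind μ m (c m)) =ᵐ[μ]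
      fun z => ((∑ m ∈ Finset.range N, β m * (cell m (c m)).indicator 1 z : ℝ) : ℂ) := by
  induction N with
  | zero =>
    filter_upwards [Lp.coeFn_zero ℂ 2 μ] with z hz
    rw [Finset.sum_range_zero, hz]
    simp
  | succ N ih =>
    rw [Finset.sum_range_succ]
    filter_upwards [ih, Lp.coeFn_add (∑ m ∈ Finset.range N, (β m : ℂ) • ind μ m (c m))
      ((β N : ℂ) • ind μ N (c N)), Lp.coeFn_smul (β N : ℂ) (ind μ N (c N)),
      indicatorConstLp_coeFn (p := 2) (hs := measurableSet_cell N (c N))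
        (hμs := measure_ne_top μ _) (c := (1 : ℂ))] with z h1 h2 h3 h4
    rw [h2, Pi.add_apply, h1, h3, Pi.smul_apply, ind, h4, Finset.sum_range_succ]
    by_cases hz : z ∈ cell N (c N) <;> simp [hz]

/-- By `starProjection_nind` the vector is a combination of indicators of nested squares around x;
the pointwise estimate is integrated, each indicator giving the measure of its square. -/
theorem spread_frame_le {M N : ℕ} (hN : N ≤ M + 1) (a : ℕ → ℝ) (x : ℂ)
    (hx : μ (cell M (cellIdx M x)) ≠ 0) :
    spread x (∑ m ∈ Finset.range N,
      (a m : ℂ) • (cellSpace μ m).starProjection (nind μ M (cellIdx M x))) ≤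
    ∑ m ∈ Finset.range N, ENNReal.ofReal (4 * a m ^ 2 * (1 / 4) ^ m) *
      (μ (cell M (cellIdx M x)) / μ (cell m (cellIdx m x))) := by
  set A := μ.real (cell M (cellIdx M x)) with hA
  have hApos : 0 < A := measureReal_pos_of_ne_zero μ hx
  have hpos : ∀ m ∈ Finset.range N, μ (cell m (cellIdx m x)) ≠ 0 := fun m hm h0 =>
    hx (measure_mono_null (cell_subset_of_le (by have := Finset.mem_range.1 hm; omega) x) h0)
  set α : ℕ → ℝ := fun m => √A * a m / μ.real (cell m (cellIdx m x)) with hα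
  have e1 : ∑ m ∈ Finset.range N,
      (a m : ℂ) • (cellSpace μ m).starProjection (nind μ M (cellIdx M x)) =
      ∑ m ∈ Finset.range N, (α m : ℂ) • ind μ m (cellIdx m x) :=
    Finset.sum_congr rfl fun m hm => by
      rw [starProjection_nind μ (by have := Finset.mem_range.1 hm; omega) x hx, smul_smul,
        ← Complex.ofReal_mul, hα]
      congr 2
      ring
  rw [e1, spread]
  calc _ ≤ ∫⁻ z, ∑ m ∈ Finset.range N, ENNReal.ofReal (4 * α m ^ 2 * (1 / 4) ^ m) *
        (cell m (cellIdx m x)).indicator 1 z ∂μ := by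
        refine lintegral_mono_ae ?_
        filter_upwards [coeFn_sum_smul_ind μ α (fun m => cellIdx m x) N] with z hz
        rw [hz]
        have h1 := weighted_sum_sq_le N (norm_nonneg (z - x))
          (fun m => (cell m (cellIdx m x)).indicator 1 z) α fun m => by
            by_cases hm : z ∈ cell m (cellIdx m x)
            · exact Or.inr ⟨by simp [hm], norm_sub_le_of_cellIdx_eq hm⟩
            · exact Or.inl (by simp [hm])
        simp only [← ofReal_norm, ← ENNReal.ofReal_pow (norm_nonneg _)]
        rw [← ENNReal.ofReal_mul (by positivity), Complex.norm_real, Real.norm_eq_abs, sq_abs]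
        refine (ENNReal.ofReal_le_ofReal h1).trans (le_of_eq ?_)
        rw [Finset.mul_sum, ENNReal.ofReal_sum_of_nonneg]
        · refine Finset.sum_congr rfl fun m _ => ?_
          by_cases hm : z ∈ cell m (cellIdx m x)
          · simp only [Set.indicator_of_mem hm, Pi.one_apply, mul_one, mul_assoc]
          · simp [hm]
        · intro m _
          have : (0 : ℝ) ≤ (cell m (cellIdx m x)).indicator 1 z :=
            Set.indicator_nonneg (fun _ _ => zero_le_one) _
          positivity
    _ = ∑ m ∈ Finset.range N, ENNReal.ofReal (4 * α m ^ 2 * (1 / 4) ^ m) *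
        μ (cell m (cellIdx m x)) := by
        rw [lintegral_finsetSum _ fun m _ =>
          (measurable_one.indicator (measurableSet_cell _ _)).const_mul _]
        refine Finset.sum_congr rfl fun m _ => ?_
        rw [lintegral_const_mul _ (measurable_one.indicator (measurableSet_cell _ _)),
          lintegral_indicator_one (measurableSet_cell _ _)]
    _ = _ := by
        refine Finset.sum_congr rfl fun m hm => ?_
        have hp := measureReal_pos_of_ne_zero μ (hpos m hm)
        rw [← ofReal_measureReal (μ := μ) (s := cell m (cellIdx m x)),
          ← ofReal_measureReal (μ := μ) (s := cell M (cellIdx M x)), ← hA,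
          ← ENNReal.ofReal_div_of_pos hp, ← ENNReal.ofReal_mul (by positivity),
          ← ENNReal.ofReal_mul (by positivity)]
        congr 1
        have := Real.sq_sqrt hApos.le
        rw [hα]
        simp only [div_pow, mul_pow, this]
        field_simp

/-- The subsquares of one level-m square contribute ratios of total at most 1, and a unit square has
4^m squares of level m. -/
theorem tsum_measure_ratio_le {q : ℤ × ℤ} (hq : μ (cell 0 q)ᶜ = 0) {m M : ℕ} (h : m ≤ M)
    (x : ℤ × ℤ → ℂ) (hx : ∀ c, μ (cell M c) ≠ 0 → x c ∈ cell M c) :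
    ∑' c, μ (cell M c) / μ (cell m (cellIdx m (x c))) ≤ 4 ^ m := by
  set F := Finset.Ico (2 ^ m * q.1) (2 ^ m * q.1 + 2 ^ m) ×ˢ
      Finset.Ico (2 ^ m * q.2) (2 ^ m * q.2 + 2 ^ m) with hF
  have hcard : (F.card : ℝ≥0∞) = 4 ^ m := by
    rw [hF, Finset.card_product, Int.card_Ico, Int.card_Ico]
    simp only [add_sub_cancel_left]
    have : ((2 : ℤ) ^ m).toNat = 2 ^ m := by
      rw [← Nat.cast_ofNat (R := ℤ), ← Nat.cast_pow, Int.toNat_natCast]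
    rw [this, ← mul_pow]
    norm_num
  have hc : ∀ c, μ (cell M c) / μ (cell m (cellIdx m (x c))) ≤
      ∑ c' ∈ F, μ (cell M c ∩ cell m c') / μ (cell m c') := fun c => by
    by_cases h0 : μ (cell M c) = 0
    · simp [h0]
    · have hxc := hx c h0
      have hsub : cell M c ⊆ cell m (cellIdx m (x c)) := by
        rw [← mem_cell.1 hxc]
        have := cell_subset_of_le h (x c)
        rwa [mem_cell.1 hxc] at this ⊢
      have hmem : cellIdx m (x c) ∈ F := by
        obtain ⟨z, hz1, hz2⟩ : (cell M c ∩ cell 0 q).Nonempty := by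
          by_contra hne
          rw [Set.not_nonempty_iff_eq_empty, ← Set.disjoint_iff_inter_eq_empty] at hne
          exact h0 (measure_mono_null hne.subset_compl_right hq)
        have := cellIdx_mem_of_cellIdx_zero m (mem_cell.1 hz2)
        rwa [mem_cell.1 (hsub hz1)] at this
      refine le_trans (le_of_eq ?_) (Finset.single_le_sum (fun _ _ => zero_le) hmem)
      rw [Set.inter_eq_left.2 hsub]
  calc _ ≤ ∑' c, ∑ c' ∈ F, μ (cell M c ∩ cell m c') / μ (cell m c') := ENNReal.tsum_le_tsum hc
    _ = ∑ c' ∈ F, ∑' c, μ (cell M c ∩ cell m c') / μ (cell m c') :=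
      Summable.tsum_finsetSum fun _ _ => ENNReal.summable
    _ ≤ ∑ c' ∈ F, 1 := by
      refine Finset.sum_le_sum fun c' _ => ?_
      simp only [div_eq_mul_inv]
      rw [ENNReal.tsum_mul_right, ← div_eq_mul_inv]
      refine ENNReal.div_le_of_le_mul ?_
      rw [one_mul, ← measure_iUnion]
      · exact measure_mono (Set.iUnion_subset fun c => Set.inter_subset_right)
      · exact fun c d hcd => (disjoint_cell M hcd).mono Set.inter_subset_left Set.inter_subset_left
      · exact fun c => (measurableSet_cell _ _).inter (measurableSet_cell _ _)
    _ = 4 ^ m := by rw [Finset.sum_const, nsmul_eq_mul, mul_one, hcard]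

/-- A finite measure on a unit square has Parseval frames of functions that are arbitrarily well
concentrated near points of its support. -/
theorem exists_concentrated_frame {q : ℤ × ℤ} (hq : μ (cell 0 q)ᶜ = 0) {ε : ℝ≥0∞} (hε : 0 < ε) :
    ∃ (v : ℕ × ℤ × ℤ → Lp ℂ 2 μ) (x : ℕ × ℤ × ℤ → ℂ),
      (∀ h, ∑' p, ‖inner ℂ (v p) h‖ₑ ^ 2 = ‖h‖ₑ ^ 2) ∧ ∑' p, spread (x p) (v p) ≤ ε ∧
      ∀ p, v p ≠ 0 → x p ∈ μ.support := by
  obtain ⟨b, hb1, hb2, hb3⟩ := SlowPartition.exists_slow_partition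
    (ENNReal.div_pos hε.ne' (by norm_num : (4 : ℝ≥0∞) ≠ ∞))
  choose M hM using hb2
  -- Squares of positive measure get a sample point in the support, where an essentially Lipschitz
  -- function has a value. Null squares give zero frame vectors, so any point does.
  have hpt : ∀ p : ℕ × ℤ × ℤ, ∃ x : ℂ, μ (cell (M p.1) p.2) ≠ 0 →
      x ∈ cell (M p.1) p.2 ∧ x ∈ μ.support := fun p => by
    by_cases h0 : μ (cell (M p.1) p.2) = 0
    · exact ⟨0, fun h => absurd h0 h⟩
    · obtain ⟨x, hx⟩ := Measure.nonempty_inter_support_of_pos (pos_iff_ne_zero.2 h0)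
      exact ⟨x, fun _ => hx⟩
  choose x hx using hpt
  refine ⟨fun p => ∑ m ∈ Finset.range (M p.1 + 1), ((b p.1 m - b p.1 (m + 1) : ℝ) : ℂ) •
    (cellSpace μ m).starProjection (nind μ (M p.1) p.2), x,
    Bessel.parseval_of_filtration (cellSpace μ) (monotone_cellSpace μ) (iSup_cellSpace_dense μ)
      (nind μ) (fun m g hg => tsum_inner_nind_sq μ m g hg) b hb1 M hM, ?_, fun p hp => ?_⟩
  · rw [ENNReal.tsum_prod']
    have hk : ∀ k, ∑' c, spread (x (k, c)) (∑ m ∈ Finset.range (M k + 1),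
        ((b k m - b k (m + 1) : ℝ) : ℂ) • (cellSpace μ m).starProjection (nind μ (M k) c)) ≤
        4 * ∑' m, ‖b k m - b k (m + 1)‖ₑ ^ 2 := fun k => by
      calc _ ≤ ∑' c, ∑ m ∈ Finset.range (M k + 1),
            ENNReal.ofReal (4 * (b k m - b k (m + 1)) ^ 2 * (1 / 4) ^ m) *
              (μ (cell (M k) c) / μ (cell m (cellIdx m (x (k, c))))) := by
            refine ENNReal.tsum_le_tsum fun c => ?_
            by_cases h0 : μ (cell (M k) c) = 0
            · simp [nind_eq_zero μ h0, spread_zero]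
            · have hc := mem_cell.1 (hx (k, c) h0).1
              have := spread_frame_le μ le_rfl (fun m => b k m - b k (m + 1)) (x (k, c))
                (M := M k) (by rw [hc]; exact h0)
              rwa [hc] at this
        _ = ∑ m ∈ Finset.range (M k + 1), ∑' c,
            ENNReal.ofReal (4 * (b k m - b k (m + 1)) ^ 2 * (1 / 4) ^ m) *
              (μ (cell (M k) c) / μ (cell m (cellIdx m (x (k, c))))) :=
          Summable.tsum_finsetSum fun _ _ => ENNReal.summable
        _ ≤ ∑ m ∈ Finset.range (M k + 1), 4 * ‖b k m - b k (m + 1)‖ₑ ^ 2 := by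
            refine Finset.sum_le_sum fun m hm => ?_
            rw [ENNReal.tsum_mul_left]
            refine (mul_le_mul_right (tsum_measure_ratio_le μ hq
              (by have := Finset.mem_range.1 hm; omega) _ fun c hc => (hx (k, c) hc).1) _).trans ?_
            rw [SlowPartition.enorm_sq_real, ← ENNReal.ofReal_ofNat 4,
              ← ENNReal.ofReal_pow (by norm_num), ← ENNReal.ofReal_mul (by positivity),
              ← ENNReal.ofReal_mul (by positivity)]
            refine ENNReal.ofReal_le_ofReal (le_of_eq ?_)
            -- The number 4^m of squares cancels the factor 4^{-m} of their second moments, leaving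
            -- only the squared differences of the weights.
            rw [mul_assoc, ← mul_pow]
            norm_num
        _ ≤ _ := by
            rw [← Finset.mul_sum]
            gcongr
            exact ENNReal.sum_le_tsum _
    refine (ENNReal.tsum_le_tsum hk).trans ?_
    rw [ENNReal.tsum_mul_left]
    refine (mul_le_mul_right hb3 4).trans (le_of_eq ?_)
    exact ENNReal.mul_div_cancel (by norm_num) (by norm_num)
  · refine (hx p fun h0 => hp ?_).2
    simp [nind_eq_zero μ h0]

end DyadicCell

/-! ## Essentially Lipschitz functions, and disjoint small sets -/

namespace DyadicCell

open Filter Topology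

/-- An essentially `1`-Lipschitz function has a value at every point of the support of the
measure. -/
theorem exists_value_of_ae_lipschitz {μ : Measure ℂ} [SFinite μ] {f : ℂ → ℂ}
    (hf : ∀ᵐ p ∂(μ.prod μ), ‖f p.1 - f p.2‖ ≤ ‖p.1 - p.2‖) {x : ℂ} (hx : x ∈ μ.support) :
    ∃ c : ℂ, ∀ᵐ t ∂μ, ‖f t - c‖ ≤ ‖t - x‖ := by
  have h1 := Measure.ae_ae_of_ae_prod hf
  -- As f is only defined almost everywhere, its value at x is a limit point of values at good
  -- points s n → x; every neighbourhood of x has positive measure, so good points exist there.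
  have h2 : ∀ n : ℕ, ∃ s, (∀ᵐ t ∂μ, ‖f s - f t‖ ≤ ‖s - t‖) ∧ dist s x < 1 / ((n : ℝ) + 1) :=
    fun n => by
      have h3 : μ (Metric.ball x (1 / ((n : ℝ) + 1))) ≠ 0 :=
        ((Measure.mem_support_iff_forall x).1 hx _ (Metric.ball_mem_nhds _ (by positivity))).ne'
      by_contra! hcon
      refine h3 (measure_mono_null (fun s hs => ?_) (ae_iff.1 h1))
      exact fun hs' => (not_lt.2 (hcon s hs')) hs
  choose s hs hsx using h2
  have hall : ∀ᵐ t ∂μ, ∀ n, ‖f (s n) - f t‖ ≤ ‖s n - t‖ := ae_all_iff.2 hs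
  have hμ : μ ≠ 0 := Measure.nonempty_support_iff.1 ⟨x, hx⟩
  have : NeBot (ae μ) := ae_neBot.2 hμ
  have hlim : Tendsto s atTop (𝓝 x) := by
    rw [tendsto_iff_dist_tendsto_zero]
    exact squeeze_zero (fun _ => dist_nonneg) (fun n => (hsx n).le)
      tendsto_one_div_add_atTop_nhds_zero_nat
  obtain ⟨t0, ht0⟩ := hall.exists
  have hbd : ∀ n, f (s n) ∈ Metric.closedBall (f t0) (1 + ‖x - t0‖) := fun n => by
    rw [Metric.mem_closedBall, dist_eq_norm]
    refine (ht0 n).trans ?_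
    have h4 : ‖s n - x‖ ≤ 1 := by
      rw [← dist_eq_norm]
      refine (hsx n).le.trans ?_
      rw [div_le_one (by positivity)]
      have : (0 : ℝ) ≤ n := n.cast_nonneg
      linarith
    calc ‖s n - t0‖ = ‖(s n - x) + (x - t0)‖ := by congr 1; ring
      _ ≤ ‖s n - x‖ + ‖x - t0‖ := norm_add_le _ _
      _ ≤ _ := by gcongr
  obtain ⟨c, -, φ, hφ, hc⟩ := tendsto_subseq_of_bounded Metric.isBounded_closedBall hbd
  refine ⟨c, ?_⟩
  filter_upwards [hall] with t ht
  rw [norm_sub_rev, norm_sub_rev t x]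
  exact le_of_tendsto_of_tendsto ((hc.sub_const (f t)).norm)
    (((hlim.comp hφ.tendsto_atTop).sub_const t).norm) (Eventually.of_forall fun n => ht (φ n))

/-- Around a support point of the restriction to A, small neighbourhoods have positive measure in A,
and arbitrarily small measure because points are null. -/
theorem exists_subset_measure_le {μ : Measure ℂ} [NullSingletonClass μ] [IsLocallyFiniteMeasure μ]
    {A : Set ℂ}
    (hA : MeasurableSet A) (h0 : μ A ≠ 0) {ε : ℝ≥0∞} (hε : ε ≠ 0) :
    ∃ B ⊆ A, MeasurableSet B ∧ μ B ≠ 0 ∧ μ B ≤ ε := by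
  obtain ⟨x, -, hx⟩ := Measure.nonempty_inter_support_of_pos (μ := μ.restrict A) (s := A)
    (by rw [Measure.restrict_apply_self]; exact pos_iff_ne_zero.2 h0)
  have hlt : μ {x} < ε := by rw [measure_singleton]; exact pos_iff_ne_zero.2 hε
  obtain ⟨U, hxU, hU, hUε⟩ := Set.exists_isOpen_lt_of_lt {x} ε hlt
  refine ⟨U ∩ A, Set.inter_subset_right, hU.measurableSet.inter hA, ?_,
    (measure_mono Set.inter_subset_left).trans hUε.le⟩
  rw [← Measure.restrict_apply hU.measurableSet]
  exact ((Measure.mem_support_iff_forall x).1 hx U (hU.mem_nhds (by simpa using hxU))).ne'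

/-- Sets C n are chosen in A n, each of measure at most a third of the preceding one. All later sets
together have measure at most half that of C n, so removing them from C n leaves positive measure
and makes the family disjoint. -/
theorem exists_disjoint_subsets_nat {μ : Measure ℂ} [NullSingletonClass μ]
    [IsLocallyFiniteMeasure μ] (A : ℕ → Set ℂ) (hA : ∀ n, MeasurableSet (A n))
    (h0 : ∀ n, μ (A n) ≠ 0) :
    ∃ N : ℕ → Set ℂ, (∀ n, N n ⊆ A n) ∧ (∀ n, MeasurableSet (N n)) ∧ (∀ n, μ (N n) ≠ 0) ∧
      (∀ n, μ (N n) ≠ ∞) ∧ Pairwise (Function.onFun Disjoint N) := by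
  have step : ∀ (n : ℕ) (t : {t : ℝ≥0∞ // t ≠ 0}), ∃ B ⊆ A n, MeasurableSet B ∧ μ B ≠ 0 ∧
      μ B ≤ min t.1 1 := fun n t => exists_subset_measure_le (hA n) (h0 n)
        (by rw [← pos_iff_ne_zero, lt_min_iff]; exact ⟨pos_iff_ne_zero.2 t.2, one_pos⟩)
  choose B hBA hBm hB0 hBt using step
  have h3 : ∀ t : ℝ≥0∞, t ≠ 0 → t / 3 ≠ 0 := fun t ht =>
    (ENNReal.div_pos ht (by norm_num)).ne'
  let t : ℕ → {t : ℝ≥0∞ // t ≠ 0} := fun n => Nat.rec ⟨1, one_ne_zero⟩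
    (fun n s => ⟨μ (B n s) / 3, h3 _ (hB0 n s)⟩) n
  set C : ℕ → Set ℂ := fun n => B n (t n) with hC
  have hC3 : ∀ n, μ (C (n + 1)) ≤ μ (C n) * 3⁻¹ := fun n =>
    (hBt (n + 1) (t (n + 1))).trans (min_le_left _ _)
  have hCfin : ∀ n, μ (C n) ≠ ∞ := fun n =>
    ((hBt n (t n)).trans (min_le_right _ _)).trans_lt ENNReal.one_lt_top |>.ne
  have hCpow : ∀ n i, μ (C (n + i)) ≤ μ (C n) * 3⁻¹ ^ i := fun n i => by
    induction i with
    | zero => simp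
    | succ i ih =>
      refine (hC3 (n + i)).trans ?_
      rw [pow_succ, ← mul_assoc]
      gcongr
  have hlt : ∀ n, μ (⋃ i, C (n + (i + 1))) < μ (C n) := fun n => by
    refine (measure_iUnion_le _).trans_lt ?_
    calc _ ≤ ∑' i, μ (C n) * 3⁻¹ ^ (i + 1) := ENNReal.tsum_le_tsum fun i => hCpow n _
      _ = μ (C n) * (3⁻¹ * (1 - 3⁻¹)⁻¹) := by
        rw [ENNReal.tsum_mul_left, ENNReal.tsum_geometric_add_one]
      _ < μ (C n) * 1 := by
        refine ENNReal.mul_lt_mul_right (hB0 n _) (hCfin n) ?_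
        rw [← div_eq_mul_inv]
        refine ENNReal.div_lt_of_lt_mul ?_
        rw [one_mul, lt_tsub_iff_right]
        rw [← ENNReal.toReal_lt_toReal (by finiteness) (by finiteness),
          ENNReal.toReal_add (by finiteness) (by finiteness)]
        norm_num
      _ = _ := mul_one _
  refine ⟨fun n => C n \ ⋃ i, C (n + (i + 1)), fun n => Set.sdiff_subset.trans (hBA n _),
    fun n => (hBm n _).diff (MeasurableSet.iUnion fun i => hBm _ _), fun n h => ?_,
    fun n => ne_top_of_le_ne_top (hCfin n) (measure_mono Set.sdiff_subset), ?_⟩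
  · have := measure_le_inter_add_sdiff μ (C n) (⋃ i, C (n + (i + 1)))
    rw [h, add_zero] at this
    exact absurd (this.trans (measure_mono Set.inter_subset_right)) (not_le.2 (hlt n))
  · refine (symm_disjoint.pairwise_on _).2 fun m n hmn => ?_
    obtain ⟨i, rfl⟩ := Nat.exists_eq_add_of_lt hmn
    refine (Set.disjoint_sdiff_left.mono_right ?_)
    refine Set.sdiff_subset.trans ?_
    rw [add_assoc]
    exact Set.subset_iUnion (fun i => C (m + (i + 1))) i

theorem exists_disjoint_subsets {κ : Type*} [Countable κ] {μ : Measure ℂ} [NullSingletonClass μ]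
    [IsLocallyFiniteMeasure μ] (A : κ → Set ℂ) (hA : ∀ n, MeasurableSet (A n))
    (h0 : ∀ n, μ (A n) ≠ 0) :
    ∃ N : κ → Set ℂ, (∀ n, N n ⊆ A n) ∧ (∀ n, MeasurableSet (N n)) ∧ (∀ n, μ (N n) ≠ 0) ∧
      (∀ n, μ (N n) ≠ ∞) ∧ Pairwise (Function.onFun Disjoint N) := by
  rcases isEmpty_or_nonempty κ with hκ | hκ
  · exact ⟨A, fun n => isEmptyElim n, fun n => isEmptyElim n, fun n => isEmptyElim n,
      fun n => isEmptyElim n, fun n => isEmptyElim n⟩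
  · obtain ⟨j, hj⟩ := exists_injective_nat κ
    obtain ⟨N, h1, h2, h3, h4, h5⟩ := exists_disjoint_subsets_nat (μ := μ)
      (fun n => A (Function.invFun j n)) (fun n => hA _) (fun n => h0 _)
    refine ⟨fun k => N (j k), fun k => ?_, fun k => h2 _, fun k => h3 _, fun k => h4 _,
      fun k k' hk => h5 (hj.ne hk)⟩
    simpa only [Function.leftInverse_invFun hj k] using h1 (j k)

end DyadicCell

/-! ## Vectors and operators supported in a subset -/

namespace ELam

open Filter Topology DyadicCell

variable {Ω B : Set ℂ}

theorem enorm_sq_L2 {μ : Measure ℂ} (g : Lp ℂ 2 μ) : ‖g‖ₑ ^ 2 = ∫⁻ z, ‖g z‖ₑ ^ 2 ∂μ := by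
  rw [Lp.enorm_def, eLpNorm_eq_lintegral_rpow_enorm_toReal (by norm_num) (by norm_num)]
  simp only [ENNReal.toReal_ofNat, ← ENNReal.rpow_two]
  rw [← ENNReal.rpow_mul]
  norm_num

theorem lintegral_indicator_leb (h : B ⊆ Ω) (hm : MeasurableSet B) (F : ℂ → ℝ≥0∞) :
    ∫⁻ z, B.indicator F z ∂leb Ω = ∫⁻ z, F z ∂leb B := by
  rw [lintegral_indicator hm, leb_restrict h hm]

theorem spread_extOp (h : B ⊆ Ω) (hm : MeasurableSet B) (x : ℂ) (w : L2 B) :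
    spread x (extOp h hm w) = spread x w := by
  rw [spread, spread, ← lintegral_indicator_leb h hm]
  refine lintegral_congr_ae ?_
  filter_upwards [coeFn_extOp h hm w] with z hz
  rw [hz]
  by_cases hB : z ∈ B <;> simp [hB]

theorem inner_extOp (h : B ⊆ Ω) (hm : MeasurableSet B) (w : L2 B) (g : L2 Ω) :
    inner ℂ (extOp h hm w) g = inner ℂ w (resOp h g) := by
  rw [← extOp_adjoint h hm, ContinuousLinearMap.adjoint_inner_right]

theorem enorm_sq_resOp (h : B ⊆ Ω) (g : L2 Ω) : ‖resOp h g‖ₑ ^ 2 = ∫⁻ z, ‖g z‖ₑ ^ 2 ∂leb B := by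
  rw [enorm_sq_L2]
  refine lintegral_congr_ae ?_
  filter_upwards [coeFn_resOp h g] with z hz
  rw [hz]

theorem coeFn_incl (h : B ⊆ Ω) (hm : MeasurableSet B) (f : Lp ℂ ∞ (leb B)) (w : L2 Ω) :
    incl h hm (mulOp f) w =ᵐ[leb Ω] B.indicator (fun z => f z * w z) := by
  filter_upwards [coeFn_extOp h hm (mulOp f (resOp h w)),
    ae_leb_imp h hm (coeFn_mulOp f (resOp h w)), ae_leb_imp h hm (coeFn_resOp h w)] with z h1 h2 h3
  refine h1.trans ?_
  by_cases hz : z ∈ B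
  · simp [hz, h2 hz, h3 hz]
  · simp [hz]

theorem enorm_incl_mulOp_sub_sq_le (h : B ⊆ Ω) (hm : MeasurableSet B) {f : Lp ℂ ∞ (leb B)}
    {w : L2 Ω} {c x : ℂ} (hf : ∀ᵐ t ∂leb B, ‖f t - c‖ ≤ ‖t - x‖)
    (hw : ∀ᵐ t ∂leb Ω, w t ≠ 0 → t ∈ B) :
    ‖incl h hm (mulOp f) w - c • w‖ₑ ^ 2 ≤ spread x w := by
  rw [enorm_sq_L2, spread]
  refine lintegral_mono_ae ?_
  filter_upwards [Lp.coeFn_sub (incl h hm (mulOp f) w) (c • w), Lp.coeFn_smul c w,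
    coeFn_incl h hm f w, hw, ae_leb_imp h hm hf] with z h1 h2 h3 h4 h5
  rw [h1, Pi.sub_apply, h2, h3, Pi.smul_apply, smul_eq_mul]
  by_cases hz : w z = 0
  · by_cases hB : z ∈ B <;> simp [hz, hB]
  · have hB := h4 hz
    rw [Set.indicator_of_mem hB, ← sub_mul, enorm_mul, mul_pow]
    gcongr
    simp only [← ofReal_norm]
    exact ENNReal.ofReal_le_ofReal (h5 hB)

theorem incl_mulOp_apply_of_disjoint (h : B ⊆ Ω) (hm : MeasurableSet B) (f : Lp ℂ ∞ (leb B))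
    {w : L2 Ω} (hw : ∀ᵐ t ∂leb Ω, w t ≠ 0 → t ∉ B) : incl h hm (mulOp f) w = 0 := by
  refine (Lp.eq_zero_iff_ae_eq_zero).2 ?_
  filter_upwards [coeFn_incl h hm f w, hw] with z h1 h2
  rw [h1]
  by_cases hB : z ∈ B
  · have : w z = 0 := by_contra fun h0 => h2 h0 hB
    simp [this]
  · simp [hB]

theorem incl_one_apply_of_mem (h : B ⊆ Ω) (hm : MeasurableSet B) {w : L2 Ω}
    (hw : ∀ᵐ t ∂leb Ω, w t ≠ 0 → t ∈ B) : incl h hm 1 w = w := by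
  refine Lp.ext ?_
  filter_upwards [coeFn_extOp h hm (resOp h w), ae_leb_imp h hm (coeFn_resOp h w), hw]
    with z h1 h2 h3
  refine h1.trans ?_
  by_cases hz : z ∈ B
  · rw [Set.indicator_of_mem hz, h2 hz]
  · rw [Set.indicator_of_notMem hz, by_contra fun h0 => hz (h3 (Ne.symm h0))]

theorem incl_one_apply_of_disjoint (h : B ⊆ Ω) (hm : MeasurableSet B) {w : L2 Ω}
    (hw : ∀ᵐ t ∂leb Ω, w t ≠ 0 → t ∉ B) : incl h hm 1 w = 0 := by
  refine (Lp.eq_zero_iff_ae_eq_zero).2 ?_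
  filter_upwards [coeFn_extOp h hm (resOp h w), ae_leb_imp h hm (coeFn_resOp h w), hw]
    with z h1 h2 h3
  refine h1.trans ?_
  by_cases hz : z ∈ B
  · rw [Set.indicator_of_mem hz, h2 hz, by_contra fun h0 => h3 h0 hz]; rfl
  · rw [Set.indicator_of_notMem hz]; rfl

theorem ae_norm_sub_le_of_eLpNorm_diffQuot_le {f : Lp ℂ ∞ (leb B)}
    (hf : eLpNorm (diffQuot f) ∞ ((leb B).prod (leb B)) ≤ 1) :
    ∀ᵐ p ∂((leb B).prod (leb B)), ‖f p.1 - f p.2‖ ≤ ‖p.1 - p.2‖ := by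
  rw [eLpNorm_exponent_top] at hf
  filter_upwards [ae_le_eLpNormEssSup (f := diffQuot f) (μ := (leb B).prod (leb B))] with p hp
  have h1 : ‖diffQuot f p‖ ≤ 1 := by
    have := hp.trans hf
    rwa [← ofReal_norm, ENNReal.ofReal_le_one] at this
  rw [diffQuot, norm_div] at h1
  by_cases h0 : p.1 - p.2 = 0
  · rw [sub_eq_zero] at h0
    simp [h0]
  · exact (div_le_one (norm_pos_iff.2 h0)).1 h1

theorem volume_cell_lt_top (q : ℤ × ℤ) : volume (cell 0 q) < ∞ := by
  refine Bornology.IsBounded.measure_lt_top (Metric.isBounded_iff.2 ⟨√2, fun z hz w hw => ?_⟩)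
  rw [dist_eq_norm]
  have := norm_sub_le_of_cellIdx_eq (hz.trans hw.symm : cellIdx 0 z = cellIdx 0 w)
  simpa using this

instance (q : ℤ × ℤ) : IsFiniteMeasure (leb (Ω ∩ cell 0 q)) :=
  ⟨by
    rw [Measure.restrict_apply_univ]
    exact (measure_mono Set.inter_subset_right).trans_lt (volume_cell_lt_top q)⟩

theorem tsum_enorm_sq_resOp_cell (hΩ : MeasurableSet Ω) (g : L2 Ω) :
    ∑' q, ‖resOp (Set.inter_subset_left : Ω ∩ cell 0 q ⊆ Ω) g‖ₑ ^ 2 = ‖g‖ₑ ^ 2 := by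
  simp only [enorm_sq_resOp]
  rw [enorm_sq_L2, ← lintegral_iUnion (fun q => hΩ.inter (measurableSet_cell 0 q))
    (fun q q' hq => (disjoint_cell 0 hq).mono Set.inter_subset_right Set.inter_subset_right),
    ← Set.inter_iUnion, iUnion_cell, Set.inter_univ]

/-- The normalized indicator of a subset of `Ω` of finite positive measure. -/
def unitInd (N : Set ℂ) (hN : MeasurableSet N) (h : leb Ω N ≠ ∞) : L2 Ω :=
  (((√((leb Ω).real N))⁻¹ : ℝ) : ℂ) • indicatorConstLp 2 hN h (1 : ℂ)

theorem coeFn_unitInd {N : Set ℂ} (hN : MeasurableSet N) (h : leb Ω N ≠ ∞) :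
    unitInd N hN h =ᵐ[leb Ω] N.indicator fun _ => (((√((leb Ω).real N))⁻¹ : ℝ) : ℂ) := by
  filter_upwards [Lp.coeFn_smul (((√((leb Ω).real N))⁻¹ : ℝ) : ℂ)
    (indicatorConstLp 2 hN h (1 : ℂ)), indicatorConstLp_coeFn (p := 2) (hs := hN)
        (hμs := h) (c := (1 : ℂ))] with z h1 h2
  rw [unitInd, h1, Pi.smul_apply, h2]
  by_cases hz : z ∈ N <;> simp [hz]

theorem orthonormal_unitInd {κ : Type*} {N : κ → Set ℂ} (hN : ∀ k, MeasurableSet (N k))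
    (h : ∀ k, leb Ω (N k) ≠ ∞) (h0 : ∀ k, leb Ω (N k) ≠ 0)
    (hd : Pairwise (Function.onFun Disjoint N)) :
    Orthonormal ℂ (fun k => unitInd (N k) (hN k) (h k)) := by
  classical
  rw [orthonormal_iff_ite]
  intro k k'
  rw [unitInd, unitInd, inner_smul_left, inner_smul_right,
    L2.inner_indicatorConstLp_one_indicatorConstLp_one (hN k) (hN k') (h k) (h k'),
    Complex.conj_ofReal]
  split_ifs with hk
  · subst hk
    have h1 : 0 < (leb Ω).real (N k) := ENNReal.toReal_pos (h0 k) (h k)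
    rw [Set.inter_self]
    have h2 := Real.mul_self_sqrt h1.le
    have h3 := (Real.sqrt_pos.2 h1).ne'
    have h4 : (√((leb Ω).real (N k)))⁻¹ * ((√((leb Ω).real (N k)))⁻¹ * (leb Ω).real (N k)) = 1 := by
      field_simp
      rw [sq, h2]
    have h5 := congrArg (fun r : ℝ => (r : ℂ)) h4
    simp only [Complex.ofReal_mul, Complex.ofReal_one] at h5
    exact h5
  · rw [(hd hk).inter_eq]
    simp

theorem spread_le_of_norm_le {x : ℂ} {r : ℝ} {w : L2 Ω} (hw : ‖w‖ = 1)
    (h : ∀ᵐ t ∂leb Ω, w t ≠ 0 → ‖t - x‖ ≤ r) : spread x w ≤ ENNReal.ofReal (r ^ 2) := by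
  calc spread x w ≤ ∫⁻ z, ENNReal.ofReal (r ^ 2) * ‖w z‖ₑ ^ 2 ∂leb Ω := by
        refine lintegral_mono_ae ?_
        filter_upwards [h] with t ht
        by_cases h0 : w t = 0
        · simp [h0]
        · gcongr
          rw [← ofReal_norm, ← ENNReal.ofReal_pow (norm_nonneg _)]
          have := ht h0
          exact ENNReal.ofReal_le_ofReal (by gcongr)
    _ = _ := by
        rw [lintegral_const_mul' _ _ ENNReal.ofReal_ne_top, ← enorm_sq_L2, ← ofReal_norm, hw]
        simp

end ELam

/-! ## Frames of `L²(Ω)` -/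

namespace ELam

open Filter Topology DyadicCell

variable {Ω B : Set ℂ}

theorem exists_mem_support_cell (h0 : volume Ω ≠ 0) :
    ∃ q x, x ∈ (leb (Ω ∩ cell 0 q)).support := by
  by_contra! hcon
  refine h0 ?_
  rw [← Set.inter_univ Ω, ← iUnion_cell 0, Set.inter_iUnion, measure_iUnion_null_iff]
  intro q
  have h1 : ¬ (leb (Ω ∩ cell 0 q)).support.Nonempty := fun ⟨x, hx⟩ => hcon q x hx
  rw [Measure.nonempty_support_iff, not_not, Measure.restrict_eq_zero] at h1
  exact h1

theorem ae_extOp_cell (hΩ : MeasurableSet Ω) (q : ℤ × ℤ) (w : L2 (Ω ∩ cell 0 q)) :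
    ∀ᵐ t ∂leb Ω, extOp Set.inter_subset_left (hΩ.inter (measurableSet_cell 0 q)) w t ≠ 0 →
      t ∈ cell 0 q := by
  filter_upwards [coeFn_extOp Set.inter_subset_left (hΩ.inter (measurableSet_cell 0 q)) w]
    with t ht h
  rw [ht] at h
  exact (Set.mem_of_indicator_ne_zero h).2

/-- Countably many Parseval frames of `L²(Ω)`, each consisting of functions that are supported in a
unit cell and concentrated around a point, and one orthonormal system which is concentrated around
the same points. -/
theorem exists_frames (hΩ : MeasurableSet Ω) (h0 : volume Ω ≠ 0) :
    ∃ (v : ℕ → (ℤ × ℤ) × (ℕ × ℤ × ℤ) → L2 Ω) (e : ℕ × (ℤ × ℤ) × (ℕ × ℤ × ℤ) → L2 Ω)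
      (x : ℕ × (ℤ × ℤ) × (ℕ × ℤ × ℤ) → ℂ) (q : ℕ × (ℤ × ℤ) × (ℕ × ℤ × ℤ) → ℤ × ℤ),
      (∀ l h, ∑' i, ‖inner ℂ (v l i) h‖ₑ ^ 2 = ‖h‖ₑ ^ 2) ∧ Orthonormal ℂ e ∧
      (∀ p, x p ∈ (leb (Ω ∩ cell 0 (q p))).support) ∧
      (∀ p, ∀ᵐ t ∂leb Ω, v p.1 p.2 t ≠ 0 → t ∈ cell 0 (q p)) ∧
      (∀ p, ∀ᵐ t ∂leb Ω, e p t ≠ 0 → t ∈ cell 0 (q p)) ∧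
      ∑' p, spread (x p) (v p.1 p.2) ≤ 1 ∧ ∑' p, spread (x p) (e p) ≤ 1 := by
  classical
  obtain ⟨q0, x0, hx0⟩ := exists_mem_support_cell h0
  obtain ⟨ε, hε, hε1⟩ := ENNReal.exists_pos_sum_of_countable one_ne_zero (ℕ × ℤ × ℤ)
  have hc : ∀ q : ℤ × ℤ, leb (Ω ∩ cell 0 q) (cell 0 q)ᶜ = 0 := fun q => by
    rw [Measure.restrict_apply (measurableSet_cell 0 q).compl, Set.inter_comm, Set.inter_assoc,
      Set.inter_compl_self, Set.inter_empty, measure_empty]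
  have hm : ∀ q : ℤ × ℤ, MeasurableSet (Ω ∩ cell 0 q) := fun q =>
    hΩ.inter (measurableSet_cell 0 q)
  have hs : ∀ q : ℤ × ℤ, Ω ∩ cell 0 q ⊆ Ω := fun q => Set.inter_subset_left
  choose w y hw hwy hy using fun (l : ℕ) (q : ℤ × ℤ) =>
    exists_concentrated_frame (leb (Ω ∩ cell 0 q)) (hc q) (ε := (ε (l, q) : ℝ≥0∞))
      (by simpa using hε (l, q))
  set v : ℕ → (ℤ × ℤ) × (ℕ × ℤ × ℤ) → L2 Ω := fun l i =>
    extOp (hs i.1) (hm i.1) (w l i.1 i.2) with hv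
  -- A zero frame vector comes with no support point; the default x0, in the square q0, keeps x p in
  -- the support for every p. This is needed for the values of f and for room to place e p.
  set x : ℕ × (ℤ × ℤ) × (ℕ × ℤ × ℤ) → ℂ := fun p =>
    if w p.1 p.2.1 p.2.2 = 0 then x0 else y p.1 p.2.1 p.2.2 with hx
  set q : ℕ × (ℤ × ℤ) × (ℕ × ℤ × ℤ) → ℤ × ℤ := fun p =>
    if w p.1 p.2.1 p.2.2 = 0 then q0 else p.2.1 with hq
  have hxq : ∀ p, x p ∈ (leb (Ω ∩ cell 0 (q p))).support := fun p => by
    by_cases h : w p.1 p.2.1 p.2.2 = 0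
    · simp only [hx, hq, h, if_true]
      exact hx0
    · simp only [hx, hq, h, if_false]
      exact hy _ _ _ h
  obtain ⟨η, hη, hη1⟩ := ENNReal.exists_pos_sum_of_countable one_ne_zero
    (ℕ × (ℤ × ℤ) × (ℕ × ℤ × ℤ))
  have hr : ∀ p, 0 < √(η p : ℝ) := fun p => Real.sqrt_pos.2 (hη p)
  -- The radius √η makes the second moment of the unit vector carried by N p at most η p.
  -- Disjointness gives orthogonality even if points x p coincide.
  obtain ⟨N, hNA, hNm, hN0, hNt, hNd⟩ := exists_disjoint_subsets (μ := leb Ω)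
    (fun p => (Ω ∩ cell 0 (q p)) ∩ Metric.ball (x p) (√(η p : ℝ)))
    (fun p => (hm _).inter measurableSet_ball) (fun p => by
      rw [Measure.restrict_eq_self _ (Set.inter_subset_left.trans (hs _)), Set.inter_comm,
        ← Measure.restrict_apply measurableSet_ball]
      exact ((Measure.mem_support_iff_forall _).1 (hxq p) _ (Metric.ball_mem_nhds _ (hr p))).ne')
  have hon := orthonormal_unitInd hNm hNt hN0 hNd
  have heN : ∀ p, ∀ᵐ t ∂leb Ω, unitInd (N p) (hNm p) (hNt p) t ≠ 0 → t ∈ N p := fun p => by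
    filter_upwards [coeFn_unitInd (hNm p) (hNt p)] with t ht h
    rw [ht] at h
    exact Set.mem_of_indicator_ne_zero h
  refine ⟨v, fun p => unitInd (N p) (hNm p) (hNt p), x, q, fun l h => ?_, hon, hxq, fun p => ?_,
    fun p => ?_, ?_, ?_⟩
  · refine (ENNReal.tsum_prod' (f := fun i => ‖inner ℂ (v l i) h‖ₑ ^ 2)).trans
      (Eq.trans ?_ (tsum_enorm_sq_resOp_cell hΩ h))
    refine tsum_congr fun c => ?_
    rw [← hw l c (resOp (hs c) h)]
    exact tsum_congr fun i => by rw [hv, inner_extOp]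
  · by_cases h : w p.1 p.2.1 p.2.2 = 0
    · simp only [hv, h, map_zero]
      filter_upwards [Lp.coeFn_zero ℂ 2 (leb Ω)] with t ht h'
      exact absurd ht h'
    · simp only [hv, hq, h, if_false]
      exact ae_extOp_cell hΩ _ _
  · filter_upwards [heN p] with t ht h
    exact (hNA p (ht h)).1.2
  · calc ∑' p, spread (x p) (v p.1 p.2)
        ≤ ∑' p : ℕ × (ℤ × ℤ) × (ℕ × ℤ × ℤ), spread (y p.1 p.2.1 p.2.2) (w p.1 p.2.1 p.2.2) := by
          refine ENNReal.tsum_le_tsum fun p => ?_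
          simp only [hv, spread_extOp, hx]
          split_ifs with h
          · rw [h, spread_zero]
            exact zero_le
          · exact le_rfl
      _ = ∑' (l : ℕ) (c : ℤ × ℤ) (i : ℕ × ℤ × ℤ), spread (y l c i) (w l c i) := by
          rw [ENNReal.tsum_prod']
          refine tsum_congr fun l => ?_
          rw [ENNReal.tsum_prod']
      _ ≤ ∑' (l : ℕ) (c : ℤ × ℤ), (ε (l, c) : ℝ≥0∞) :=
          ENNReal.tsum_le_tsum fun l => ENNReal.tsum_le_tsum fun c => hwy l c
      _ ≤ 1 := (ENNReal.tsum_prod' (f := fun p => (ε p : ℝ≥0∞))).symm.trans_le hε1.le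
  · refine (ENNReal.tsum_le_tsum fun p => ?_).trans hη1.le
    have := spread_le_of_norm_le (x := x p) (r := √(η p : ℝ)) (hon.1 p) (by
      filter_upwards [heN p] with t ht h
      have := (hNA p (ht h)).2
      rw [Metric.mem_ball, dist_eq_norm] at this
      exact this.le)
    refine this.trans ?_
    rw [Real.sq_sqrt (η p).coe_nonneg, ENNReal.ofReal_coe_nnreal]

end ELam

/-! ## Isometries that respect the unit cells -/

namespace ELam

open Filter Topology DyadicCell
open scoped ComplexConjugate

variable {Ω B : Set ℂ}

theorem eq_zero_of_hsNorm_eq_zero {T : L2 Ω →L[ℂ] L2 Ω} (h : hsNorm T = 0) : T = 0 := by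
  obtain ⟨w, b, -⟩ := exists_hilbertBasis ℂ (L2 Ω)
  have h1 := Bessel.hsNorm_sq_eq b T
  rw [h, zero_pow two_ne_zero, eq_comm, ENNReal.tsum_eq_zero] at h1
  refine ContinuousLinearMap.ext_on (Submodule.dense_iff_topologicalClosure_eq_top.2 b.dense_span)
    ?_
  rintro _ ⟨i, rfl⟩
  simpa using h1 i

/-- The compression to `L²(B)` of an operator on `L²(Ω)`. -/
def compress (h : B ⊆ Ω) (hm : MeasurableSet B) (X : L2 Ω →L[ℂ] L2 Ω) : L2 B →L[ℂ] L2 B :=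
  resOp h ∘L X ∘L extOp h hm

/-- Functions on B act on L²(Ω) as M_f ⊕ 0, so compressions are tested without extending Lipschitz
functions from B to Ω. -/
theorem compress_commutator (h : B ⊆ Ω) (hm : MeasurableSet B) (X : L2 Ω →L[ℂ] L2 Ω)
    (M : L2 B →L[ℂ] L2 B) : M * compress h hm X - compress h hm X * M =
      resOp h ∘L (incl h hm M * X - X * incl h hm M) ∘L extOp h hm := by
  ext1 x
  simp [incl, compress, resOp_extOp]

theorem compress_refl (hm : MeasurableSet Ω) (X : L2 Ω →L[ℂ] L2 Ω) :
    compress subset_rfl hm X = X := by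
  have h1 : ∀ g : L2 Ω, resOp subset_rfl g = g := fun g => Lp.ext (coeFn_resOp _ g)
  have h2 : ∀ g : L2 Ω, extOp subset_rfl hm g = g := fun g => by
    rw [← h1 (extOp _ _ _), resOp_extOp]
  ext1 x
  simp [compress, h1, h2]

/-- Operators which commute with the restriction to every union of unit cells, and whose
compressions to these unions lie in `EΛ`. -/
def IsCellular (X : L2 Ω →L[ℂ] L2 Ω) : Prop :=
  ∀ (S : Set (ℤ × ℤ)) (B : Set ℂ) (h : B ⊆ Ω) (hm : MeasurableSet B),
    B = Ω ∩ cellIdx 0 ⁻¹' S → Commute (incl h hm 1) X ∧ compress h hm X ∈ EL B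

theorem IsCellular.mem_EL (hΩ : MeasurableSet Ω) {X : L2 Ω →L[ℂ] L2 Ω} (hX : IsCellular X) :
    X ∈ EL Ω := by
  have := (hX Set.univ Ω subset_rfl hΩ (by simp)).2
  rwa [compress_refl] at this

/-- Since B is cut out by unit squares, w lies either inside B, where c is the value of f at x, or
off B, where M_f ⊕ 0 kills it and c = 0. The same c serves every w, hence both the frame vector and
its orthonormal partner. -/
theorem exists_value_of_diffQuot (hΩ : MeasurableSet Ω) {f : Lp ℂ ∞ (leb B)}
    (hf : eLpNorm (diffQuot f) ∞ ((leb B).prod (leb B)) ≤ 1) {S : Set (ℤ × ℤ)}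
    (h : B ⊆ Ω) (hm : MeasurableSet B) (hB : B = Ω ∩ cellIdx 0 ⁻¹' S) {q : ℤ × ℤ} {x : ℂ}
    (hx : x ∈ (leb (Ω ∩ cell 0 q)).support) :
    ∃ c : ℂ, ∀ w : L2 Ω, (∀ᵐ t ∂leb Ω, w t ≠ 0 → t ∈ cell 0 q) →
      ‖incl h hm (mulOp f) w - c • w‖ₑ ^ 2 ≤ spread x w ∧
      ‖star (incl h hm (mulOp f)) w - conj c • w‖ₑ ^ 2 ≤ spread x w := by
  rw [← incl_star, mulOp_adjoint]
  by_cases hq : q ∈ S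
  · have hsub : Ω ∩ cell 0 q ⊆ B := by
      rw [hB]
      refine Set.inter_subset_inter_right _ fun z hz => ?_
      rw [mem_cell] at hz
      rwa [Set.mem_preimage, hz]
    obtain ⟨c, hc⟩ := exists_value_of_ae_lipschitz (ae_norm_sub_le_of_eLpNorm_diffQuot_le hf)
      (Measure.support_mono (leb_mono hsub) hx)
    have hw' : ∀ w : L2 Ω, (∀ᵐ t ∂leb Ω, w t ≠ 0 → t ∈ cell 0 q) →
        ∀ᵐ t ∂leb Ω, w t ≠ 0 → t ∈ B := fun w hw => by
      filter_upwards [hw, ae_restrict_mem hΩ] with t h1 h2 h3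
      exact hsub ⟨h2, h1 h3⟩
    refine ⟨c, fun w hw => ⟨enorm_incl_mulOp_sub_sq_le h hm hc (hw' w hw),
      enorm_incl_mulOp_sub_sq_le h hm ?_ (hw' w hw)⟩⟩
    filter_upwards [hc, Lp.coeFn_star f] with t h1 h2
    rw [h2, Pi.star_apply, ← starRingEnd_apply, ← map_sub, RCLike.norm_conj]
    exact h1
  · refine ⟨0, fun w hw => ?_⟩
    have hw' : ∀ᵐ t ∂leb Ω, w t ≠ 0 → t ∉ B := by
      filter_upwards [hw] with t ht h0 hB'
      rw [hB] at hB'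
      have := mem_cell.1 (ht h0)
      exact hq (this ▸ hB'.2)
    simp [incl_mulOp_apply_of_disjoint h hm _ hw']

theorem exists_cellular_isometries (hΩ : MeasurableSet Ω) :
    ∃ R W : L2 Ω →L[ℂ] L2 Ω, star R * R = 1 ∧ star W * W = 1 ∧ R * star R + W * star W = 1 ∧
      IsCellular R ∧ IsCellular W := by
  by_cases h0 : volume Ω = 0
  · have hz : leb Ω Set.univ = 0 := by rw [Measure.restrict_apply_univ, h0]
    have : Subsingleton (L2 Ω) := ⟨fun f g => Lp.ext (ae_iff.2
      (measure_mono_null (Set.subset_univ _) hz))⟩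
    have hc : IsCellular (0 : L2 Ω →L[ℂ] L2 Ω) := fun S B h hm _ =>
      ⟨Commute.zero_right _, by
        rw [show compress h hm (0 : L2 Ω →L[ℂ] L2 Ω) = 0 by ext1; simp [compress]]
        exact zero_mem _⟩
    exact ⟨0, 0, Subsingleton.elim _ _, Subsingleton.elim _ _, Subsingleton.elim _ _, hc, hc⟩
  obtain ⟨v, e, x, q, hv, he, hx, hvq, heq, hvx, hex⟩ := exists_frames hΩ h0
  obtain ⟨R, W, hR, hW, hRW, hcomm⟩ := Bessel.exists_isometries v e hv he
  have key : ∀ (S : Set (ℤ × ℤ)) (B : Set ℂ) (h : B ⊆ Ω) (hm : MeasurableSet B),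
      B = Ω ∩ cellIdx 0 ⁻¹' S →
      (hsNorm (incl h hm 1 * R - R * incl h hm 1) ^ 2 ≤ 88 * 0 ∧
        hsNorm (incl h hm 1 * W - W * incl h hm 1) ^ 2 ≤ 88 * 0) ∧
      ∀ f : Lp ℂ ∞ (leb B), eLpNorm (diffQuot f) ∞ ((leb B).prod (leb B)) ≤ 1 →
      hsNorm (incl h hm (mulOp f) * R - R * incl h hm (mulOp f)) ^ 2 ≤ 88 * 1 ∧
      hsNorm (incl h hm (mulOp f) * W - W * incl h hm (mulOp f)) ^ 2 ≤ 88 * 1 := by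
    intro S B h hm hB
    constructor
    · classical
      have hP : ∀ p (w : L2 Ω), (∀ᵐ t ∂leb Ω, w t ≠ 0 → t ∈ cell 0 (q p)) →
          incl h hm 1 w - (if q p ∈ S then (1 : ℂ) else 0) • w = 0 ∧
          star (incl h hm 1) w - conj (if q p ∈ S then (1 : ℂ) else 0) • w = 0 := by
        intro p w hw
        rw [← incl_star, star_one]
        have hw' : ∀ᵐ t ∂leb Ω, t ∈ Ω := ae_restrict_mem hΩ
        split_ifs with hq
        · rw [map_one, one_smul, incl_one_apply_of_mem h hm, sub_self]
          · simp
          · filter_upwards [hw, hw'] with t h1 h2 h3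
            rw [hB]
            exact ⟨h2, by rw [Set.mem_preimage, mem_cell.1 (h1 h3)]; exact hq⟩
        · rw [map_zero, zero_smul, sub_zero, incl_one_apply_of_disjoint h hm]
          · simp
          · filter_upwards [hw] with t h1 h3 h4
            rw [hB] at h4
            exact hq (mem_cell.1 (h1 h3) ▸ h4.2)
      -- For the projection onto L²(B) all vectors are exact eigenvectors, with eigenvalue 1 or 0,
      -- so τ = 0 and the commutators vanish.
      refine hcomm (incl h hm 1) (fun p => if q p ∈ S then 1 else 0) 0 ENNReal.zero_lt_top
        ?_ ?_ ?_ ?_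
      · simp only [(hP _ _ (heq _)).1]; simp
      · simp only [(hP _ _ (heq _)).2]; simp
      · simp only [(hP _ _ (hvq _)).1]; simp
      · simp only [(hP _ _ (hvq _)).2]; simp
    · intro f hf
      choose c hc using fun p => exists_value_of_diffQuot hΩ hf h hm hB (hx p)
      exact hcomm (incl h hm (mulOp f)) c 1 ENNReal.one_lt_top
        ((ENNReal.tsum_le_tsum fun p => (hc p _ (heq p)).1).trans hex)
        ((ENNReal.tsum_le_tsum fun p => (hc p _ (heq p)).2).trans hex)
        ((ENNReal.tsum_le_tsum fun p => (hc p _ (hvq p)).1).trans hvx)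
        ((ENNReal.tsum_le_tsum fun p => (hc p _ (hvq p)).2).trans hvx)
  have fin : ∀ X : L2 Ω →L[ℂ] L2 Ω,
      (∀ (S : Set (ℤ × ℤ)) (B : Set ℂ) (h : B ⊆ Ω) (hm : MeasurableSet B),
        B = Ω ∩ cellIdx 0 ⁻¹' S →
        hsNorm (incl h hm 1 * X - X * incl h hm 1) ^ 2 ≤ 88 * 0 ∧
        ∀ f : Lp ℂ ∞ (leb B), eLpNorm (diffQuot f) ∞ ((leb B).prod (leb B)) ≤ 1 →
          hsNorm (incl h hm (mulOp f) * X - X * incl h hm (mulOp f)) ^ 2 ≤ 88 * 1) →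
      IsCellular X := by
    intro X hX S B h hm hB
    obtain ⟨h1, h2⟩ := hX S B h hm hB
    constructor
    · refine sub_eq_zero.1 (eq_zero_of_hsNorm_eq_zero ?_)
      simpa using h1
    · refine (lipNorm_le _ (‖resOp h‖ₑ * (88 * ‖extOp h hm‖ₑ)) fun f hf => ?_).trans_lt ?_
      · rw [compress_commutator]
        refine (hsNorm_comp_le _ _).trans ?_
        gcongr
        refine (hsNorm_comp_le' _ _).trans ?_
        gcongr
        have h3 := h2 f hf
        by_contra! h4
        refine absurd h3 (not_le.2 ?_)
        -- The estimate bounds the square of the norm by 88, so 88 bounds the norm itself.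
        calc (88 * 1 : ℝ≥0∞) ≤ 88 ^ 2 := by norm_num
          _ < _ := by gcongr
      · finiteness
  exact ⟨R, W, hR, hW, hRW,
    fin R fun S B h hm hB => ⟨(key S B h hm hB).1.1, fun f hf => ((key S B h hm hB).2 f hf).1⟩,
    fin W fun S B h hm hB => ⟨(key S B h hm hB).1.2, fun f hf => ((key S B h hm hB).2 f hf).2⟩⟩

end ELam

/-! ## Cellular operators and the algebra `EΛ(ℂ)₀` -/

namespace ELam

open DyadicCell

variable {Ω B : Set ℂ}

theorem IsCellular.one : IsCellular (1 : L2 Ω →L[ℂ] L2 Ω) := fun S B h hm _ =>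
  ⟨Commute.one_right _, by
    rw [show compress h hm (1 : L2 Ω →L[ℂ] L2 Ω) = 1 by ext1; simp [compress, resOp_extOp]]
    exact one_mem _⟩

theorem IsCellular.mul {X Y : L2 Ω →L[ℂ] L2 Ω} (hX : IsCellular X) (hY : IsCellular Y) :
    IsCellular (X * Y) := fun S B h hm hB => by
  obtain ⟨h1, h2⟩ := hX S B h hm hB
  obtain ⟨h3, h4⟩ := hY S B h hm hB
  refine ⟨h1.mul_right h3, ?_⟩
  have : compress h hm (X * Y) = compress h hm X * compress h hm Y := by
    ext1 x
    have h5 := congrArg (resOp h) (DFunLike.congr_fun h1.eq (Y (extOp h hm x)))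
    simpa [incl, compress, resOp_extOp] using h5
  rw [this]
  exact mul_mem h2 h4

theorem IsCellular.star {X : L2 Ω →L[ℂ] L2 Ω} (hX : IsCellular X) : IsCellular (star X) :=
    fun S B h hm hB => by
  obtain ⟨h1, h2⟩ := hX S B h hm hB
  constructor
  · have := h1.star_star
    rwa [← incl_star, star_one] at this
  · have : compress h hm (Star.star X) = Star.star (compress h hm X) := by
      rw [ContinuousLinearMap.star_eq_adjoint, ContinuousLinearMap.star_eq_adjoint, compress,
        compress, ContinuousLinearMap.adjoint_comp, ContinuousLinearMap.adjoint_comp,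
        extOp_adjoint, ← extOp_adjoint h hm, ContinuousLinearMap.adjoint_adjoint,
        ContinuousLinearMap.comp_assoc]
    rw [this]
    exact star_mem h2

theorem isBounded_cells {B : Set ℂ} (hB : Bornology.IsBounded B) :
    Bornology.IsBounded (cellIdx 0 ⁻¹' (cellIdx 0 '' B)) := by
  refine (hB.cthickening (δ := √2)).subset ?_
  rintro z ⟨b, hb, hbz⟩
  refine Metric.mem_cthickening_of_dist_le z b _ _ hb ?_
  rw [dist_comm, dist_eq_norm]
  simpa using norm_sub_le_of_cellIdx_eq hbz

theorem mul_incl_mul {X Y : L2 Ω →L[ℂ] L2 Ω} (h : B ⊆ Ω) (hm : MeasurableSet B)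
    (hX : Commute (incl h hm 1) X) (hY : Commute (incl h hm 1) Y) (S : L2 B →L[ℂ] L2 B) :
    X * incl h hm S * Y = incl h hm (compress h hm X * S * compress h hm Y) := by
  have h1 : incl h hm S = incl h hm 1 * incl h hm S * incl h hm 1 := by
    rw [← incl_mul, ← incl_mul, one_mul, mul_one]
  have h2 : incl h hm (compress h hm X * S * compress h hm Y) =
      incl h hm 1 * X * incl h hm S * (Y * incl h hm 1) := by
    ext1 x
    simp [incl, compress]
  rw [h2, ← hY.eq, hX.eq]
  conv_lhs => rw [h1]
  simp only [mul_assoc]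

/-- The bounded set B is enlarged to the union E of the unit squares it meets. E is still bounded, X
and Y commute with the projection onto L²(E), and their compressions to it lie in EΛ(E). -/
theorem mul_bddPart_mul {X Y T : L2 Set.univ →L[ℂ] L2 Set.univ} (hX : IsCellular X)
    (hY : IsCellular Y) (hT : T ∈ bddPart Set.univ) : X * T * Y ∈ bddPart Set.univ := by
  obtain ⟨B, h, hm, hb, S, hS, rfl⟩ := hT
  set E := cellIdx 0 ⁻¹' (cellIdx 0 '' B) with hE
  have hBE : B ⊆ E := Set.subset_preimage_image _ _
  have hEm : MeasurableSet E := measurableSet_preimage_cellIdx 0 _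
  have hE' : E = Set.univ ∩ cellIdx 0 ⁻¹' (cellIdx 0 '' B) := by rw [Set.univ_inter]
  obtain ⟨h1, h2⟩ := hX _ E (Set.subset_univ _) hEm hE'
  obtain ⟨h3, h4⟩ := hY _ E (Set.subset_univ _) hEm hE'
  rw [← incl_incl hBE (Set.subset_univ _) hm hEm, mul_incl_mul _ _ h1 h3]
  exact ⟨E, _, hEm, isBounded_cells hb, _, mul_mem (mul_mem h2 (incl_mem_EL _ _ hS)) h4, rfl⟩

/-- X and Y need only have finite triple norm; submultiplicativity then carries the approximation by
bounded pieces over to the product. -/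
theorem mul_EL0_mul {X Y T : L2 Set.univ →L[ℂ] L2 Set.univ} (hX : IsCellular X)
    (hY : IsCellular Y) (hT : T ∈ EL0 Set.univ) : X * T * Y ∈ EL0 Set.univ := by
  obtain ⟨hT, ha⟩ := hT
  have hX' := hX.mem_EL MeasurableSet.univ
  have hY' := hY.mem_EL MeasurableSet.univ
  refine ⟨mul_mem (mul_mem hX' hT) hY', fun ε hε => ?_⟩
  obtain ⟨δ, hδ, hδε⟩ := ENNReal.exists_pos_mul_lt
    (ENNReal.mul_ne_top ((tripleNorm_lt_top_iff X).2 hX').ne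
      ((tripleNorm_lt_top_iff Y).2 hY').ne) hε.ne'
  obtain ⟨S, hS, hSδ⟩ := ha δ hδ
  refine ⟨X * S * Y, mul_bddPart_mul hX hY hS, ?_⟩
  rw [← sub_mul, ← mul_sub]
  calc _ ≤ tripleNorm X * tripleNorm (T - S) * tripleNorm Y :=
        (tripleNorm_mul_le _ _).trans (by gcongr; exact tripleNorm_mul_le _ _)
    _ ≤ tripleNorm X * δ * tripleNorm Y := by gcongr
    _ = δ * (tripleNorm X * tripleNorm Y) := by ring
    _ < ε := hδε

/-- Two isometries with complementary ranges yield `n + 1` isometries with complementary ranges. -/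
theorem exists_complementary_isometries {A : Type*} [Ring A] [StarRing A] (C : A → Prop)
    (h1 : C 1) (hmul : ∀ x y, C x → C y → C (x * y)) (hstar : ∀ x, C x → C (star x)) {R W : A}
    (hR : star R * R = 1) (hW : star W * W = 1) (hRW : R * star R + W * star W = 1)
    (hCR : C R) (hCW : C W) (n : ℕ) :
    ∃ V : Fin (n + 1) → A, (∀ k, C (V k)) ∧
      (∀ j k, V j * star (V k) = if j = k then 1 else 0) ∧ ∑ k, star (V k) * V k = 1 := by
  -- Sandwiching RR* + WW* = 1 between R* and W gives 2 R*W = R*W.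
  have hz : star R * W = 0 := by
    have h2 : star R * (R * star R + W * star W) * W = star R * W := by rw [hRW, mul_one]
    have h3 : star R * (R * star R + W * star W) * W =
        (star R * R) * star R * W + star R * W * (star W * W) := by noncomm_ring
    rw [h2, hR, hW, one_mul, mul_one] at h3
    simpa using h3
  have hz' : star W * R = 0 := by
    have := congrArg star hz
    rwa [star_mul, star_star, star_zero] at this
  induction n with
  | zero =>
    refine ⟨fun _ => 1, fun _ => h1, fun j k => ?_, by simp⟩
    rw [if_pos (Fin.ext (by omega)), star_one, one_mul]
  | succ n ih =>
    obtain ⟨V, hC, hV, hV1⟩ := ih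
    -- The space splits as ran R ⊕ ran W, and the family already found is transported to ran W by
    -- W*.
    refine ⟨Fin.cons (star R) fun k => V k * star W, fun k => ?_, fun j k => ?_, ?_⟩
    · refine Fin.cases ?_ (fun k => ?_) k
      · exact hstar _ hCR
      · exact hmul _ _ (hC k) (hstar _ hCW)
    · refine Fin.cases ?_ (fun j => ?_) j <;> refine Fin.cases ?_ (fun k => ?_) k
      · simp [hR]
      · simp only [Fin.cons_zero, Fin.cons_succ, star_mul, star_star, ← mul_assoc, hz, zero_mul]
        rw [if_neg (Fin.succ_ne_zero k).symm]
      · simp only [Fin.cons_zero, Fin.cons_succ, star_star, mul_assoc, hz', mul_zero]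
        rw [if_neg (Fin.succ_ne_zero j)]
      · simp only [Fin.cons_succ, star_mul, star_star, Fin.succ_inj]
        rw [← hV j k, mul_assoc, ← mul_assoc (star W), hW, one_mul]
    · rw [Fin.sum_univ_succ]
      simp only [Fin.cons_zero, Fin.cons_succ, star_mul, star_star]
      rw [← hRW]
      congr 1
      calc ∑ k, W * star (V k) * (V k * star W) = W * (∑ k, star (V k) * V k) * star W := by
            rw [Finset.mul_sum, Finset.sum_mul]
            exact Finset.sum_congr rfl fun k _ => by simp only [mul_assoc]
        _ = _ := by rw [hV1, mul_one]

end ELam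

/-! ## Spatial isomorphisms with amplifications -/

namespace ELam

variable {Ω : Set ℂ} {n : ℕ}

/-- The unitary `h ↦ ∑ V_k h ⊗ e_k` given by coisometries `V_k` with complementary initial
spaces. -/
theorem exists_unitary (V : Fin n → L2 Ω →L[ℂ] L2 Ω)
    (hV : ∀ j k, V j * star (V k) = if j = k then 1 else 0) (hV1 : ∑ k, star (V k) * V k = 1) :
    ∃ U : L2 Ω ≃ₗᵢ[ℂ] L2 Ω ⊗[ℂ] Cn n,
      ∀ h, U h = ∑ k, V k h ⊗ₜ[ℂ] (EuclideanSpace.single k 1 : Cn n) := by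
  have hV' : ∀ j k (h : L2 Ω), V j (star (V k) h) = if j = k then h else 0 := fun j k h => by
    rw [← Bessel.op_mul_apply, hV]
    split_ifs <;> simp
  have hV1' : ∀ h : L2 Ω, ∑ k, star (V k) (V k h) = h := fun h => by
    simpa using DFunLike.congr_fun hV1 h
  let F : L2 Ω →ₗ[ℂ] L2 Ω ⊗[ℂ] Cn n :=
    ∑ k, (TensorProduct.mk ℂ (L2 Ω) (Cn n)).flip (EuclideanSpace.single k 1) ∘ₗ
      (V k : L2 Ω →ₗ[ℂ] L2 Ω)
  have hF : ∀ h, F h = ∑ k, V k h ⊗ₜ[ℂ] (EuclideanSpace.single k 1 : Cn n) := fun h => by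
    simp [F]
  -- The inverse, h ⊗ v ↦ ∑ v_k V_k* h. Having it explicitly gives surjectivity onto the algebraic
  -- tensor product, so no completion is involved.
  let G : L2 Ω ⊗[ℂ] Cn n →ₗ[ℂ] L2 Ω := TensorProduct.lift
    (LinearMap.mk₂ ℂ (fun (h : L2 Ω) (v : Cn n) => ∑ k, v k • star (V k) h)
      (fun _ _ _ => by simp [Finset.sum_add_distrib])
      (fun c h v => by
        rw [Finset.smul_sum]
        exact Finset.sum_congr rfl fun k _ => by rw [map_smul, smul_comm])
      (fun _ _ _ => by simp [add_smul, Finset.sum_add_distrib])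
      (fun _ _ _ => by simp [Finset.smul_sum, mul_smul]))
  have hG : ∀ h v, G (h ⊗ₜ v) = ∑ k, v k • star (V k) h := fun h v => rfl
  have hGF : ∀ h, G (F h) = h := fun h => by
    rw [hF, map_sum]
    simp only [hG]
    conv_rhs => rw [← hV1' h]
    refine Finset.sum_congr rfl fun k _ => ?_
    rw [Finset.sum_eq_single k] <;> simp +contextual
  have hFG : F ∘ₗ G = LinearMap.id := by
    refine TensorProduct.ext' fun h v => ?_
    rw [LinearMap.comp_apply, hG, hF, LinearMap.id_apply]
    have hv : v = ∑ k, v k • (EuclideanSpace.single k 1 : Cn n) := by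
      ext i
      simp [Pi.single_apply]
    conv_rhs => rw [hv]
    rw [TensorProduct.tmul_sum]
    refine Finset.sum_congr rfl fun k _ => ?_
    simp [map_sum, hV', TensorProduct.smul_tmul]
  let E : L2 Ω ≃ₗ[ℂ] L2 Ω ⊗[ℂ] Cn n :=
    LinearEquiv.ofLinearMap F G hFG (LinearMap.ext hGF)
  refine ⟨E.isometryOfInner fun h g => ?_, hF⟩
  change inner ℂ (F h) (F g) = inner ℂ h g
  rw [hF, hF, sum_inner]
  simp only [inner_sum, TensorProduct.inner_tmul]
  conv_rhs => rw [← hV1' g, inner_sum]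
  refine Finset.sum_congr rfl fun k _ => ?_
  rw [Finset.sum_eq_single k]
  · rw [ContinuousLinearMap.star_eq_adjoint, ContinuousLinearMap.adjoint_inner_right]
    simp
  · intro l _ hl
    rw [EuclideanSpace.inner_single_left]
    simp [hl.symm]
  · simp

theorem exists_linearMap_lift {A M : Type*} [AddCommGroup A] [Module ℂ A] [AddCommGroup M]
    [Module ℂ M] (j : A →ₗ[ℂ] M) (hj : Function.Injective j) (L : M →ₗ[ℂ] M)
    (h : ∀ a, ∃ a', j a' = L (j a)) : ∃ l : A →ₗ[ℂ] A, ∀ a, j (l a) = L (j a) := by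
  choose l hl using h
  exact ⟨⟨⟨l, fun a b => hj (by simp [hl])⟩, fun c a => hj (by simp [hl])⟩, hl⟩

theorem tensorOp_tmul {A : Type*} [AddCommGroup A] [Module ℂ A]
    (j : A →ₗ[ℂ] (L2 Ω →L[ℂ] L2 Ω)) (a : A) (m : Mn n) (h : L2 Ω) (v : Cn n) :
    tensorOp j n (a ⊗ₜ m) (h ⊗ₜ v) = j a h ⊗ₜ Matrix.toEuclideanLin m v := rfl

/-- An algebra of operators which is invariant under `T ↦ V_j T V_k*` and `T ↦ V_j* T V_k` is
isomorphic to its own amplification by `M_n`, spatially. -/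
theorem exists_starAlgEquiv {A : Type*} [NonUnitalRing A] [StarRing A] [Module ℂ A]
    [IsScalarTower ℂ A A] [SMulCommClass ℂ A A] [StarModule ℂ A]
    (j : A →ₗ[ℂ] (L2 Ω →L[ℂ] L2 Ω)) (hj : Function.Injective j)
    (hmul : ∀ a b, j (a * b) = j a * j b) (hstar : ∀ a, j (star a) = star (j a))
    (V : Fin n → L2 Ω →L[ℂ] L2 Ω)
    (hV : ∀ j k, V j * star (V k) = if j = k then 1 else 0) (hV1 : ∑ k, star (V k) * V k = 1)
    (h1 : ∀ k l a, ∃ a', j a' = V k * j a * star (V l))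
    (h2 : ∀ k l a, ∃ a', j a' = star (V k) * j a * V l)
    (U : L2 Ω ≃ₗᵢ[ℂ] L2 Ω ⊗[ℂ] Cn n)
    (hU : ∀ h, U h = ∑ k, V k h ⊗ₜ[ℂ] (EuclideanSpace.single k 1 : Cn n)) :
    conjBy U '' Set.range j = Set.range (tensorOp j n) ∧
      ∃ Φ : A ≃⋆ₐ[ℂ] A ⊗[ℂ] Mn n, ∀ T, tensorOp j n (Φ T) = conjBy U (j T) := by
  have hL : ∀ X Y : L2 Ω →L[ℂ] L2 Ω, ∃ L : (L2 Ω →L[ℂ] L2 Ω) →ₗ[ℂ] (L2 Ω →L[ℂ] L2 Ω),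
      ∀ T, L T = X * T * Y := fun X Y =>
    ⟨LinearMap.mulRight ℂ Y ∘ₗ LinearMap.mulLeft ℂ X, fun T => rfl⟩
  have h1' : ∀ k l, ∃ f : A →ₗ[ℂ] A, ∀ a, j (f a) = V k * j a * star (V l) := fun k l => by
    obtain ⟨L, hL⟩ := hL (V k) (star (V l))
    simp only [← hL] at h1 ⊢
    exact exists_linearMap_lift j hj L (by simpa only [hL] using h1 k l)
  have h2' : ∀ k l, ∃ f : A →ₗ[ℂ] A, ∀ a, j (f a) = star (V k) * j a * V l := fun k l => by
    obtain ⟨L, hL⟩ := hL (star (V k)) (V l)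
    simp only [← hL]
    exact exists_linearMap_lift j hj L (by simpa only [hL] using h2 k l)
  choose α hα using h1'
  choose β hβ using h2'
  let F : A →ₗ[ℂ] A ⊗[ℂ] Mn n :=
    ∑ k, ∑ l, (TensorProduct.mk ℂ A (Mn n)).flip (Matrix.single k l 1) ∘ₗ α k l
  have hF : ∀ a, F a = ∑ k, ∑ l, α k l a ⊗ₜ[ℂ] (Matrix.single k l 1 : Mn n) := fun a => by
    simp [F]
  let G : A ⊗[ℂ] Mn n →ₗ[ℂ] A := TensorProduct.lift
    (LinearMap.mk₂ ℂ (fun (a : A) (m : Mn n) => ∑ k, ∑ l, m k l • β k l a)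
      (fun _ _ _ => by simp [Finset.sum_add_distrib])
      (fun c h v => by
        simp only [Finset.smul_sum]
        exact Finset.sum_congr rfl fun k _ => Finset.sum_congr rfl fun l _ => by
          rw [map_smul, smul_comm])
      (fun _ _ _ => by simp [add_smul, Finset.sum_add_distrib])
      (fun _ _ _ => by simp [Finset.smul_sum, mul_smul]))
  have hG : ∀ a m, G (a ⊗ₜ m) = ∑ k, ∑ l, m k l • β k l a := fun a m => rfl
  have hjG : ∀ a m, j (G (a ⊗ₜ m)) = ∑ k, ∑ l, m k l • (star (V k) * j a * V l) := fun a m => by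
    simp [hG, hβ]
  -- The (k, l) matrix entry of the operator assigned to a ⊗ m is m_kl a, by the relations V_j V_k*
  -- = δ_jk.
  have hkey : ∀ a m k l, V k * j (G (a ⊗ₜ m)) * star (V l) = m k l • j a := fun a m k l => by
    rw [hjG, Finset.mul_sum, Finset.sum_mul, Finset.sum_eq_single k]
    · rw [Finset.mul_sum, Finset.sum_mul, Finset.sum_eq_single l]
      · rw [mul_smul_comm, smul_mul_assoc, mul_assoc, mul_assoc, hV, ← mul_assoc, ← mul_assoc, hV]
        simp
      · intro q _ hq
        rw [mul_smul_comm, smul_mul_assoc, mul_assoc, mul_assoc, hV]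
        simp [hq]
      · simp
    · intro p _ hp
      rw [Finset.mul_sum, Finset.sum_mul]
      refine Finset.sum_eq_zero fun q _ => ?_
      rw [mul_smul_comm, ← mul_assoc, ← mul_assoc, hV]
      simp [hp.symm]
    · simp
  have hins : ∀ X Y : L2 Ω →L[ℂ] L2 Ω, X * Y = ∑ k, X * star (V k) * (V k * Y) := fun X Y => by
    calc X * Y = X * (∑ k, star (V k) * V k) * Y := by rw [hV1, mul_one]
      _ = _ := by
        rw [Finset.mul_sum, Finset.sum_mul]
        simp only [mul_assoc]
  -- An operator is determined by its matrix entries, since ∑ V_k* V_k = 1 can be inserted on either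
  -- side.
  have hext : ∀ X Y : L2 Ω →L[ℂ] L2 Ω,
      (∀ k l, V k * X * star (V l) = V k * Y * star (V l)) → X = Y := fun X Y h => by
    have h3 : ∀ k, V k * X = V k * Y := fun k => by
      rw [← mul_one (V k * X), ← mul_one (V k * Y), hins, hins (V k * Y)]
      simp only [h]
    rw [← one_mul X, ← one_mul Y, hins, hins 1 Y]
    simp only [h3]
  have hGF : ∀ a, G (F a) = a := fun a => hj <| hext _ _ fun k l => by
    rw [hF, map_sum, map_sum, Finset.mul_sum, Finset.sum_mul, Finset.sum_eq_single k]
    · rw [map_sum, map_sum, Finset.mul_sum, Finset.sum_mul, Finset.sum_eq_single l]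
      · rw [hkey, hα]
        simp
      · intro q _ hq
        rw [hkey]
        simp [hq]
      · simp
    · intro p _ hp
      rw [map_sum, map_sum, Finset.mul_sum, Finset.sum_mul]
      refine Finset.sum_eq_zero fun q _ => ?_
      rw [hkey]
      simp [hp]
    · simp
  have hFG : F ∘ₗ G = LinearMap.id := by
    refine TensorProduct.ext' fun a m => ?_
    have h3 : ∀ k l, α k l (G (a ⊗ₜ m)) = m k l • a := fun k l => hj (by
      rw [hα, hkey, map_smul])
    rw [LinearMap.comp_apply, hF, LinearMap.id_apply]
    conv_rhs => rw [Matrix.matrix_eq_sum_single m]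
    rw [TensorProduct.tmul_sum]
    refine Finset.sum_congr rfl fun k _ => ?_
    rw [TensorProduct.tmul_sum]
    refine Finset.sum_congr rfl fun l _ => ?_
    rw [h3, TensorProduct.smul_tmul, Matrix.smul_single, smul_eq_mul, mul_one]
  -- Products and adjoints are checked for the inverse map G, which is explicit on pure tensors, and
  -- are transferred to F through the injectivity of G.
  have hGmul : ∀ x y, G (x * y) = G x * G y := fun x y => by
    induction x with
    | zero => simp
    | add x₁ x₂ h₁ h₂ => rw [add_mul, map_add, map_add, h₁, h₂, add_mul]
    | tmul a m =>
      induction y with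
      | zero => simp
      | add y₁ y₂ h₁ h₂ => rw [mul_add, map_add, map_add, h₁, h₂, mul_add]
      | tmul b m' =>
        refine hj (hext _ _ fun k l => ?_)
        have h3 : ∀ X Y : L2 Ω →L[ℂ] L2 Ω, V k * (X * Y) * star (V l) =
            ∑ i, V k * X * star (V i) * (V i * Y * star (V l)) := fun X Y => by
          rw [← mul_assoc, mul_assoc, hins]
          simp only [mul_assoc]
        rw [Algebra.TensorProduct.tmul_mul_tmul, hkey, hmul (G _), h3, Matrix.mul_apply,
          Finset.sum_smul, hmul]
        exact Finset.sum_congr rfl fun i _ => by rw [hkey, hkey, smul_mul_smul_comm]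
  have hGstar : ∀ x, G (star x) = star (G x) := fun x => by
    induction x with
    | zero => simp
    | add x₁ x₂ h₁ h₂ => rw [star_add, map_add, map_add, h₁, h₂, star_add]
    | tmul a m =>
      refine hj (hext _ _ fun k l => ?_)
      have h3 := congrArg star (hkey a m l k)
      rw [star_mul, star_mul, star_star, ← mul_assoc, star_smul] at h3
      rw [TensorProduct.star_tmul, hkey, hstar, hstar, h3, Matrix.star_apply]
  have hspatial : ∀ x, tensorOp j n x = conjBy U (j (G x)) := by
    have h3 : ∀ x g, tensorOp j n x (U g) = U (j (G x) g) := fun x g => by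
      induction x with
      | zero => simp
      | add x₁ x₂ h₁ h₂ => simp only [map_add, LinearMap.add_apply, h₁, h₂,
          add_apply]
      | tmul a m =>
        have h4 : ∀ l, V l (j (G (a ⊗ₜ m)) g) = ∑ k, m l k • j a (V k g) := fun l => by
          have h5 := hins (V l * j (G (a ⊗ₜ m))) 1
          simp only [hkey, mul_one] at h5
          simpa [sum_apply] using DFunLike.congr_fun h5 g
        have h6 : ∀ k, Matrix.toEuclideanLin m (EuclideanSpace.single k 1) =
            ∑ l, m l k • (EuclideanSpace.single l 1 : Cn n) := fun k => by
          ext i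
          simp [Matrix.toLpLin_apply, Pi.single_apply]
        rw [hU, hU, map_sum]
        simp only [tensorOp_tmul, h4, h6, TensorProduct.sum_tmul, TensorProduct.tmul_sum]
        rw [Finset.sum_comm]
        simp only [TensorProduct.smul_tmul]
    intro x
    refine LinearMap.ext fun y => ?_
    obtain ⟨g, rfl⟩ := U.surjective y
    rw [h3]
    change _ = U (j (G x) (U.symm (U g)))
    rw [U.symm_apply_apply]
  have hFG' : ∀ x, F (G x) = x := fun x => LinearMap.congr_fun hFG x
  have hinj : Function.Injective G := Function.LeftInverse.injective hFG'
  constructor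
  · ext X
    constructor
    · rintro ⟨_, ⟨a, rfl⟩, rfl⟩
      exact ⟨F a, by rw [hspatial, hGF]⟩
    · rintro ⟨x, rfl⟩
      exact ⟨j (G x), ⟨G x, rfl⟩, (hspatial x).symm⟩
  · exact ⟨{ toFun := F
             invFun := G
             left_inv := hGF
             right_inv := hFG'
             map_mul' := fun a b => hinj (by simp only [hGmul, hGF])
             map_add' := map_add F
             map_star' := fun a => hinj (by simp only [hGstar, hGF])
             map_smul' := map_smul F }, fun T => by
      change tensorOp j n (F T) = _
      rw [hspatial, hGF]⟩

end ELam

/-! ### Amplification of the two algebras. -/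

namespace ELam

theorem EL_amplification {n : ℕ} {Ω : Set ℂ} (V : Fin n → L2 Ω →L[ℂ] L2 Ω)
    (hV : ∀ j k, V j * star (V k) = if j = k then 1 else 0) (hV1 : ∑ k, star (V k) * V k = 1)
    (hE : ∀ k, V k ∈ EL Ω) (U : L2 Ω ≃ₗᵢ[ℂ] L2 Ω ⊗[ℂ] Cn n)
    (hU : ∀ h, U h = ∑ k, V k h ⊗ₜ[ℂ] (EuclideanSpace.single k 1 : Cn n)) :
    conjBy U '' (EL Ω : Set (L2 Ω →L[ℂ] L2 Ω)) = Set.range (ELtensorOp Ω n) ∧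
      ∃ Φ : EL Ω ≃⋆ₐ[ℂ] EL Ω ⊗[ℂ] Mn n, ∀ T : EL Ω, ELtensorOp Ω n (Φ T) = conjBy U T := by
  have h := exists_starAlgEquiv (EL Ω).subtype.toAlgHom.toLinearMap
    Subtype.val_injective (fun _ _ => rfl) (fun _ => rfl) V hV hV1
    (fun k l a => ⟨⟨_, mul_mem (mul_mem (hE k) a.2) (star_mem (hE l))⟩, rfl⟩)
    (fun k l a => ⟨⟨_, mul_mem (mul_mem (star_mem (hE k)) a.2) (hE l)⟩, rfl⟩) U hU
  have hr : Set.range (EL Ω).subtype.toAlgHom.toLinearMap = (EL Ω : Set (L2 Ω →L[ℂ] L2 Ω)) :=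
    Subtype.range_coe
  rw [hr] at h
  exact h

/-- The V_k are not assumed to lie in EΛ(Ω)₀, so its invariance under two-sided multiplication by
them is a hypothesis rather than closure under products. -/
theorem EL0_amplification {n : ℕ} {Ω : Set ℂ} (V : Fin n → L2 Ω →L[ℂ] L2 Ω)
    (hV : ∀ j k, V j * star (V k) = if j = k then 1 else 0) (hV1 : ∑ k, star (V k) * V k = 1)
    (h1 : ∀ k l T, T ∈ EL0 Ω → V k * T * star (V l) ∈ EL0 Ω)
    (h2 : ∀ k l T, T ∈ EL0 Ω → star (V k) * T * V l ∈ EL0 Ω)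
    (U : L2 Ω ≃ₗᵢ[ℂ] L2 Ω ⊗[ℂ] Cn n)
    (hU : ∀ h, U h = ∑ k, V k h ⊗ₜ[ℂ] (EuclideanSpace.single k 1 : Cn n)) :
    conjBy U '' (EL0 Ω : Set (L2 Ω →L[ℂ] L2 Ω)) = Set.range (EL0tensorOp Ω n) ∧
      ∃ Φ : EL0 Ω ≃⋆ₐ[ℂ] EL0 Ω ⊗[ℂ] Mn n, ∀ T : EL0 Ω, EL0tensorOp Ω n (Φ T) = conjBy U T := by
  have h := exists_starAlgEquiv (A := EL0 Ω)
    ((EL0 Ω).toNonUnitalSubalgebra.toSubmodule.subtype)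
    Subtype.val_injective (fun _ _ => rfl) (fun _ => rfl) V hV hV1
    (fun k l a => ⟨⟨_, h1 k l _ a.2⟩, rfl⟩) (fun k l a => ⟨⟨_, h2 k l _ a.2⟩, rfl⟩) U hU
  have hr : Set.range ((EL0 Ω).toNonUnitalSubalgebra.toSubmodule.subtype) =
      (EL0 Ω : Set (L2 Ω →L[ℂ] L2 Ω)) := Subtype.range_coe
  rw [hr] at h
  exact h

end ELam

/-! ### Cellular coisometries and the conclusion. -/

namespace ELam

theorem exists_cellular_coisometries {Ω : Set ℂ} (hΩ : MeasurableSet Ω) {n : ℕ} (hn : 1 ≤ n) :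
    ∃ V : Fin n → L2 Ω →L[ℂ] L2 Ω, (∀ k, IsCellular (V k)) ∧
      (∀ j k, V j * star (V k) = if j = k then 1 else 0) ∧ ∑ k, star (V k) * V k = 1 := by
  obtain ⟨R, W, hR, hW, hRW, hCR, hCW⟩ := exists_cellular_isometries hΩ
  obtain ⟨n, rfl⟩ := Nat.exists_eq_add_of_le' hn
  exact exists_complementary_isometries IsCellular IsCellular.one (fun _ _ => IsCellular.mul)
    (fun _ => IsCellular.star) hR hW hRW hCR hCW n

end ELam

theorem mainTheorem9 (n : ℕ) (hn : 1 ≤ n) (Ω : Set ℂ) (hΩ : MeasurableSet Ω) :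
    ∃ (V : Fin n → ELam.EL Ω) (U : ELam.L2 Ω ≃ₗᵢ[ℂ] ELam.L2 Ω ⊗[ℂ] ELam.Cn n),
      (∀ h : ELam.L2 Ω, U h = ∑ k, (V k : ELam.L2 Ω →L[ℂ] ELam.L2 Ω) h ⊗ₜ[ℂ]
        (EuclideanSpace.single k 1 : ELam.Cn n)) ∧
      (ELam.conjBy U '' (ELam.EL Ω : Set (ELam.L2 Ω →L[ℂ] ELam.L2 Ω)) =
        Set.range (ELam.ELtensorOp Ω n)) ∧
      (∃ Φ : ELam.EL Ω ≃⋆ₐ[ℂ] ELam.EL Ω ⊗[ℂ] ELam.Mn n,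
        ∀ T : ELam.EL Ω, ELam.ELtensorOp Ω n (Φ T) = ELam.conjBy U T) ∧
      (Ω = Set.univ →
        (ELam.conjBy U '' (ELam.EL0 Ω : Set (ELam.L2 Ω →L[ℂ] ELam.L2 Ω)) =
          Set.range (ELam.EL0tensorOp Ω n)) ∧
        (∃ Ψ : ELam.EL0 Ω ≃⋆ₐ[ℂ] ELam.EL0 Ω ⊗[ℂ] ELam.Mn n,
          ∀ T : ELam.EL0 Ω, ELam.EL0tensorOp Ω n (Ψ T) = ELam.conjBy U T)) := by
  obtain ⟨V, hC, hV, hV1⟩ := ELam.exists_cellular_coisometries hΩ hn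
  obtain ⟨U, hU⟩ := ELam.exists_unitary V hV hV1
  have hE : ∀ k, V k ∈ ELam.EL Ω := fun k => (hC k).mem_EL hΩ
  obtain ⟨h1, h2⟩ := ELam.EL_amplification V hV hV1 hE U hU
  refine ⟨fun k => ⟨V k, hE k⟩, U, hU, h1, h2, ?_⟩
  rintro rfl
  exact ELam.EL0_amplification V hV hV1
    (fun k l _ hT => ELam.mul_EL0_mul (hC k) (hC l).star hT)
    (fun k l _ hT => ELam.mul_EL0_mul (hC k).star (hC l) hT) U hU

end
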